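/- Let $(E,\rho)$ be a metric space in which every closed ball is compact, with Borel $\sigma$-algebra, and let $(X(t))_{t\ge 0}$, with laws $(\mathbb P^x)_{x\in E}$, be a (conservative) standard Markov process on $E$: a strong Markov process with $X(0)=x$ $\mathbb P^x$-a.s., with càdlàg paths in $E$, quasi-left-continuous, whose filtration is complete and right-continuous. Assume the weak Feller property $P_t\mathcal C_0\subseteq\mathcal C_0$ for $t\ge 0$, where $P_th(x)=\mathbb E^x\{h(X(t))\}$ and $\mathcal C_0$ is the space of continuous functions $E\to\mathbb R$ vanishing at infinity. Let $\mathcal O\subseteq E$ be open, $\tau_{\mathcal O}=\inf\{t\ge 0: X(t)\notin\mathcal O\}$, let $\alpha>0$, and let $f,G,H:[0,\infty)\times E\to\mathbb R$ be continuous and bounded. Assume (A1) for every $t>0$, the operator $h\mapsto \mathbb E^{\,\cdot}\{\mathbf 1_{\{t<\tau_{\mathcal O}\}}h(X(t))\}$ maps the space of continuous bounded functions on $E$ into itself. For a stopping time $\tau$ with values in $[0,\infty]$ put $$J(s,x,\tau)=\mathbb E^x\Big\{\int_0^{\tau\wedge\tau_{\mathcal O}}e^{-\alpha u}f(s+u,X(u))\,du+\mathbf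 1_{\{\tau<\tau_{\mathcal O}\}}e^{-\alpha\tau}G(s+\tau,X(\tau))+\mathbf 1_{\{\tau\ge\tau_{\mathcal O}\}}e^{-\alpha\tau_{\mathcal O}}H(s+\tau_{\mathcal O},X(\tau_{\mathcal O}))\Big\},$$ where terms discounted at an infinite time are $0$, and let $w(s,x)=\sup_\tau J(s,x,\tau)$, the supremum being over all stopping times; it is finite. Then for every $\beta>0$ there is exactly one bounded measurable function $w^\beta:[0,\infty)\times E\to\mathbb R$ such that for all $(s,x)$ $$w^\beta(s,x)=\mathbb E^x\Big\{\int_0^{\tau_{\mathcal O}}e^{-\alpha u}\Big[f(s+u,X(u))+\beta\big(G(s+u,X(u))-w^\beta(s+u,X(u))\big)^+\Big]du+e^{-\alpha\tau_{\mathcal O}}H(s+\tau_{\mathcal O},X(\tau_{\mathcal O}))\Big\}.$$ Moreover: 1. $w^\beta(s,x)$ is nondecreasing in $\beta$ and $w^\beta(s,x)\to w(s,x)$ as $\beta\to\infty$, for every $(s,x)\in[0,\infty)\times E$. 2. $w$ is lower semicontinuous on $[0,\infty)\times E$. 3. If $w$ is continuous, then $w^\beta\to w$ as $\beta\to\infty$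 uniformly on compact subsets of $[0,\infty)\times E$. -/

import Mathlib

open MeasureTheory Filter Topology Set
open scoped NNReal ENNReal BoundedContinuousFunction ZeroAtInfty

noncomputable section

/-- A (conservative) standard Markov process with state space `E`, realised on `Ω`: a normal strong
Markov process with càdlàg paths which is quasi-left-continuous, together with a complete and
right-continuous filtration. `P x` is the law of the process started at `x`. -/
structure StandardMarkovProcess (E Ω : Type*) [MetricSpace E] [MeasurableSpace E]
    [MeasurableSpace Ω] where
  /-- the probability measures `P^x` -/
  P : E → Measure Ω
  isProbabilityMeasure : ∀ x, IsProbabilityMeasure (P x)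
  /-- the filtration -/
  filt : Filtration ℝ≥0 (inferInstance : MeasurableSpace Ω)
  /-- the process -/
  X : ℝ≥0 → Ω → E
  adapted : ∀ t, Measurable[filt t] (X t)
  /-- under `P^x` the process starts at `x` -/
  start : ∀ x, ∀ᵐ ω ∂(P x), X 0 ω = x
  measurable_transition : ∀ (t : ℝ≥0) (B : Set E), MeasurableSet B →
    Measurable fun x => P x {ω | X t ω ∈ B}
  /-- strong Markov property: on `{τ < ∞}`, the conditional probability of `X (τ + t) ∈ B`
  given the σ-algebra of events before `τ` is `P^{X τ} (X t ∈ B)` -/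
  strong_markov : ∀ (τ : Ω → WithTop ℝ≥0) (hτ : IsStoppingTime filt τ) (t : ℝ≥0) (B : Set E),
    MeasurableSet B → ∀ A : Set Ω, MeasurableSet[hτ.measurableSpace] A → ∀ x,
      P x (A ∩ {ω | τ ω ≠ ⊤ ∧ X ((τ ω).untopA + t) ω ∈ B}) =
        ∫⁻ ω in A ∩ {ω | τ ω ≠ ⊤}, P (stoppedValue X τ ω) {ω' | X t ω' ∈ B} ∂(P x)
  right_continuous_paths : ∀ ω t, ContinuousWithinAt (fun u => X u ω) (Ici t) t
  left_limits : ∀ ω t, ∃ y, Tendsto (fun u => X u ω) (𝓝[<] t) (𝓝 y)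
  /-- if stopping times `T n` increase to `S`, then `X (T n) → X S` a.s. on `{S < ∞}` -/
  quasi_left_continuous : ∀ (T : ℕ → Ω → WithTop ℝ≥0) (S : Ω → WithTop ℝ≥0),
    (∀ n, IsStoppingTime filt (T n)) → (∀ ω, Monotone fun n => T n ω) →
    (∀ ω, IsLUB (range fun n => T n ω) (S ω)) → ∀ x, ∀ᵐ ω ∂(P x), S ω ≠ ⊤ →
      Tendsto (fun n => stoppedValue X (T n) ω) atTop (𝓝 (stoppedValue X S ω))
  right_continuous_filtration : filt.IsRightContinuous
  /-- completeness: every subset of an event that is null under all the laws `P^x` belongs to the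
  filtration from time `0` on -/
  complete_filtration : ∀ A N : Set Ω, MeasurableSet N → A ⊆ N → (∀ x, P x N = 0) →
    MeasurableSet[filt 0] A

/-- The discount factor `exp (-α t)` for `t ∈ [0, ∞]`, equal to `0` at `t = ∞` (used for `α > 0`). -/
def discount (α : ℝ) : WithTop ℝ≥0 → ℝ
  | ⊤ => 0
  | (t : ℝ≥0) => Real.exp (-α * t)

namespace StandardMarkovProcess

variable {E Ω : Type*} [MetricSpace E] [MeasurableSpace E] [MeasurableSpace Ω]

/-- The weak Feller property `P_t C₀ ⊆ C₀`. -/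
def WeakFeller (M : StandardMarkovProcess E Ω) : Prop :=
  ∀ (t : ℝ≥0) (h : C₀(E, ℝ)), ∃ g : C₀(E, ℝ), ∀ x, g x = ∫ ω, h (M.X t ω) ∂(M.P x)

/-- The first exit time `inf {t ≥ 0 : X t ∉ O}`, equal to `⊤` if the path never leaves `O`. -/
def exitTime (M : StandardMarkovProcess E Ω) (O : Set E) : Ω → WithTop ℝ≥0 :=
  hittingAfter M.X Oᶜ 0

/-- The stopped semigroup `P_t^{τ_O} h (x) = E^x [1_{t < τ_O} h (X t)]`. -/
def stoppedSemigroup (M : StandardMarkovProcess E Ω) (O : Set E) (t : ℝ≥0) (h : E → ℝ) (x : E) :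
    ℝ :=
  ∫ ω, {ω | (t : WithTop ℝ≥0) < M.exitTime O ω}.indicator (fun ω => h (M.X t ω)) ω ∂(M.P x)

/-- For every `t > 0` the operator `P_t^{τ_O}` maps bounded continuous functions to bounded
continuous functions. -/
def StoppedFeller (M : StandardMarkovProcess E Ω) (O : Set E) : Prop :=
  ∀ t : ℝ≥0, 0 < t → ∀ h : E →ᵇ ℝ, ∃ g : E →ᵇ ℝ, ∀ x, g x = M.stoppedSemigroup O t h x

/-- The pathwise integral `∫_0^T exp (-α u) g (s + u, X u) du`, where `T ∈ [0, ∞]`. -/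
def runningIntegral (M : StandardMarkovProcess E Ω) (α : ℝ) (g : ℝ≥0 × E → ℝ) (s : ℝ≥0)
    (T : WithTop ℝ≥0) (ω : Ω) : ℝ :=
  ∫ u in {u : ℝ | 0 < u ∧ ((u.toNNReal : ℝ≥0) : WithTop ℝ≥0) < T},
    Real.exp (-α * u) * g (s + u.toNNReal, M.X u.toNNReal ω)

/-- The discounted terminal payoff `exp (-α τ) g (s + τ, X τ)`, equal to `0` where `τ = ∞`. -/
def terminalPayoff (M : StandardMarkovProcess E Ω) (α : ℝ) (g : ℝ≥0 × E → ℝ) (s : ℝ≥0)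
    (τ : Ω → WithTop ℝ≥0) (ω : Ω) : ℝ :=
  discount α (τ ω) * g (s + (τ ω).untopA, stoppedValue M.X τ ω)

open Classical in
/-- The functional
`J(s,x,τ) = E^x [∫_0^{τ ∧ τ_O} exp (-α u) f(s+u, X u) du + 1_{τ < τ_O} exp (-α τ) G(s+τ, X τ)
  + 1_{τ ≥ τ_O} exp (-α τ_O) H(s+τ_O, X τ_O)]`. -/
def payoff (M : StandardMarkovProcess E Ω) (O : Set E) (α : ℝ) (f G H : ℝ≥0 × E → ℝ)
    (s : ℝ≥0) (x : E) (τ : Ω → WithTop ℝ≥0) : ℝ :=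
  ∫ ω, (M.runningIntegral α f s (min (τ ω) (M.exitTime O ω)) ω +
    if τ ω < M.exitTime O ω then M.terminalPayoff α G s τ ω
    else M.terminalPayoff α H s (M.exitTime O) ω) ∂(M.P x)

/-- The value function `w(s,x) = sup_τ J(s,x,τ)`, the supremum being over all stopping times. -/
def value (M : StandardMarkovProcess E Ω) (O : Set E) (α : ℝ) (f G H : ℝ≥0 × E → ℝ)
    (z : ℝ≥0 × E) : ℝ :=
  sSup {r | ∃ τ, IsStoppingTime M.filt τ ∧ r = M.payoff O α f G H z.1 z.2 τ}

/-- `u` is a bounded measurable solution of the penalized equation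
`u(s,x) = E^x [∫_0^{τ_O} exp (-α r) (f + β (G - u)^+)(s+r, X r) dr
  + exp (-α τ_O) H(s+τ_O, X τ_O)]`. -/
def IsPenalizedSolution (M : StandardMarkovProcess E Ω) (O : Set E) (α : ℝ)
    (f G H : ℝ≥0 × E → ℝ) (β : ℝ) (u : ℝ≥0 × E → ℝ) : Prop :=
  Measurable u ∧ (∃ C, ∀ z, |u z| ≤ C) ∧
    ∀ s x, u (s, x) =
      ∫ ω, (M.runningIntegral α (fun z => f z + β * max (G z - u z) 0) s (M.exitTime O ω) ω +
        M.terminalPayoff α H s (M.exitTime O) ω) ∂(M.P x)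

end StandardMarkovProcess

end

/-! Work with the space-time process (s + t, X t) killed on leaving `O`. Write R_γ for its resolvent
(`resolvent O γ`), U_γ for the unkilled one (`resolvent univ γ`) and h_γ for `exitValue O γ H`. The
penalized equation reads u = R_α(f + β(G - u)⁺) + h_α. The resolvent identity for R and its analogue
for h (`resolvent_identity`, `exitValue_identity`) move β u into the discount; since (G - u)⁺ + u =
max(G, u), the equation is equivalent to u = R_{α+β}(f + β max(G, u)) + h_{α+β}
(`isPenalizedSolution_iff_add`). The right side is monotone in u and contracts the sup norm by
β/(α+β). This gives a fixed point among bounded continuous functions, uniqueness among bounded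
measurable ones, and monotonicity in β.

The fixed point argument needs R_γ and h_γ to preserve continuity. For R_γ this is (A1), extended to
space-time functions. For h_γ, which (A1) does not mention, Dynkin's formula gives E[e^{-ατ_O} (U_α
g)(exit point)] = U_α g - R_α g, continuous for continuous g. The functions γU_γψ with ψ compactly
supported lie in the range of U_α, vanish at infinity and converge boundedly to ψ; vague compactness
then makes the discounted exit laws vaguely continuous in the starting point. Their masses are
continuous because 1 = U_α α, so they are weakly continuous (`WeakFeller.continuous_exitValue`).

The link with stopping is Dynkin's formula `resolvent_add_exitValue_eq_payoff`: w^β is the payoff,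
for any stopping time, with running reward f + β(G - w^β)⁺, stopping reward w^β and exit reward H.
Stopping when w^β first falls below G + ε, there is no penalty beforehand, so w^β ≤ J + ε and w^β ≤
w. Conversely, for every τ, w^β dominates the payoff with stopping reward min(G, w^β). Inside `O`
this reward tends to G, because w^β ≥ R_{α+β}(f + βG) + h_{α+β} and γR_γG → G; bounded convergence
gives liminf w^β ≥ J(τ). Thus w is an increasing limit of continuous functions, hence lower
semicontinuous, and Dini's theorem gives the uniform statement.

All of this rests on the strong Markov property of the killed process (`measure_add_lt_exitTime`).
By quasi-left-continuity τ_O is announced by hitting times of shrinking neighbourhoods of `Oᶜ`, so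
{t < τ_O} is, up to a null set, a countable union of events "X avoids an open set on [0, t]"; these
are limits of events on dyadic time grids, to which the Markov property applies step by step. -/

/-! ### Dyadic discretisation of time and hitting times of right-continuous processes -/

/-- The `k`-th positive dyadic number of level `n`. -/
noncomputable def dyadicStep (n k : ℕ) : ℝ≥0 := (k + 1) / 2 ^ n

/-- The dyadic time of level `n` immediately to the right of `t`. -/
noncomputable def dyadicRight (n : ℕ) (t : ℝ≥0) : ℝ≥0 := dyadicStep n ⌊t * 2 ^ n⌋₊

lemma lt_dyadicRight (n : ℕ) (t : ℝ≥0) : t < dyadicRight n t := by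
  rw [dyadicRight, dyadicStep, lt_div_iff₀ (by positivity)]
  exact Nat.lt_floor_add_one _

lemma dyadicRight_le (n : ℕ) (t : ℝ≥0) : dyadicRight n t ≤ t + 1 / 2 ^ n := by
  rw [dyadicRight, dyadicStep, add_div]
  gcongr
  rw [div_le_iff₀ (by positivity)]
  exact Nat.floor_le (by positivity)

lemma tendsto_dyadicRight (t : ℝ≥0) : Tendsto (fun n => dyadicRight n t) atTop (𝓝 t) := by
  have h : Tendsto (fun n : ℕ => t + 1 / 2 ^ n) atTop (𝓝 (t + 0)) := by
    refine tendsto_const_nhds.add ?_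
    have := tendsto_pow_atTop_nhds_zero_of_lt_one (r := (1 / 2 : ℝ≥0)) (by positivity)
      (by rw [div_lt_one (by norm_num)]; norm_num)
    simpa [div_pow] using this
  rw [add_zero] at h
  exact tendsto_of_tendsto_of_tendsto_of_le_of_le tendsto_const_nhds h
    (fun n => (lt_dyadicRight n t).le) (fun n => dyadicRight_le n t)

/-- A discretised time takes countably many values, indexed by a floor, so joint measurability
reduces to measurability at each fixed time. -/
lemma measurable_natFloor_comp {γ Ω β : Type*} [MeasurableSpace γ] [MeasurableSpace Ω]
    [MeasurableSpace β] {v : ℕ → Ω → β} (hv : ∀ k, Measurable (v k)) {p : γ → ℝ≥0}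
    (hp : Measurable p) {w : γ → Ω} (hw : Measurable w) :
    Measurable fun c => v ⌊p c⌋₊ (w c) := by
  have h1 : Measurable fun q : ℕ × Ω => v q.1 q.2 := measurable_from_prod_countable_right hv
  exact h1.comp ((Nat.measurable_floor.comp hp).prodMk hw)

lemma coe_untopA_of_ne_top {a : WithTop ℝ≥0} (h : a ≠ ⊤) : ((a.untopA : ℝ≥0) : WithTop ℝ≥0) = a := by
  lift a to ℝ≥0 using h
  rfl

/-- A right-continuous adapted process with values in a metrizable space is progressive. -/
lemma isProgressive_of_rightContinuous {Ω β : Type*} {m : MeasurableSpace Ω}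
    [TopologicalSpace β] [TopologicalSpace.PseudoMetrizableSpace β] [MeasurableSpace β]
    [BorelSpace β] {f : Filtration ℝ≥0 m} {u : ℝ≥0 → Ω → β} (hu : ∀ t, Measurable[f t] (u t))
    (hc : ∀ ω t, ContinuousWithinAt (fun r => u r ω) (Ici t) t) :
    IsProgressive f u := by
  intro i
  -- Truncation at `i` keeps the approximating times within the information available at time `i`.
  refine @measurable_of_tendsto_metrizable' _ _ (_) _ _ _ _ _
    (fun (n : ℕ) (p : Iic i × Ω) => u (min i (dyadicRight n p.1)) p.2) _ atTop _ _ ?_ ?_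
  · intro n
    exact @measurable_natFloor_comp _ _ _ (_) (f i) _ (fun k => u (min i (dyadicStep n k)))
      (fun k => (hu (min i (dyadicStep n k))).mono (f.mono (min_le_left _ _)) le_rfl) _
      ((measurable_subtype_coe.comp (@measurable_fst _ _ _ (f i))).mul_const _) _
      (@measurable_snd _ _ _ (f i))
  · rw [tendsto_pi_nhds]
    rintro ⟨⟨t, ht⟩, ω⟩
    have h : Tendsto (fun n => min i (dyadicRight n t)) atTop (𝓝[Ici t] t) := by
      refine tendsto_nhdsWithin_iff.2 ⟨?_, Eventually.of_forall fun n => ?_⟩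
      · simpa [min_eq_right (mem_Iic.1 ht)] using
          (tendsto_const_nhds (x := i)).min (tendsto_dyadicRight t)
      · exact le_min ht (lt_dyadicRight n t).le
    exact (hc ω t).tendsto.comp h

/-- The hitting time of an open set by a right-continuous adapted process is a stopping time for a
right-continuous filtration. -/
lemma isStoppingTime_hittingAfter_of_isOpen {Ω β : Type*} {m : MeasurableSpace Ω}
    [TopologicalSpace β] [MeasurableSpace β] [BorelSpace β] {f : Filtration ℝ≥0 m}
    [f.IsRightContinuous] {u : ℝ≥0 → Ω → β} (hu : ∀ t, Measurable[f t] (u t))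
    (hc : ∀ ω t, ContinuousWithinAt (fun r => u r ω) (Ici t) t) {W : Set β} (hW : IsOpen W) :
    IsStoppingTime f (hittingAfter u W 0) := by
  refine isStoppingTime_of_measurableSet_lt_of_isRightContinuous fun t => ?_
  -- A path in the open set `W` at time `r` is still in `W` at dyadic times just to the right of
  -- `r`, so countably many times decide the event.
  have h : {ω | hittingAfter u W 0 ω < t} =
      ⋃ n : ℕ, ⋃ k : ℕ, ⋃ _ : dyadicStep n k < t, u (dyadicStep n k) ⁻¹' W := by
    ext ω
    simp only [mem_ofPred_eq, hittingAfter_lt_iff, mem_iUnion, mem_preimage, exists_prop]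
    constructor
    · rintro ⟨r, ⟨-, hr⟩, hrW⟩
      have h1 : Tendsto (fun n => dyadicRight n r) atTop (𝓝[Ici r] r) :=
        tendsto_nhdsWithin_iff.2 ⟨tendsto_dyadicRight r,
          Eventually.of_forall fun n => (lt_dyadicRight n r).le⟩
      have h2 := ((hc ω r).tendsto.comp h1).eventually (hW.mem_nhds hrW)
      obtain ⟨n, hn1, hn2⟩ := (h2.and ((tendsto_dyadicRight r).eventually_lt_const hr)).exists
      exact ⟨n, _, hn2, hn1⟩
    · rintro ⟨n, k, hk, hW⟩
      exact ⟨_, ⟨zero_le, hk⟩, hW⟩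
  rw [h]
  exact .iUnion fun n => .iUnion fun k => .iUnion fun hk => f.mono hk.le _ (hu _ hW.measurableSet)

/-- A right-continuous path is in the closure of a set at its hitting time. -/
lemma mem_closure_hittingAfter {Ω β : Type*} [TopologicalSpace β] {u : ℝ≥0 → Ω → β} {W : Set β}
    {ω : Ω} (hc : ∀ t, ContinuousWithinAt (fun r => u r ω) (Ici t) t)
    (h : hittingAfter u W 0 ω ≠ ⊤) : stoppedValue u (hittingAfter u W 0) ω ∈ closure W := by
  rw [stoppedValue]
  lift hittingAfter u W 0 ω to ℝ≥0 using h with t ht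
  change u t ω ∈ _
  rw [mem_closure_iff_nhds]
  intro V hV
  have hV' := (hc t).tendsto hV
  rw [mem_map, mem_nhdsWithin_iff_exists_mem_nhds_inter] at hV'
  obtain ⟨N, hN, hNV⟩ := hV'
  -- The infimum need not be attained, but visits to `W` occur in every interval `[t, r)`.
  obtain ⟨r, hr, hrN⟩ := exists_Ico_subset_of_mem_nhds hN ⟨t + 1, by simp⟩
  have h1 : hittingAfter u W 0 ω < r := by rw [← ht]; exact_mod_cast hr
  obtain ⟨j, ⟨-, hj⟩, hjW⟩ := hittingAfter_lt_iff.1 h1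
  have hjt : t ≤ j := by
    have := hittingAfter_le_of_mem (zero_le (a := j)) hjW
    rw [← ht] at this
    exact_mod_cast this
  exact ⟨u j ω, hNV ⟨hrN ⟨hjt, hj⟩, hjt⟩, hjW⟩

lemma isStoppingTime_add_const {Ω : Type*} {m : MeasurableSpace Ω} {f : Filtration ℝ≥0 m}
    {τ : Ω → WithTop ℝ≥0} (hτ : IsStoppingTime f τ) (t : ℝ≥0) :
    IsStoppingTime f fun ω => τ ω + t := by
  intro j
  by_cases h : t ≤ j
  · have h_eq : {ω | τ ω + t ≤ j} = {ω | τ ω ≤ (j - t : ℝ≥0)} := by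
      ext ω
      simp only [mem_ofPred_eq]
      cases τ ω with
      | top => rw [WithTop.top_add]; simp only [top_le_iff, WithTop.coe_ne_top]
      | coe a => norm_cast; exact (le_tsub_iff_right h).symm
    rw [h_eq]
    exact f.mono tsub_le_self _ (hτ _)
  · have h_eq : {ω | τ ω + t ≤ j} = ∅ := by
      ext ω
      simp only [mem_ofPred_eq, mem_empty_iff_false, iff_false]
      cases τ ω with
      | top => rw [WithTop.top_add]; simp only [top_le_iff, WithTop.coe_ne_top, not_false_eq_true]
      | coe a => norm_cast; exact fun h' => h (le_of_add_le_right h')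
    rw [h_eq]
    exact @MeasurableSet.empty _ (f j)

/-! ### Announcing the exit time -/

namespace StandardMarkovProcess

/-- A decreasing sequence of open neighbourhoods of the complement of `O`. -/
def outerNhd {E : Type*} [MetricSpace E] (O : Set E) (n : ℕ) : Set E := Metric.thickening (1 / (n + 1)) Oᶜ

lemma isOpen_outerNhd {E : Type*} [MetricSpace E] (O : Set E) (n : ℕ) : IsOpen (outerNhd O n) := Metric.isOpen_thickening

lemma compl_subset_outerNhd {E : Type*} [MetricSpace E] (O : Set E) (n : ℕ) : Oᶜ ⊆ outerNhd O n :=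
  Metric.self_subset_thickening Nat.one_div_pos_of_nat _

lemma outerNhd_antitone {E : Type*} [MetricSpace E] (O : Set E) : Antitone (outerNhd O) := fun _ _ h =>
  Metric.thickening_mono (Nat.one_div_le_one_div h) _

variable {E Ω : Type*} [MetricSpace E] [MeasurableSpace E] [MeasurableSpace Ω]

instance (M : StandardMarkovProcess E Ω) (x : E) : IsProbabilityMeasure (M.P x) :=
  M.isProbabilityMeasure x

instance (M : StandardMarkovProcess E Ω) : M.filt.IsRightContinuous :=
  M.right_continuous_filtration

lemma measurable_X (M : StandardMarkovProcess E Ω) (t : ℝ≥0) : Measurable (M.X t) :=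
  (M.adapted t).mono (M.filt.le t) le_rfl

lemma isStronglyProgressive [BorelSpace E] [SecondCountableTopology E]
    (M : StandardMarkovProcess E Ω) : IsStronglyProgressive M.filt M.X :=
  (isProgressive_of_rightContinuous M.adapted M.right_continuous_paths).isStronglyProgressive

lemma measurable_stoppedValue [BorelSpace E] [SecondCountableTopology E]
    (M : StandardMarkovProcess E Ω) {τ : Ω → WithTop ℝ≥0} (hτ : IsStoppingTime M.filt τ) :
    Measurable (stoppedValue M.X τ) :=
  (MeasureTheory.measurable_stoppedValue M.isStronglyProgressive hτ).mono hτ.measurableSpace_le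
    le_rfl

lemma measurable_uncurry_X [BorelSpace E] (M : StandardMarkovProcess E Ω) :
    Measurable fun p : ℝ≥0 × Ω => M.X p.1 p.2 := by
  refine measurable_of_tendsto_metrizable' (f := fun (n : ℕ) (p : ℝ≥0 × Ω) =>
    M.X (dyadicRight n p.1) p.2) atTop ?_ ?_
  · intro n
    exact measurable_natFloor_comp (v := fun k => M.X (dyadicStep n k))
      (fun k => M.measurable_X (dyadicStep n k)) (measurable_fst.mul_const _) measurable_snd
  · rw [tendsto_pi_nhds]
    rintro ⟨t, ω⟩
    exact (M.right_continuous_paths ω t).tendsto.comp (tendsto_nhdsWithin_iff.2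
      ⟨tendsto_dyadicRight t, Eventually.of_forall fun n => (lt_dyadicRight n t).le⟩)

/-- The hitting times of the neighbourhoods `outerNhd O n`, which announce the exit from `O`. -/
noncomputable def approachTime (M : StandardMarkovProcess E Ω) (O : Set E) (n : ℕ) : Ω → WithTop ℝ≥0 :=
  hittingAfter M.X (outerNhd O n) 0

lemma isStoppingTime_approachTime [BorelSpace E] (M : StandardMarkovProcess E Ω) (O : Set E)
    (n : ℕ) : IsStoppingTime M.filt (M.approachTime O n) :=
  isStoppingTime_hittingAfter_of_isOpen M.adapted M.right_continuous_paths (isOpen_outerNhd O n)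

lemma approachTime_le_exitTime (M : StandardMarkovProcess E Ω) (O : Set E) (n : ℕ) (ω : Ω) :
    M.approachTime O n ω ≤ M.exitTime O ω :=
  hittingAfter_anti _ _ (compl_subset_outerNhd O n) ω

lemma isStoppingTime_iSup_approachTime [BorelSpace E] (M : StandardMarkovProcess E Ω)
    (O : Set E) : IsStoppingTime M.filt fun ω => ⨆ n, M.approachTime O n ω := by
  intro t
  have : {ω | ⨆ n, M.approachTime O n ω ≤ t} = ⋂ n, {ω | M.approachTime O n ω ≤ t} := by
    ext ω; simp only [mem_ofPred_eq, mem_iInter, iSup_le_iff]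
  rw [this]
  exact MeasurableSet.iInter fun n => M.isStoppingTime_approachTime O n t

/-- Outside of an event which is null under all the laws, the exit time is announced by the
approach times. -/
lemma exists_null_exitTime [BorelSpace E] [SecondCountableTopology E]
    (M : StandardMarkovProcess E Ω) {O : Set E} (hO : IsOpen O) :
    ∃ N : Set Ω, MeasurableSet N ∧ (∀ x, M.P x N = 0) ∧
      ∀ ω ∉ N, M.exitTime O ω = ⨆ n, M.approachTime O n ω := by
  set S : Ω → WithTop ℝ≥0 := fun ω => ⨆ n, M.approachTime O n ω with hS
  have hSst : IsStoppingTime M.filt S := M.isStoppingTime_iSup_approachTime O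
  have hT := M.isStoppingTime_approachTime O
  -- The exceptional set is where quasi-left-continuity along the approach times fails. It does not
  -- depend on the starting point and is null under each law.
  refine ⟨{ω | S ω ≠ ⊤} ∩ {ω | Tendsto (fun n => dist (stoppedValue M.X (M.approachTime O n) ω)
    (stoppedValue M.X S ω)) atTop (𝓝 0)}ᶜ, ?_, fun x => ?_, fun ω hω => ?_⟩
  · refine MeasurableSet.inter (hSst.measurable' (measurableSet_singleton _).compl) ?_
    exact (measurableSet_tendsto _ fun n => (M.measurable_stoppedValue (hT n)).dist
      (M.measurable_stoppedValue hSst)).compl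
  · have h := M.quasi_left_continuous (M.approachTime O) S hT
      (fun ω m n h => hittingAfter_anti _ _ (outerNhd_antitone O h) ω) (fun ω => isLUB_iSup) x
    rw [ae_iff] at h
    refine measure_mono_null ?_ h
    rintro ω ⟨h1, h2⟩
    simp only [mem_ofPred_eq, Classical.not_imp]
    exact ⟨h1, fun h3 => h2 (tendsto_iff_dist_tendsto_zero.1 h3)⟩
  · refine le_antisymm ?_ (iSup_le fun n => M.approachTime_le_exitTime O n ω)
    by_cases htop : S ω = ⊤
    · exact le_top.trans_eq htop.symm
    have hlim : Tendsto (fun n => stoppedValue M.X (M.approachTime O n) ω) atTop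
        (𝓝 (stoppedValue M.X S ω)) := by
      rw [tendsto_iff_dist_tendsto_zero]
      by_contra h
      exact hω ⟨htop, h⟩
    -- The position at the `n`-th approach time is within `1 / (n + 1)` of the closed set `Oᶜ`;
    -- hence the limit lies in `Oᶜ`.
    have hmem : stoppedValue M.X S ω ∈ Oᶜ := by
      rw [← hO.isClosed_compl.closure_eq, Metric.mem_closure_iff_infEDist_zero]
      have h1 : ∀ n, Metric.infEDist (stoppedValue M.X (M.approachTime O n) ω) Oᶜ ≤
          ENNReal.ofReal (1 / (n + 1)) := by
        intro n
        have hn : M.approachTime O n ω ≠ ⊤ := ne_top_of_le_ne_top htop (le_iSup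
          (fun n => M.approachTime O n ω) n)
        exact Metric.closure_thickening_subset_cthickening _ _
          (mem_closure_hittingAfter (M.right_continuous_paths ω) hn)
      have h2 : Tendsto (fun n : ℕ => ENNReal.ofReal (1 / ((n : ℝ) + 1))) atTop (𝓝 0) := by
        simpa using ENNReal.tendsto_ofReal (tendsto_one_div_add_atTop_nhds_zero_nat (𝕜 := ℝ))
      have h3 := ((Metric.continuous_infEDist (s := Oᶜ)).tendsto _).comp hlim
      exact le_antisymm (le_of_tendsto_of_tendsto' h3 h2 h1) zero_le
    have := hittingAfter_le_of_mem (u := M.X) (n := 0) zero_le hmem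
    exact this.trans_eq (coe_untopA_of_ne_top htop)

end StandardMarkovProcess

/-! ### Strong Markov property of the killed process, by dyadic skeletons -/

namespace StandardMarkovProcess

variable {E Ω : Type*} [MetricSpace E] [MeasurableSpace E] [MeasurableSpace Ω]

/-- Off a null set the exit time is the supremum of the approach times; on the null set,
completeness makes every subset measurable from time `0` on. -/
lemma isStoppingTime_exitTime [BorelSpace E] [SecondCountableTopology E]
    (M : StandardMarkovProcess E Ω) {O : Set E} (hO : IsOpen O) :
    IsStoppingTime M.filt (M.exitTime O) := by
  obtain ⟨N, hN, hN0, h⟩ := M.exists_null_exitTime hO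
  intro t
  have hnull : ∀ A ⊆ N, MeasurableSet[M.filt t] A := fun A hA =>
    M.filt.mono zero_le _ (M.complete_filtration A N hN hA hN0)
  have heq : {ω | M.exitTime O ω ≤ t} =
      ({ω | ⨆ n, M.approachTime O n ω ≤ t} \ N) ∪ ({ω | M.exitTime O ω ≤ t} ∩ N) := by
    ext ω
    by_cases hω : ω ∈ N
    · simp [hω]
    · simp only [mem_ofPred_eq, mem_union, Set.mem_sdiff, hω, not_false_eq_true, and_true,
        mem_inter_iff, and_false, or_false]
      rw [h ω hω]
  rw [heq]
  exact ((M.isStoppingTime_iSup_approachTime O t).diff (hnull N subset_rfl)).union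
    (hnull _ inter_subset_right)

/-- The event that the process stays outside of `outerNhd O n` on the time interval
`[τ, τ + t]`. -/
def staysAway (M : StandardMarkovProcess E Ω) (O : Set E) (n : ℕ) (τ : Ω → WithTop ℝ≥0)
    (t : ℝ≥0) : Set Ω :=
  {ω | ∀ u ≤ t, M.X ((τ ω).untopA + u) ω ∈ (outerNhd O n)ᶜ}

lemma exitTime_mem (M : StandardMarkovProcess E Ω) {O : Set E} (hO : IsOpen O) {ω : Ω}
    (h : M.exitTime O ω ≠ ⊤) : stoppedValue M.X (M.exitTime O) ω ∉ O := by
  have := mem_closure_hittingAfter (M.right_continuous_paths ω) h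
  rwa [hO.isClosed_compl.closure_eq] at this

/-- Replaces survival up to time `r` by conditions that can be tested on countably many times. A
path might approach `Oᶜ` through a left limit without leaving `O`; announcing the exit time confines
this to a null set. -/
lemma exists_null_lt_exitTime [BorelSpace E] [SecondCountableTopology E]
    (M : StandardMarkovProcess E Ω) {O : Set E} (hO : IsOpen O) :
    ∃ N : Set Ω, MeasurableSet N ∧ (∀ x, M.P x N = 0) ∧ ∀ ω ∉ N, ∀ r : ℝ≥0,
      (r < M.exitTime O ω ↔ ∃ n, ∀ u ≤ r, M.X u ω ∈ (outerNhd O n)ᶜ) := by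
  obtain ⟨N, hN, hN0, h⟩ := M.exists_null_exitTime hO
  refine ⟨N, hN, hN0, fun ω hω r => ⟨fun hr => ?_, fun ⟨n, hn⟩ => ?_⟩⟩
  · rw [h ω hω, lt_iSup_iff] at hr
    obtain ⟨n, hn⟩ := hr
    exact ⟨n, fun u hu => notMem_of_lt_hittingAfter ((WithTop.coe_le_coe.2 hu).trans_lt hn)
      zero_le⟩
  · by_contra hlt
    rw [not_lt] at hlt
    have htop : M.exitTime O ω ≠ ⊤ := ne_top_of_le_ne_top WithTop.coe_ne_top hlt
    have h1 := M.exitTime_mem hO htop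
    have h2 := hn (M.exitTime O ω).untopA (WithTop.untopA_le hlt)
    exact h2 (compl_subset_outerNhd O n h1)

/-- Separates survival up to `τ` from survival during the next `t` units, as the Markov property
requires. The larger of the two indices gives a neighbourhood avoided on both pieces. One null set
serves all `τ` and `t`. -/
lemma exists_null_add_lt_exitTime [BorelSpace E] [SecondCountableTopology E]
    (M : StandardMarkovProcess E Ω) {O : Set E} (hO : IsOpen O) :
    ∃ N : Set Ω, MeasurableSet N ∧ (∀ x, M.P x N = 0) ∧
      ∀ ω ∉ N, ∀ (τ : Ω → WithTop ℝ≥0) (t : ℝ≥0), τ ω ≠ ⊤ →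
        (τ ω + t < M.exitTime O ω ↔ τ ω < M.exitTime O ω ∧ ω ∈ ⋃ n, M.staysAway O n τ t) := by
  obtain ⟨N, hN, hN0, h⟩ := M.exists_null_lt_exitTime hO
  refine ⟨N, hN, hN0, fun ω hω τ t htop => ?_⟩
  rw [mem_iUnion]
  simp only [staysAway, mem_ofPred_eq]
  generalize hr : (τ ω).untopA = r
  have hτ : τ ω = r := by rw [← coe_untopA_of_ne_top htop, hr]
  rw [hτ]
  have := h ω hω (r + t)
  rw [WithTop.coe_add] at this
  rw [this, h ω hω r]
  constructor
  · rintro ⟨n, hn⟩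
    exact ⟨⟨n, fun u hu => hn u (hu.trans (by simp))⟩, n, fun u hu => hn _ (by gcongr)⟩
  · rintro ⟨⟨n, hn⟩, m, hm⟩
    refine ⟨max n m, fun u hu hmem => ?_⟩
    rcases le_total u r with hur | hur
    · exact hn u hur (outerNhd_antitone O (le_max_left n m) hmem)
    · refine hm (u - r) (tsub_le_iff_left.2 hu) (outerNhd_antitone O (le_max_right n m) ?_)
      rwa [add_tsub_cancel_of_le hur]

/-- The event that the process is in `C` at the times `τ, τ + δ, …, τ + m δ`, and in `B` at the
last of them. -/
def skeletonEvent (M : StandardMarkovProcess E Ω) (δ : ℝ≥0) (C B : Set E) (m : ℕ)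
    (τ : Ω → WithTop ℝ≥0) : Set Ω :=
  {ω | (∀ j ≤ m, M.X ((τ ω).untopA + j * δ) ω ∈ C) ∧ M.X ((τ ω).untopA + m * δ) ω ∈ B}

/-- The transition kernels of the process. -/
noncomputable def transition (M : StandardMarkovProcess E Ω) (t : ℝ≥0) :
    ProbabilityTheory.Kernel E E where
  toFun x := (M.P x).map (M.X t)
  measurable' := by
    refine Measure.measurable_of_measurable_coe _ fun B hB => ?_
    simp_rw [Measure.map_apply (M.measurable_X t) hB]
    exact M.measurable_transition t B hB

lemma transition_apply (M : StandardMarkovProcess E Ω) (t : ℝ≥0) (x : E) :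
    M.transition t x = (M.P x).map (M.X t) := rfl

/-- The probability of `skeletonEvent` with `τ = 0`, as a function of the starting point. -/
noncomputable def skeletonProb (M : StandardMarkovProcess E Ω) (δ : ℝ≥0) (C B : Set E) :
    ℕ → E → ℝ≥0∞
  | 0 => (C ∩ B).indicator 1
  | m + 1 => C.indicator fun y => ∫⁻ z, M.skeletonProb δ C B m z ∂M.transition δ y

lemma measurable_skeletonProb (M : StandardMarkovProcess E Ω) (δ : ℝ≥0) {C B : Set E}
    (hC : MeasurableSet C) (hB : MeasurableSet B) (m : ℕ) :
    Measurable (M.skeletonProb δ C B m) := by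
  induction m with
  | zero => exact measurable_one.indicator (hC.inter hB)
  | succ m ih => exact (ih.lintegral_kernel).indicator hC

lemma measurableSet_ne_top {τ : Ω → WithTop ℝ≥0} (M : StandardMarkovProcess E Ω)
    (hτ : IsStoppingTime M.filt τ) : MeasurableSet {ω | τ ω ≠ ⊤} :=
  hτ.measurable' (measurableSet_singleton _).compl

variable [BorelSpace E]

lemma measurable_X_untopA_add (M : StandardMarkovProcess E Ω) {τ : Ω → WithTop ℝ≥0}
    (hτ : IsStoppingTime M.filt τ) (t : ℝ≥0) :
    Measurable fun ω => M.X ((τ ω).untopA + t) ω :=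
  M.measurable_uncurry_X.comp ((hτ.measurable'.untopA.add_const t).prodMk measurable_id)

lemma measurableSet_skeletonEvent (M : StandardMarkovProcess E Ω) {τ : Ω → WithTop ℝ≥0}
    (hτ : IsStoppingTime M.filt τ) (δ : ℝ≥0) {C B : Set E} (hC : MeasurableSet C)
    (hB : MeasurableSet B) (m : ℕ) : MeasurableSet (M.skeletonEvent δ C B m τ) := by
  refine MeasurableSet.inter ?_ (M.measurable_X_untopA_add hτ _ hB)
  change MeasurableSet {ω | ∀ j ≤ m, M.X ((τ ω).untopA + j * δ) ω ∈ C}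
  simp_rw [Set.ofPred_forall]
  exact .iInter fun j => .iInter fun _ => M.measurable_X_untopA_add hτ _ hC

variable [SecondCountableTopology E]

/-- The strong Markov hypothesis says that two measures on `E` agree on every Borel set, so it
passes to nonnegative functions. -/
lemma lintegral_strong_markov (M : StandardMarkovProcess E Ω) {τ : Ω → WithTop ℝ≥0}
    (hτ : IsStoppingTime M.filt τ) (t : ℝ≥0) {A : Set Ω}
    (hA : MeasurableSet[hτ.measurableSpace] A) (x : E) {K : E → ℝ≥0∞} (hK : Measurable K) :
    ∫⁻ ω in A ∩ {ω | τ ω ≠ ⊤}, K (M.X ((τ ω).untopA + t) ω) ∂(M.P x) =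
      ∫⁻ ω in A ∩ {ω | τ ω ≠ ⊤}, ∫⁻ z, K z ∂M.transition t (stoppedValue M.X τ ω) ∂(M.P x) := by
  have hX := M.measurable_X_untopA_add hτ t
  have hS := M.measurable_stoppedValue hτ
  have hA' : MeasurableSet (A ∩ {ω | τ ω ≠ ⊤}) :=
    (hτ.measurableSpace_le _ hA).inter (M.measurableSet_ne_top hτ)
  have key : ((M.P x).restrict (A ∩ {ω | τ ω ≠ ⊤})).map (fun ω => M.X ((τ ω).untopA + t) ω) =
      (((M.P x).restrict (A ∩ {ω | τ ω ≠ ⊤})).map (stoppedValue M.X τ)).bind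
        (M.transition t) := by
    ext B hB
    rw [Measure.map_apply hX hB, Measure.bind_apply hB (M.transition t).measurable.aemeasurable,
      lintegral_map ((M.transition t).measurable_coe hB) hS, Measure.restrict_apply (hX hB)]
    simp_rw [transition_apply, Measure.map_apply (M.measurable_X t) hB]
    refine Eq.trans ?_ (M.strong_markov τ hτ t B hB A hA x)
    congr 1
    ext ω
    simp only [mem_inter_iff, mem_preimage, mem_ofPred_eq]
    tauto
  rw [← lintegral_map hK hX, key, Measure.lintegral_bind (M.transition t).measurable.aemeasurable
    hK.aemeasurable, lintegral_map hK.lintegral_kernel hS]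

/-- Induction on the number of steps: check `C` at time `τ`, then restart at `τ + δ`. Hence `τ` and
`A` are quantified inside the induction. -/
lemma measure_skeletonEvent (M : StandardMarkovProcess E Ω) (δ : ℝ≥0) {C B : Set E}
    (hC : MeasurableSet C) (hB : MeasurableSet B) (x : E) (m : ℕ) :
    ∀ {τ : Ω → WithTop ℝ≥0} (hτ : IsStoppingTime M.filt τ) {A : Set Ω},
      MeasurableSet[hτ.measurableSpace] A →
      M.P x (A ∩ {ω | τ ω ≠ ⊤} ∩ M.skeletonEvent δ C B m τ) =
        ∫⁻ ω in A ∩ {ω | τ ω ≠ ⊤}, M.skeletonProb δ C B m (stoppedValue M.X τ ω) ∂(M.P x) := by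
  induction m with
  | zero =>
    intro τ hτ A hA
    have h0 : M.skeletonEvent δ C B 0 τ = stoppedValue M.X τ ⁻¹' (C ∩ B) := by
      ext ω; simp [skeletonEvent, stoppedValue]
    have h1 : ∀ ω, M.skeletonProb δ C B 0 (stoppedValue M.X τ ω) =
        (stoppedValue M.X τ ⁻¹' (C ∩ B)).indicator 1 ω := fun ω => rfl
    have hm := M.measurable_stoppedValue hτ (hC.inter hB)
    simp_rw [h1]
    rw [h0, lintegral_indicator_one hm, Measure.restrict_apply hm, inter_comm]
  | succ m ih =>
    intro τ hτ A hA
    have hτ' := isStoppingTime_add_const hτ δ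
    have hA' : MeasurableSet[hτ.measurableSpace] (A ∩ stoppedValue M.X τ ⁻¹' C) :=
      hA.inter (MeasureTheory.measurable_stoppedValue M.isStronglyProgressive hτ hC)
    have hle : τ ≤ fun ω => τ ω + δ := fun ω => le_add_of_nonneg_right (zero_le (a := (δ : WithTop ℝ≥0)))
    have htop : ∀ ω, τ ω + δ ≠ ⊤ ↔ τ ω ≠ ⊤ := fun ω => by
      cases τ ω with
      | top => rw [WithTop.top_add]
      | coe a => exact iff_of_true WithTop.coe_ne_top WithTop.coe_ne_top
    have hunt : ∀ ω, τ ω ≠ ⊤ → (τ ω + δ).untopA = (τ ω).untopA + δ := by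
      intro ω h
      lift τ ω to ℝ≥0 using h with r
      rfl
    have h1 := ih hτ' (hτ.measurableSpace_mono hτ' hle _ hA')
    have h2 := M.lintegral_strong_markov hτ δ hA' x (M.measurable_skeletonProb δ hC hB m)
    have hset : A ∩ {ω | τ ω ≠ ⊤} ∩ M.skeletonEvent δ C B (m + 1) τ =
        A ∩ stoppedValue M.X τ ⁻¹' C ∩ {ω | τ ω + δ ≠ ⊤} ∩
          M.skeletonEvent δ C B m (fun ω => τ ω + δ) := by
      ext ω
      simp only [mem_inter_iff, mem_ofPred_eq, mem_preimage, htop, skeletonEvent, stoppedValue]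
      by_cases h : τ ω = ⊤
      · simp [h]
      · simp only [hunt ω h, h, ne_eq, not_false_eq_true, and_true]
        have e : ∀ j : ℕ, (τ ω).untopA + δ + j * δ = (τ ω).untopA + (j + 1 : ℕ) * δ := by
          intro j; push_cast; ring
        simp only [e]
        constructor
        · rintro ⟨h1, h2, h3⟩
          exact ⟨⟨h1, by simpa using h2 0 (by simp)⟩, fun j hj => h2 _ (by lia), h3⟩
        · rintro ⟨⟨h1, h1'⟩, h2, h3⟩
          refine ⟨h1, fun j hj => ?_, h3⟩
          cases j with
          | zero => simpa using h1'
          | succ j => exact h2 j (by lia)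
    have hset' : A ∩ stoppedValue M.X τ ⁻¹' C ∩ {ω | τ ω + δ ≠ ⊤} =
        A ∩ stoppedValue M.X τ ⁻¹' C ∩ {ω | τ ω ≠ ⊤} := by
      ext ω; simp only [mem_inter_iff, mem_ofPred_eq, htop]
    have hm : MeasurableSet (A ∩ {ω | τ ω ≠ ⊤}) :=
      (hτ.measurableSpace_le _ hA).inter (M.measurableSet_ne_top hτ)
    rw [hset, h1, hset']
    have h3 : ∫⁻ ω in A ∩ stoppedValue M.X τ ⁻¹' C ∩ {ω | τ ω ≠ ⊤}, M.skeletonProb δ C B m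
          (stoppedValue M.X (fun ω => τ ω + δ) ω) ∂(M.P x) =
        ∫⁻ ω in A ∩ stoppedValue M.X τ ⁻¹' C ∩ {ω | τ ω ≠ ⊤}, M.skeletonProb δ C B m
          (M.X ((τ ω).untopA + δ) ω) ∂(M.P x) := by
      refine setLIntegral_congr_fun ?_ fun ω hω => ?_
      · exact (hτ.measurableSpace_le _ hA').inter (M.measurableSet_ne_top hτ)
      · simp only [stoppedValue, hunt ω hω.2]
    rw [h3, h2, inter_right_comm, inter_comm (A ∩ _), ← setLIntegral_indicator
      (M.measurable_stoppedValue hτ hC)]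
    rfl

/-- The case `τ = 0` identifies the recursion with a path probability, whose measurability in the
starting point thereby follows from that of the one-time transition probabilities. -/
lemma skeletonProb_eq (M : StandardMarkovProcess E Ω) (δ : ℝ≥0) {C B : Set E}
    (hC : MeasurableSet C) (hB : MeasurableSet B) (m : ℕ) (y : E) :
    M.skeletonProb δ C B m y = M.P y (M.skeletonEvent δ C B m fun _ => 0) := by
  have h := M.measure_skeletonEvent δ hC hB y m (isStoppingTime_const M.filt (0 : ℝ≥0))
    (@MeasurableSet.univ _ (_))
  have h2 : ∫⁻ ω, M.skeletonProb δ C B m (stoppedValue M.X (fun _ => 0) ω) ∂(M.P y) =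
      ∫⁻ _, M.skeletonProb δ C B m y ∂(M.P y) := by
    refine lintegral_congr_ae ?_
    filter_upwards [M.start y] with ω hω
    change M.skeletonProb δ C B m (M.X 0 ω) = _
    rw [hω]
  simp only [WithTop.coe_zero, ne_eq, WithTop.zero_ne_top, not_false_eq_true, Set.ofPred_true,
    inter_univ, univ_inter, Measure.restrict_univ] at h
  rw [h, h2]
  simp

end StandardMarkovProcess

namespace StandardMarkovProcess

variable {E Ω : Type*} [MetricSpace E] [MeasurableSpace E] [MeasurableSpace Ω]

lemma staysAway_mono (M : StandardMarkovProcess E Ω) (O : Set E) (τ : Ω → WithTop ℝ≥0)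
    (t : ℝ≥0) : Monotone fun n => M.staysAway O n τ t :=
  fun _ _ h _ hω u hu hmem => hω u hu (outerNhd_antitone O h hmem)

lemma skeletonEvent_antitone (M : StandardMarkovProcess E Ω) (t : ℝ≥0) (C B : Set E)
    (τ : Ω → WithTop ℝ≥0) :
    Antitone fun k : ℕ => M.skeletonEvent (t / 2 ^ k) C B (2 ^ k) τ := by
  refine antitone_nat_of_succ_le fun k ω => ?_
  rintro ⟨h1, h2⟩
  refine ⟨fun j hj => ?_, ?_⟩
  -- The `j`-th point of the level `k` grid is the `2 j`-th point of level `k + 1`.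
  · have := h1 (2 * j) (by rw [pow_succ]; lia)
    convert this using 3
    push_cast
    field_simp
    ring
  · convert h2 using 3
    push_cast
    field_simp

/-- Avoiding an open set is a closed condition, so by right continuity it need only be checked at
dyadic fractions of the interval. -/
lemma iInter_skeletonEvent (M : StandardMarkovProcess E Ω) (O : Set E) (n : ℕ) (t : ℝ≥0)
    (B : Set E) (τ : Ω → WithTop ℝ≥0) :
    ⋂ k : ℕ, M.skeletonEvent (t / 2 ^ k) (outerNhd O n)ᶜ B (2 ^ k) τ =
      M.staysAway O n τ t ∩ {ω | M.X ((τ ω).untopA + t) ω ∈ B} := by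
  have hend : ∀ k : ℕ, ((2 ^ k : ℕ) : ℝ≥0) * (t / 2 ^ k) = t := by
    intro k; push_cast; field_simp
  ext ω
  simp only [mem_iInter, skeletonEvent, mem_inter_iff, mem_ofPred_eq, hend, staysAway]
  constructor
  · intro h
    refine ⟨fun u hu => ?_, (h 0).2⟩
    -- The right endpoint has no grid times to its right, but it is itself a grid point.
    rcases hu.eq_or_lt with rfl | hu
    · have := (h 0).1 1 (by simp)
      simpa using this
    · have ht : 0 < t := pos_of_gt hu
      have hlim : Tendsto (fun k => (τ ω).untopA + t * dyadicRight k (u / t)) atTop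
          (𝓝[Ici ((τ ω).untopA + u)] ((τ ω).untopA + u)) := by
        have e : t * (u / t) = u := by field_simp
        refine tendsto_nhdsWithin_iff.2 ⟨?_, Eventually.of_forall fun k => ?_⟩
        · have := ((tendsto_dyadicRight (u / t)).const_mul t).const_add (τ ω).untopA
          rwa [e] at this
        · have := mul_le_mul_right (lt_dyadicRight k (u / t)).le t
          rw [e] at this
          exact mem_Ici.2 (by gcongr)
      refine (isOpen_outerNhd O n).isClosed_compl.mem_of_tendsto
        ((M.right_continuous_paths ω _).tendsto.comp hlim) (Eventually.of_forall fun k => ?_)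
      have hfl : ⌊u / t * 2 ^ k⌋₊ < 2 ^ k := by
        rw [Nat.floor_lt (by positivity)]
        push_cast
        have : u / t < 1 := (div_lt_one ht).2 hu
        calc u / t * 2 ^ k < 1 * 2 ^ k := by gcongr
          _ = 2 ^ k := one_mul _
      have := (h k).1 (⌊u / t * 2 ^ k⌋₊ + 1) (by lia)
      have e : ((⌊u / t * 2 ^ k⌋₊ + 1 : ℕ) : ℝ≥0) * (t / 2 ^ k) = t * dyadicRight k (u / t) := by
        simp only [dyadicRight, dyadicStep]
        push_cast
        field_simp
      rwa [e] at this
  · rintro ⟨h1, h2⟩ k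
    refine ⟨fun j hj => h1 _ ?_, h2⟩
    calc (j : ℝ≥0) * (t / 2 ^ k) ≤ (2 ^ k : ℕ) * (t / 2 ^ k) := by gcongr
      _ = t := hend k

variable [BorelSpace E] [SecondCountableTopology E]

/-- Markov property at a stopping time for the event of staying away from the complement of `O`. -/
lemma measure_staysAway (M : StandardMarkovProcess E Ω) {τ : Ω → WithTop ℝ≥0}
    (hτ : IsStoppingTime M.filt τ) (O : Set E) (n : ℕ) (t : ℝ≥0) {B : Set E}
    (hB : MeasurableSet B) {A : Set Ω} (hA : MeasurableSet[hτ.measurableSpace] A) (x : E) :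
    (Measurable fun y => M.P y (M.staysAway O n (fun _ => 0) t ∩ {ω | M.X t ω ∈ B})) ∧
    M.P x (A ∩ {ω | τ ω ≠ ⊤} ∩ (M.staysAway O n τ t ∩ {ω | M.X ((τ ω).untopA + t) ω ∈ B})) =
      ∫⁻ ω in A ∩ {ω | τ ω ≠ ⊤}, M.P (stoppedValue M.X τ ω)
        (M.staysAway O n (fun _ => 0) t ∩ {ω | M.X t ω ∈ B}) ∂(M.P x) := by
  have hC : MeasurableSet (outerNhd O n)ᶜ := (isOpen_outerNhd O n).measurableSet.compl
  have h0 : (0 : WithTop ℝ≥0).untopA + t = t := zero_add t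
  have hlim : ∀ y, Tendsto (fun k : ℕ => M.skeletonProb (t / 2 ^ k) (outerNhd O n)ᶜ B (2 ^ k) y)
      atTop (𝓝 (M.P y (M.staysAway O n (fun _ => 0) t ∩ {ω | M.X t ω ∈ B}))) := by
    intro y
    have e := M.iInter_skeletonEvent O n t B (fun _ => 0)
    simp only [h0] at e
    rw [← e]
    simp_rw [M.skeletonProb_eq _ hC hB]
    exact tendsto_measure_iInter_atTop (fun k => (M.measurableSet_skeletonEvent
      (isStoppingTime_const M.filt (0 : ℝ≥0)) _ hC hB _).nullMeasurableSet)
      (M.skeletonEvent_antitone t _ B _) ⟨0, measure_ne_top _ _⟩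
  have hmeas : ∀ k : ℕ, Measurable (M.skeletonProb (t / 2 ^ k) (outerNhd O n)ᶜ B (2 ^ k)) :=
    fun k => M.measurable_skeletonProb _ hC hB _
  refine ⟨measurable_of_tendsto_metrizable hmeas (tendsto_pi_nhds.2 hlim), ?_⟩
  have hA' : MeasurableSet (A ∩ {ω | τ ω ≠ ⊤}) :=
    (hτ.measurableSpace_le _ hA).inter (M.measurableSet_ne_top hτ)
  have h1 : Tendsto (fun k : ℕ => M.P x (A ∩ {ω | τ ω ≠ ⊤} ∩
      M.skeletonEvent (t / 2 ^ k) (outerNhd O n)ᶜ B (2 ^ k) τ)) atTop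
      (𝓝 (M.P x (A ∩ {ω | τ ω ≠ ⊤} ∩
        (M.staysAway O n τ t ∩ {ω | M.X ((τ ω).untopA + t) ω ∈ B})))) := by
    rw [← iInter_skeletonEvent, inter_iInter]
    exact tendsto_measure_iInter_atTop (fun k => (hA'.inter
      (M.measurableSet_skeletonEvent hτ _ hC hB _)).nullMeasurableSet)
      (fun i j h => inter_subset_inter_right _ (M.skeletonEvent_antitone t _ B _ h))
      ⟨0, measure_ne_top _ _⟩
  -- The identity holds for each dyadic grid; both sides converge as the grid is refined.
  refine tendsto_nhds_unique h1 ?_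
  simp_rw [M.measure_skeletonEvent _ hC hB x _ hτ hA]
  refine tendsto_lintegral_of_dominated_convergence (fun _ => 1)
    (fun k => (hmeas k).comp (M.measurable_stoppedValue hτ)) (fun k => ?_) ?_
    (Eventually.of_forall fun ω => hlim _)
  · refine Eventually.of_forall fun ω => ?_
    change M.skeletonProb _ _ _ _ _ ≤ 1
    rw [M.skeletonProb_eq _ hC hB]
    exact prob_le_one
  · simp

lemma measure_iUnion_staysAway (M : StandardMarkovProcess E Ω) {τ : Ω → WithTop ℝ≥0}
    (hτ : IsStoppingTime M.filt τ) (O : Set E) (t : ℝ≥0) {B : Set E}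
    (hB : MeasurableSet B) {A : Set Ω} (hA : MeasurableSet[hτ.measurableSpace] A) (x : E) :
    (Measurable fun y => M.P y ((⋃ n, M.staysAway O n (fun _ => 0) t) ∩ {ω | M.X t ω ∈ B})) ∧
    M.P x (A ∩ {ω | τ ω ≠ ⊤} ∩
        ((⋃ n, M.staysAway O n τ t) ∩ {ω | M.X ((τ ω).untopA + t) ω ∈ B})) =
      ∫⁻ ω in A ∩ {ω | τ ω ≠ ⊤}, M.P (stoppedValue M.X τ ω)
        ((⋃ n, M.staysAway O n (fun _ => 0) t) ∩ {ω | M.X t ω ∈ B}) ∂(M.P x) := by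
  have hlim : ∀ y, Tendsto
      (fun n => M.P y (M.staysAway O n (fun _ => 0) t ∩ {ω | M.X t ω ∈ B})) atTop
      (𝓝 (M.P y ((⋃ n, M.staysAway O n (fun _ => 0) t) ∩ {ω | M.X t ω ∈ B}))) := by
    intro y
    rw [iUnion_inter]
    exact tendsto_measure_iUnion_atTop fun i j h =>
      inter_subset_inter_left _ (M.staysAway_mono O _ t h)
  have hmeas := fun n => (M.measure_staysAway hτ O n t hB hA x).1
  refine ⟨measurable_of_tendsto_metrizable hmeas (tendsto_pi_nhds.2 hlim), ?_⟩
  have h1 : Tendsto (fun n => M.P x (A ∩ {ω | τ ω ≠ ⊤} ∩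
      (M.staysAway O n τ t ∩ {ω | M.X ((τ ω).untopA + t) ω ∈ B}))) atTop
      (𝓝 (M.P x (A ∩ {ω | τ ω ≠ ⊤} ∩
        ((⋃ n, M.staysAway O n τ t) ∩ {ω | M.X ((τ ω).untopA + t) ω ∈ B})))) := by
    rw [iUnion_inter, inter_iUnion]
    exact tendsto_measure_iUnion_atTop fun i j h =>
      inter_subset_inter_right _ (inter_subset_inter_left _ (M.staysAway_mono O _ t h))
  refine tendsto_nhds_unique h1 ?_
  simp_rw [fun n => (M.measure_staysAway hτ O n t hB hA x).2]
  refine tendsto_lintegral_of_dominated_convergence (fun _ => 1)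
    (fun k => (hmeas k).comp (M.measurable_stoppedValue hτ))
    (fun k => Eventually.of_forall fun ω => prob_le_one) (by simp)
    (Eventually.of_forall fun ω => hlim _)

/-- Strong Markov property of the process killed at the exit from `O`. -/
lemma measure_add_lt_exitTime (M : StandardMarkovProcess E Ω) {O : Set E} (hO : IsOpen O)
    {τ : Ω → WithTop ℝ≥0} (hτ : IsStoppingTime M.filt τ) (t : ℝ≥0) {B : Set E}
    (hB : MeasurableSet B) {A : Set Ω} (hA : MeasurableSet[hτ.measurableSpace] A) (x : E) :
    (Measurable fun y => M.P y {ω | t < M.exitTime O ω ∧ M.X t ω ∈ B}) ∧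
    M.P x (A ∩ {ω | τ ω + t < M.exitTime O ω ∧ M.X ((τ ω).untopA + t) ω ∈ B}) =
      ∫⁻ ω in A ∩ {ω | τ ω < M.exitTime O ω}, M.P (stoppedValue M.X τ ω)
        {ω | t < M.exitTime O ω ∧ M.X t ω ∈ B} ∂(M.P x) := by
  obtain ⟨N, hN, hN0, h⟩ := M.exists_null_add_lt_exitTime hO
  obtain ⟨N', hN', hN0', h'⟩ := M.exists_null_lt_exitTime hO
  have hae : ∀ y, ∀ᵐ ω ∂(M.P y), ω ∉ N ∧ ω ∉ N' := fun y =>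
    (measure_eq_zero_iff_ae_notMem.1 (hN0 y)).and (measure_eq_zero_iff_ae_notMem.1 (hN0' y))
  have e1 : ∀ y, M.P y {ω | t < M.exitTime O ω ∧ M.X t ω ∈ B} =
      M.P y ((⋃ n, M.staysAway O n (fun _ => 0) t) ∩ {ω | M.X t ω ∈ B}) := by
    intro y
    refine measure_congr ?_
    filter_upwards [hae y] with ω hω
    refine propext (and_congr_left' ?_)
    rw [h' ω hω.2 t, mem_iUnion]
    refine exists_congr fun n => forall₂_congr fun u _ => ?_
    change _ ↔ M.X (0 + u) ω ∈ _
    rw [zero_add]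
  -- Survival up to `τ` is known at time `τ`, so it can be absorbed into the conditioning event `A`.
  have hlt : MeasurableSet[hτ.measurableSpace] {ω | τ ω < M.exitTime O ω} := by
    have := ((M.isStoppingTime_exitTime hO).measurableSet_stopping_time_le hτ).compl
    convert this using 1
    ext ω; simp
  have hAlt : A ∩ {ω | τ ω < M.exitTime O ω} ∩ {ω | τ ω ≠ ⊤} =
      A ∩ {ω | τ ω < M.exitTime O ω} := by
    refine inter_eq_left.2 fun ω hω => hω.2.ne_top
  have key := M.measure_iUnion_staysAway hτ O t hB (hA.inter hlt) x
  rw [hAlt] at key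
  simp_rw [e1]
  refine ⟨key.1, Eq.trans (measure_congr ?_) key.2⟩
  filter_upwards [hae x] with ω hω
  refine propext ?_
  change (ω ∈ A ∧ _ ∧ _) ↔ ((ω ∈ A ∧ _) ∧ _ ∧ _)
  by_cases htop : τ ω = ⊤
  · refine iff_of_false (fun hh => ?_) fun hh => ?_
    · have := hh.2.1
      rw [htop, WithTop.top_add] at this
      exact not_top_lt this
    · exact hh.1.2.ne_top htop
  · rw [h ω hω.1 τ t htop]
    simp only [mem_ofPred_eq]
    tauto

end StandardMarkovProcess

/-! ### Bounded measurable functions and measurable families of measures -/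

/-- Bounded measurable real functions. -/
def BddMeas {Z : Type*} [MeasurableSpace Z] (g : Z → ℝ) : Prop :=
  Measurable g ∧ ∃ C, ∀ z, |g z| ≤ C

namespace BddMeas

variable {Z : Type*} [MeasurableSpace Z] {g h : Z → ℝ}

lemma exists_pos_bound (hg : BddMeas g) : ∃ C, 0 < C ∧ ∀ z, |g z| ≤ C := by
  obtain ⟨C, hC⟩ := hg.2
  exact ⟨max C 1, by positivity, fun z => (hC z).trans (le_max_left _ _)⟩

lemma add (hg : BddMeas g) (hh : BddMeas h) : BddMeas fun z => g z + h z := by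
  obtain ⟨C, hC⟩ := hg.2
  obtain ⟨D, hD⟩ := hh.2
  exact ⟨hg.1.add hh.1, C + D, fun z => (abs_add_le _ _).trans (add_le_add (hC z) (hD z))⟩

lemma const_mul (hg : BddMeas g) (c : ℝ) : BddMeas fun z => c * g z := by
  obtain ⟨C, hC⟩ := hg.2
  refine ⟨hg.1.const_mul c, |c| * C, fun z => ?_⟩
  rw [abs_mul]
  exact mul_le_mul_of_nonneg_left (hC z) (abs_nonneg c)

lemma const (c : ℝ) : BddMeas fun _ : Z => c := ⟨measurable_const, |c|, fun _ => le_rfl⟩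

lemma neg (hg : BddMeas g) : BddMeas fun z => -g z := by
  obtain ⟨C, hC⟩ := hg.2
  exact ⟨hg.1.neg, C, fun z => by rw [abs_neg]; exact hC z⟩

lemma sub (hg : BddMeas g) (hh : BddMeas h) : BddMeas fun z => g z - h z := by
  simpa only [sub_eq_add_neg] using hg.add hh.neg

lemma max (hg : BddMeas g) (hh : BddMeas h) : BddMeas fun z => max (g z) (h z) := by
  obtain ⟨C, hC⟩ := hg.2
  obtain ⟨D, hD⟩ := hh.2
  exact ⟨hg.1.max hh.1, Max.max C D, fun z => abs_max_le_max_abs_abs.trans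
    (max_le_max (hC z) (hD z))⟩

lemma of_bcf [TopologicalSpace Z] [OpensMeasurableSpace Z] (g : Z →ᵇ ℝ) : BddMeas g :=
  ⟨g.continuous.measurable, ‖g‖, fun z => g.norm_coe_le_norm z⟩

lemma integrable (hg : BddMeas g) (μ : Measure Z) [IsFiniteMeasure μ] : Integrable g μ := by
  obtain ⟨C, hC⟩ := hg.2
  exact Integrable.of_bound hg.1.aestronglyMeasurable C (Eventually.of_forall hC)

lemma comp {Y : Type*} [MeasurableSpace Y] (hg : BddMeas g) {f : Y → Z} (hf : Measurable f) :
    BddMeas fun y => g (f y) := ⟨hg.1.comp hf, hg.2.imp fun _ hC _ => hC _⟩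

end BddMeas

lemma abs_integral_le_of_measure_le_one {Z : Type*} [MeasurableSpace Z] {μ : Measure Z}
    (hμ : μ univ ≤ 1) {g : Z → ℝ} {C : ℝ} (hC : ∀ z, |g z| ≤ C) (hC0 : 0 ≤ C) :
    |∫ z, g z ∂μ| ≤ C := by
  have : IsFiniteMeasure μ := ⟨hμ.trans_lt ENNReal.one_lt_top⟩
  have h := norm_integral_le_of_norm_le_const (μ := μ) (f := g) (Eventually.of_forall hC)
  have h1 : μ.real univ ≤ 1 := ENNReal.toReal_le_of_le_ofReal zero_le_one (by simpa using hμ)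
  exact h.trans (mul_le_of_le_one_right hC0 h1)

/-- Closed sets form a generating π-system and their indicators are limits of continuous functions.
Joint measurability of the killed kernels in time and starting point comes from this criterion,
because right continuity in time is available for integrals of continuous functions. -/
lemma measurable_measure_of_integral_bcf {α Y : Type*} [MeasurableSpace α] [PseudoEMetricSpace Y]
    [MeasurableSpace Y] [BorelSpace Y] {μ : α → Measure Y} [∀ a, IsFiniteMeasure (μ a)]
    (h : ∀ g : Y →ᵇ ℝ, Measurable fun a => ∫ y, g y ∂(μ a)) : Measurable μ := by
  have hl : ∀ g : Y →ᵇ ℝ≥0, Measurable fun a => ∫⁻ y, g y ∂(μ a) := by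
    intro g
    have h1 : ∀ a, ∫⁻ y, g y ∂(μ a) = ENNReal.ofReal
        (∫ y, BoundedContinuousFunction.comp _ NNReal.isometry_coe.lipschitz g y ∂(μ a)) := by
      intro a
      change _ = ENNReal.ofReal (∫ y, (g y : ℝ) ∂(μ a))
      rw [← BoundedContinuousFunction.toReal_lintegral_coe_eq_integral, ENNReal.ofReal_toReal]
      exact (BoundedContinuousFunction.lintegral_lt_top_of_nnreal (μ a) g).ne
    simp_rw [h1]
    exact (h _).ennreal_ofReal
  have hcl : ∀ F : Set Y, IsClosed F → Measurable fun a => μ a F := by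
    intro F hF
    refine measurable_of_tendsto_metrizable (f := fun (n : ℕ) a => ∫⁻ y,
      thickenedIndicator (δ := 1 / ((n : ℝ) + 1)) Nat.one_div_pos_of_nat F y ∂(μ a))
      (fun n => hl _) (tendsto_pi_nhds.2 fun a => ?_)
    exact tendsto_lintegral_thickenedIndicator_of_isClosed (μ a) hF _
      tendsto_one_div_add_atTop_nhds_zero_nat
  exact Measurable.measure_of_isPiSystem
    (by rw [← borel_eq_generateFrom_isClosed]; exact BorelSpace.measurable_eq)
    isPiSystem_isClosed hcl (hcl _ isClosed_univ)

lemma integral_measure_bind {Y Z : Type*} [MeasurableSpace Y] [MeasurableSpace Z] {μ : Measure Y}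
    [IsFiniteMeasure μ] (κ : ProbabilityTheory.Kernel Y Z) [ProbabilityTheory.IsSFiniteKernel κ]
    {g : Z → ℝ} (hg : Integrable g (μ.bind κ)) :
    ∫ z, g z ∂(μ.bind κ) = ∫ y, ∫ z, g z ∂(κ y) ∂μ := by
  have h : (ProbabilityTheory.Kernel.comp κ (ProbabilityTheory.Kernel.const Unit μ)) () =
      μ.bind κ := by
    rw [ProbabilityTheory.Kernel.comp_apply, ProbabilityTheory.Kernel.const_apply]
  rw [← h] at hg ⊢
  rw [ProbabilityTheory.Kernel.integral_comp hg, ProbabilityTheory.Kernel.const_apply]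

/-! ### Space-time transition measures of the killed process -/

namespace StandardMarkovProcess

variable {E Ω : Type*} [MetricSpace E] [MeasurableSpace E] [MeasurableSpace Ω]

/-- The law of `(s + t, X t)` on `{t < τ_O}` under `P x`, at the argument `(t, s, x)`. -/
noncomputable def killedMeasure (M : StandardMarkovProcess E Ω) (O : Set E)
    (p : ℝ≥0 × ℝ≥0 × E) : Measure (ℝ≥0 × E) :=
  ((M.P p.2.2).restrict {ω | p.1 < M.exitTime O ω}).map fun ω => (p.2.1 + p.1, M.X p.1 ω)

/-- The law of `(s + τ, X τ)` on `{τ < τ_O}` under `P x`. -/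
noncomputable def killedLaw (M : StandardMarkovProcess E Ω) (O : Set E) (τ : Ω → WithTop ℝ≥0)
    (s : ℝ≥0) (x : E) : Measure (ℝ≥0 × E) :=
  ((M.P x).restrict {ω | τ ω < M.exitTime O ω}).map
    fun ω => (s + (τ ω).untopA, stoppedValue M.X τ ω)

instance (M : StandardMarkovProcess E Ω) (O : Set E) (p : ℝ≥0 × ℝ≥0 × E) :
    IsFiniteMeasure (M.killedMeasure O p) := by
  unfold killedMeasure; infer_instance

instance (M : StandardMarkovProcess E Ω) (O : Set E) (τ : Ω → WithTop ℝ≥0)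
    (s : ℝ≥0) (x : E) : IsFiniteMeasure (M.killedLaw O τ s x) := by
  unfold killedLaw; infer_instance

lemma measurable_pair (M : StandardMarkovProcess E Ω) (s t : ℝ≥0) :
    Measurable fun ω => (s + t, M.X t ω) := measurable_const.prodMk (M.measurable_X t)

lemma killedMeasure_univ_le (M : StandardMarkovProcess E Ω) (O : Set E) (p : ℝ≥0 × ℝ≥0 × E) :
    M.killedMeasure O p univ ≤ 1 := by
  rw [killedMeasure, Measure.map_apply (M.measurable_pair _ _) .univ]
  exact (Measure.restrict_apply_le _ _).trans prob_le_one

lemma integral_killedMeasure (M : StandardMarkovProcess E Ω) (O : Set E) (p : ℝ≥0 × ℝ≥0 × E)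
    {g : ℝ≥0 × E → ℝ} (hg : Measurable g) :
    ∫ z, g z ∂(M.killedMeasure O p) =
      ∫ ω in {ω | p.1 < M.exitTime O ω}, g (p.2.1 + p.1, M.X p.1 ω) ∂(M.P p.2.2) := by
  rw [killedMeasure, integral_map (M.measurable_pair _ _).aemeasurable hg.aestronglyMeasurable]

lemma killedMeasure_prod (M : StandardMarkovProcess E Ω) (O : Set E)
    (p : ℝ≥0 × ℝ≥0 × E) {I : Set ℝ≥0} (hI : MeasurableSet I) {B : Set E} (hB : MeasurableSet B) :
    M.killedMeasure O p (I ×ˢ B) = I.indicator 1 (p.2.1 + p.1) *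
      M.P p.2.2 {ω | p.1 < M.exitTime O ω ∧ M.X p.1 ω ∈ B} := by
  rw [killedMeasure, Measure.map_apply (M.measurable_pair _ _) (hI.prod hB),
    Measure.restrict_apply (M.measurable_pair _ _ (hI.prod hB))]
  by_cases h : p.2.1 + p.1 ∈ I
  · rw [indicator_of_mem h, Pi.one_apply, one_mul]
    congr 1
    ext ω
    simp only [mem_inter_iff, mem_preimage, mem_prod, h, true_and, mem_ofPred_eq]
    tauto
  · rw [indicator_of_notMem h, zero_mul]
    convert measure_empty (μ := M.P p.2.2)
    ext ω
    simp [h]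

variable [BorelSpace E] [SecondCountableTopology E]

lemma measurableSet_lt_exitTime (M : StandardMarkovProcess E Ω) {O : Set E} (hO : IsOpen O)
    {τ : Ω → WithTop ℝ≥0} (hτ : IsStoppingTime M.filt τ) :
    MeasurableSet {ω | τ ω < M.exitTime O ω} :=
  measurableSet_lt hτ.measurable' (M.isStoppingTime_exitTime hO).measurable'

lemma measurable_stoppedPair (M : StandardMarkovProcess E Ω) {τ : Ω → WithTop ℝ≥0}
    (hτ : IsStoppingTime M.filt τ) (s : ℝ≥0) :
    Measurable fun ω => (s + (τ ω).untopA, stoppedValue M.X τ ω) :=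
  (hτ.measurable'.untopA.const_add s).prodMk (M.measurable_stoppedValue hτ)

/-- Strong Markov property in terms of the killed transition measures. -/
lemma killedLaw_add_const (M : StandardMarkovProcess E Ω) {O : Set E} (hO : IsOpen O)
    {τ : Ω → WithTop ℝ≥0} (hτ : IsStoppingTime M.filt τ) (t s : ℝ≥0) (x : E)
    (hmeas : Measurable fun z => M.killedMeasure O (t, z)) :
    M.killedLaw O (fun ω => τ ω + t) s x =
      (M.killedLaw O τ s x).bind fun z => M.killedMeasure O (t, z) := by
  have hτ' := isStoppingTime_add_const hτ t
  refine Measure.ext_prod fun {I} {B} hI hB => ?_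
  -- The condition on the time coordinate is known at time `τ`, so it plays the role of `A` in the
  -- strong Markov property.
  have hI' : MeasurableSet[hτ.measurableSpace] {ω | s + (τ ω).untopA + t ∈ I} := by
    have : Measurable[hτ.measurableSpace] fun ω => s + (τ ω).untopA + t :=
      (Measurable.untopA hτ.measurable).const_add s |>.add_const t
    exact this hI
  rw [Measure.bind_apply (hI.prod hB) hmeas.aemeasurable, killedLaw, killedLaw,
    lintegral_map (f := fun z => M.killedMeasure O (t, z) (I ×ˢ B))
      ((Measure.measurable_coe (hI.prod hB)).comp hmeas) (M.measurable_stoppedPair hτ s),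
    Measure.map_apply (M.measurable_stoppedPair hτ' s) (hI.prod hB),
    Measure.restrict_apply (M.measurable_stoppedPair hτ' s (hI.prod hB))]
  simp_rw [M.killedMeasure_prod O _ hI hB]
  have h1 : ∫⁻ ω in {ω | τ ω < M.exitTime O ω}, I.indicator 1 (s + (τ ω).untopA + t) *
      M.P (stoppedValue M.X τ ω) {ω | t < M.exitTime O ω ∧ M.X t ω ∈ B} ∂(M.P x) =
      ∫⁻ ω in {ω | τ ω < M.exitTime O ω}, {ω | s + (τ ω).untopA + t ∈ I}.indicator
      (fun ω => M.P (stoppedValue M.X τ ω) {ω | t < M.exitTime O ω ∧ M.X t ω ∈ B}) ω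
        ∂(M.P x) := by
    refine lintegral_congr fun ω => ?_
    by_cases h : s + (τ ω).untopA + t ∈ I
    · rw [indicator_of_mem h, indicator_of_mem (by exact h), Pi.one_apply, one_mul]
    · rw [indicator_of_notMem h, indicator_of_notMem (by exact h), zero_mul]
  rw [h1, setLIntegral_indicator (hτ.measurableSpace_le _ hI'),
    ← (M.measure_add_lt_exitTime hO hτ t hB hI' x).2]
  congr 1
  ext ω
  simp only [mem_inter_iff, mem_preimage, mem_prod, mem_ofPred_eq, stoppedValue]
  by_cases htop : τ ω = ⊤
  · rw [htop, WithTop.top_add]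
    simp
  · have hunt : (τ ω + t).untopA = (τ ω).untopA + t := by
      lift τ ω to ℝ≥0 using htop with r
      rfl
    rw [hunt, add_assoc]
    tauto

lemma measurable_killedMeasure_right (M : StandardMarkovProcess E Ω) {O : Set E} (hO : IsOpen O)
    (t : ℝ≥0) : Measurable fun z => M.killedMeasure O (t, z) := by
  have hrect : ∀ (I : Set ℝ≥0) (B : Set E), MeasurableSet I → MeasurableSet B →
      Measurable fun z => M.killedMeasure O (t, z) (I ×ˢ B) := by
    intro I B hI hB
    simp_rw [M.killedMeasure_prod O _ hI hB]
    -- The measurability statement used here comes bundled with a starting point, hence the separate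
    -- case of empty `E`.
    by_cases hne : Nonempty E
    · obtain ⟨x⟩ := hne
      have h := (M.measure_add_lt_exitTime hO (isStoppingTime_const M.filt (0 : ℝ≥0)) t hB
        (@MeasurableSet.univ _ (_)) x).1
      exact (((measurable_one.indicator hI).comp (measurable_fst.add_const t)).mul
        (h.comp measurable_snd))
    · rw [not_nonempty_iff] at hne
      exact measurable_of_empty _
  refine Measurable.measure_of_isPiSystem generateFrom_prod.symm isPiSystem_prod ?_ ?_
  · rintro _ ⟨I, hI, B, hB, rfl⟩
    exact hrect I B hI hB
  · rw [← univ_prod_univ]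
    exact hrect _ _ .univ .univ

/-- Both the path and the indicator of `r < τ_O` are right-continuous in `r`: survival past `t` is
an open condition, and death by time `t` is permanent. -/
lemma tendsto_integral_killedMeasure (M : StandardMarkovProcess E Ω) {O : Set E} (hO : IsOpen O)
    (g : ℝ≥0 × E →ᵇ ℝ) (t : ℝ≥0) (z : ℝ≥0 × E) :
    Tendsto (fun r => ∫ y, g y ∂(M.killedMeasure O (r, z))) (𝓝[≥] t)
      (𝓝 (∫ y, g y ∂(M.killedMeasure O (t, z)))) := by
  have hm : ∀ r : ℝ≥0, MeasurableSet {ω | r < M.exitTime O ω} := fun r =>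
    M.measurableSet_lt_exitTime hO (isStoppingTime_const M.filt r)
  simp_rw [M.integral_killedMeasure O _ g.continuous.measurable, ← integral_indicator (hm _)]
  refine tendsto_integral_filter_of_dominated_convergence (fun _ => ‖g‖)
    (Eventually.of_forall fun r => ?_) (Eventually.of_forall fun r => ?_)
    (integrable_const _) (Eventually.of_forall fun ω => ?_)
  · exact ((g.continuous.measurable.comp (M.measurable_pair _ _)).indicator
      (hm r)).aestronglyMeasurable
  · exact Eventually.of_forall fun ω => (norm_indicator_le_norm_self _ _).trans
      (g.norm_coe_le_norm _)
  · by_cases h : t < M.exitTime O ω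
    · have hev : ∀ᶠ r : ℝ≥0 in 𝓝[≥] t, r < M.exitTime O ω :=
        nhdsWithin_le_nhds ((WithTop.continuous_coe.tendsto t).eventually_lt_const h)
      have h1 : Tendsto (fun r : ℝ≥0 => g (z.1 + r, M.X r ω)) (𝓝[≥] t)
          (𝓝 (g (z.1 + t, M.X t ω))) := by
        refine (g.continuous.tendsto _).comp (Tendsto.prodMk_nhds ?_ ?_)
        · exact ((continuous_const.add continuous_id).tendsto t).mono_left nhdsWithin_le_nhds
        · exact M.right_continuous_paths ω t
      rw [indicator_of_mem (by exact h)]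
      refine h1.congr' ?_
      filter_upwards [hev] with r hr
      rw [indicator_of_mem (by exact hr)]
    · rw [indicator_of_notMem (by exact h)]
      refine tendsto_const_nhds.congr' ?_
      filter_upwards [self_mem_nhdsWithin] with r hr
      rw [indicator_of_notMem]
      intro (hr' : r < M.exitTime O ω)
      exact h ((WithTop.coe_le_coe.2 hr).trans_lt hr')

lemma measurable_killedMeasure (M : StandardMarkovProcess E Ω) {O : Set E} (hO : IsOpen O) :
    Measurable (M.killedMeasure O) := by
  refine measurable_measure_of_integral_bcf fun g => ?_
  refine measurable_of_tendsto_metrizable (f := fun (n : ℕ) (p : ℝ≥0 × ℝ≥0 × E) =>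
    ∫ y, g y ∂(M.killedMeasure O (dyadicRight n p.1, p.2))) ?_ ?_
  · intro n
    refine measurable_natFloor_comp
      (v := fun k z => ∫ y, g y ∂(M.killedMeasure O (dyadicStep n k, z))) (fun k => ?_)
      (measurable_fst.mul_const _) measurable_snd
    exact (StronglyMeasurable.integral_kernel (κ := ⟨_, M.measurable_killedMeasure_right hO _⟩)
      g.continuous.stronglyMeasurable).measurable
  · rw [tendsto_pi_nhds]
    rintro ⟨t, z⟩
    exact (M.tendsto_integral_killedMeasure hO g t z).comp (tendsto_nhdsWithin_iff.2
      ⟨tendsto_dyadicRight t, Eventually.of_forall fun n => (lt_dyadicRight n t).le⟩)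

end StandardMarkovProcess

/-! ### Laplace transforms and discount factors -/

lemma integrableOn_exp_neg_mul {α : ℝ} (hα : 0 < α) :
    IntegrableOn (fun u : ℝ => Real.exp (-α * u)) (Ioi 0) :=
  integrableOn_exp_mul_Ioi (neg_lt_zero.2 hα) 0

lemma integral_exp_neg_mul {α : ℝ} (hα : 0 < α) :
    ∫ u in Ioi (0 : ℝ), Real.exp (-α * u) = 1 / α := by
  rw [integral_exp_mul_Ioi (neg_lt_zero.2 hα)]
  simp

lemma integrableOn_exp_mul_of_bdd {α : ℝ} (hα : 0 < α) {F : ℝ → ℝ} (hF : BddMeas F) :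
    IntegrableOn (fun u => Real.exp (-α * u) * F u) (Ioi 0) := by
  obtain ⟨C, hC⟩ := hF.2
  exact (integrableOn_exp_neg_mul hα).mul_bdd hF.1.aestronglyMeasurable (Eventually.of_forall hC)

lemma abs_integral_exp_mul_le {α : ℝ} (hα : 0 < α) {F : ℝ → ℝ} {C : ℝ} (hC : ∀ u, |F u| ≤ C) :
    |∫ u in Ioi (0 : ℝ), Real.exp (-α * u) * F u| ≤ C / α := by
  have h := norm_integral_le_of_norm_le (μ := volume.restrict (Ioi (0 : ℝ)))
    ((integrableOn_exp_neg_mul hα).mul_const C) (f := fun u => Real.exp (-α * u) * F u)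
    (Eventually.of_forall fun u => by
      rw [norm_mul, Real.norm_eq_abs, Real.abs_exp]
      exact mul_le_mul_of_nonneg_left (hC u) (Real.exp_nonneg _))
  rw [integral_mul_const, integral_exp_neg_mul hα, one_div_mul_eq_div] at h
  exact h

/-- The Laplace transform of a bounded function at large arguments. -/
lemma tendsto_mul_integral_exp {F : ℝ → ℝ} (hF : BddMeas F) {c : ℝ}
    (h0 : Tendsto F (𝓝[>] 0) (𝓝 c)) :
    Tendsto (fun γ : ℝ => γ * ∫ u in Ioi (0 : ℝ), Real.exp (-γ * u) * F u) atTop (𝓝 c) := by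
  obtain ⟨C, hC⟩ := hF.2
  -- Substitute `u = r / γ`: the weight becomes fixed and the argument of `F` shrinks to `0`.
  have h1 : ∀ᶠ γ : ℝ in atTop, ∫ r in Ioi (0 : ℝ), Real.exp (-1 * r) * F (γ⁻¹ * r) =
      γ * ∫ u in Ioi (0 : ℝ), Real.exp (-γ * u) * F u := by
    filter_upwards [eventually_gt_atTop 0] with γ hγ
    have := integral_comp_mul_left_Ioi (fun u => Real.exp (-γ * u) * F u) 0 (inv_pos.2 hγ)
    rw [mul_zero, inv_inv, smul_eq_mul] at this
    rw [← this]
    refine setIntegral_congr_fun measurableSet_Ioi fun r _ => ?_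
    have : -γ * (γ⁻¹ * r) = -1 * r := by field_simp
    simp only [this]
  refine Tendsto.congr' h1 ?_
  have h2 : 𝓝 c = 𝓝 (∫ r in Ioi (0 : ℝ), Real.exp (-1 * r) * c) := by
    rw [integral_mul_const, integral_exp_neg_mul one_pos]
    simp
  rw [h2]
  refine tendsto_integral_filter_of_dominated_convergence (fun r => Real.exp (-1 * r) * C)
    (Eventually.of_forall fun γ => ?_) (Eventually.of_forall fun γ => ?_)
    ((integrableOn_exp_neg_mul one_pos).mul_const C) ?_
  · exact ((Real.measurable_exp.comp (measurable_const_mul _)).mul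
      (hF.1.comp (measurable_const_mul _))).aestronglyMeasurable
  · refine Eventually.of_forall fun r => ?_
    rw [norm_mul, Real.norm_eq_abs, Real.abs_exp]
    exact mul_le_mul_of_nonneg_left (hC _) (Real.exp_nonneg _)
  · filter_upwards [ae_restrict_mem measurableSet_Ioi] with r (hr : 0 < r)
    refine (h0.comp ?_).const_mul _
    refine tendsto_nhdsWithin_iff.2 ⟨?_, ?_⟩
    · simpa using tendsto_inv_atTop_zero.mul_const r
    · filter_upwards [eventually_gt_atTop 0] with γ hγ
      exact mul_pos (inv_pos.2 hγ) hr

lemma integrable_exp_mul_exp_mul {α γ : ℝ} (hα : 0 < α) (hγ : 0 < γ) {F : ℝ × ℝ → ℝ}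
    (hF : BddMeas F) : Integrable (fun p : ℝ × ℝ => Real.exp (-γ * p.1) * Real.exp (-α * p.2) * F p)
      ((volume.restrict (Ioi 0)).prod (volume.restrict (Ioi 0))) := by
  obtain ⟨C, hC⟩ := hF.2
  exact ((integrableOn_exp_neg_mul hγ).mul_prod (integrableOn_exp_neg_mul hα)).mul_bdd
    hF.1.aestronglyMeasurable (Eventually.of_forall hC)

lemma setIntegral_Ioi_comp_add_left (F : ℝ → ℝ) (c : ℝ) :
    ∫ r in Ioi (0 : ℝ), F (c + r) = ∫ w in Ioi c, F w := by
  have h := (measurePreserving_add_left volume c).setIntegral_preimage_emb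
    (measurableEmbedding_addLeft c) F (Ioi c)
  simpa using h

lemma integral_exp_neg_mul_zero {c : ℝ} (hc : c ≠ 0) (w : ℝ) :
    ∫ t in (0 : ℝ)..w, Real.exp (-c * t) = (1 - Real.exp (-c * w)) / c := by
  rw [intervalIntegral.integral_comp_mul_left (fun t => Real.exp t) (neg_ne_zero.2 hc),
    integral_exp, mul_zero, Real.exp_zero, smul_eq_mul]
  field_simp
  ring

/-- The resolvent identity for Laplace transforms. -/
lemma integral_integral_exp_add {α γ : ℝ} (hα : 0 < α) (hγ : α < γ) {F : ℝ → ℝ}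
    (hF : BddMeas F) :
    (γ - α) * ∫ t in Ioi (0 : ℝ), Real.exp (-γ * t) *
        ∫ r in Ioi (0 : ℝ), Real.exp (-α * r) * F (t + r) =
      (∫ w in Ioi (0 : ℝ), Real.exp (-α * w) * F w) -
        ∫ w in Ioi (0 : ℝ), Real.exp (-γ * w) * F w := by
  have hδ : 0 < γ - α := sub_pos.2 hγ
  -- With `w = t + r` the weights become exp(-(γ - α)t) exp(-αw) on `t < w`; Fubini then leaves an
  -- elementary integral over `0 < t < w`.
  have h1 : ∀ t ∈ Ioi (0 : ℝ), Real.exp (-γ * t) *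
      ∫ r in Ioi (0 : ℝ), Real.exp (-α * r) * F (t + r) =
      ∫ w in Ioi (0 : ℝ), Real.exp (-(γ - α) * t) * Real.exp (-α * w) *
        (Ioi t).indicator F w := by
    intro t ht
    have e1 : ∀ w, Real.exp (-(γ - α) * t) * Real.exp (-α * w) * (Ioi t).indicator F w =
        (Ioi t).indicator (fun w => Real.exp (-(γ - α) * t) * Real.exp (-α * w) * F w) w := by
      intro w
      by_cases hw : w ∈ Ioi t
      · simp only [indicator_of_mem hw]
      · simp only [indicator_of_notMem hw, mul_zero]
    simp_rw [e1]
    rw [setIntegral_indicator measurableSet_Ioi, Ioi_inter_Ioi, max_eq_right (le_of_lt ht)]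
    rw [← setIntegral_Ioi_comp_add_left
      (fun w => Real.exp (-(γ - α) * t) * Real.exp (-α * w) * F w) t, ← integral_const_mul]
    refine integral_congr_ae (Eventually.of_forall fun r => ?_)
    simp only
    rw [← mul_assoc, ← Real.exp_add, ← Real.exp_add]
    ring_nf
  have hG : BddMeas fun p : ℝ × ℝ => (Ioi p.1).indicator F p.2 := by
    have : (fun p : ℝ × ℝ => (Ioi p.1).indicator F p.2) =
        {p : ℝ × ℝ | p.1 < p.2}.indicator fun p => F p.2 := by
      ext p; simp [indicator]
    rw [this]
    obtain ⟨C, hC⟩ := hF.2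
    exact ⟨(hF.1.comp measurable_snd).indicator (measurableSet_lt measurable_fst measurable_snd),
      C, fun p => (norm_indicator_le_norm_self (fun p : ℝ × ℝ => F p.2) p).trans (hC _)⟩
  rw [setIntegral_congr_fun measurableSet_Ioi h1,
    integral_integral_swap (integrable_exp_mul_exp_mul hα hδ hG), ← integral_const_mul,
    ← integral_sub (integrableOn_exp_mul_of_bdd hα hF)
      (integrableOn_exp_mul_of_bdd (hα.trans hγ) hF)]
  refine setIntegral_congr_fun measurableSet_Ioi fun w (hw : 0 < w) => ?_
  have e1 : ∀ t, Real.exp (-(γ - α) * t) * Real.exp (-α * w) * (Ioi t).indicator F w =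
      (Iio w).indicator (fun t => Real.exp (-(γ - α) * t) * (Real.exp (-α * w) * F w)) t := by
    intro t
    by_cases hw : t < w
    · rw [indicator_of_mem (mem_Ioi.2 hw), indicator_of_mem (mem_Iio.2 hw), mul_assoc]
    · rw [indicator_of_notMem (by simpa using hw), indicator_of_notMem (by simpa using hw),
        mul_zero]
  simp_rw [e1]
  rw [setIntegral_indicator measurableSet_Iio, Ioi_inter_Iio, integral_mul_const,
    ← integral_Ioc_eq_integral_Ioo, ← intervalIntegral.integral_of_le hw.le,
    integral_exp_neg_mul_zero hδ.ne' w]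
  have : Real.exp (-γ * w) = Real.exp (-(γ - α) * w) * Real.exp (-α * w) := by
    rw [← Real.exp_add]; ring_nf
  rw [this]
  field_simp

lemma integrable_exp_mul_prod {Y : Type*} [MeasurableSpace Y] (μ : Measure Y) [IsFiniteMeasure μ]
    {α : ℝ} (hα : 0 < α) {F : Y × ℝ → ℝ} (hF : BddMeas F) :
    Integrable (fun p : Y × ℝ => Real.exp (-α * p.2) * F p)
      (μ.prod (volume.restrict (Ioi 0))) := by
  obtain ⟨C, hC⟩ := hF.2
  have h := (integrable_const (μ := μ) (1 : ℝ)).mul_prod (integrableOn_exp_neg_mul hα)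
  simp only [one_mul] at h
  exact h.mul_bdd hF.1.aestronglyMeasurable (Eventually.of_forall hC)

lemma bddMeas_integral_exp_mul {Y : Type*} [MeasurableSpace Y] {α : ℝ} (hα : 0 < α)
    {F : Y × ℝ → ℝ} (hF : BddMeas F) :
    BddMeas fun y => ∫ u in Ioi (0 : ℝ), Real.exp (-α * u) * F (y, u) := by
  obtain ⟨C, hC⟩ := hF.2
  refine ⟨?_, C / α, fun y => abs_integral_exp_mul_le hα fun u => hC _⟩
  refine (StronglyMeasurable.integral_prod_right (f := fun y u =>
    Real.exp (-α * u) * F (y, u)) ?_).measurable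
  exact ((Real.measurable_exp.comp (measurable_snd.const_mul _)).mul hF.1).stronglyMeasurable

lemma integral_integral_exp_mul_swap {Y : Type*} [MeasurableSpace Y] (μ : Measure Y)
    [IsFiniteMeasure μ] {α : ℝ} (hα : 0 < α) {F : Y × ℝ → ℝ} (hF : BddMeas F) :
    ∫ y, (∫ u in Ioi (0 : ℝ), Real.exp (-α * u) * F (y, u)) ∂μ =
      ∫ u in Ioi (0 : ℝ), Real.exp (-α * u) * ∫ y, F (y, u) ∂μ := by
  rw [integral_integral_swap (integrable_exp_mul_prod μ hα hF)]
  simp_rw [integral_const_mul]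

lemma discount_coe (α : ℝ) (t : ℝ≥0) : discount α t = Real.exp (-α * t) := rfl

lemma discount_top (α : ℝ) : discount α ⊤ = 0 := rfl

lemma discount_nonneg (α : ℝ) (t : WithTop ℝ≥0) : 0 ≤ discount α t := by
  cases t with
  | top => exact le_rfl
  | coe t => exact Real.exp_nonneg _

lemma discount_le_one {α : ℝ} (hα : 0 < α) (t : WithTop ℝ≥0) : discount α t ≤ 1 := by
  cases t with
  | top => exact zero_le_one
  | coe t =>
    rw [discount_coe, Real.exp_le_one_iff]
    have := t.2
    nlinarith [mul_nonneg hα.le this]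

lemma measurable_discount (α : ℝ) : Measurable (discount α) := by
  refine WithTop.measurable_of_measurable_comp_coe ?_
  exact Real.measurable_exp.comp (measurable_coe_nnreal_real.const_mul _)

/-! ### The space-time resolvent -/

namespace StandardMarkovProcess

variable {E Ω : Type*} [MetricSpace E] [MeasurableSpace E] [MeasurableSpace Ω]

/-- The space-time semigroup of the process killed at the exit from `O`. -/
noncomputable def killedOp (M : StandardMarkovProcess E Ω) (O : Set E) (g : ℝ≥0 × E → ℝ)
    (t : ℝ≥0) (z : ℝ≥0 × E) : ℝ := ∫ y, g y ∂(M.killedMeasure O (t, z))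

/-- The space-time resolvent of the process killed at the exit from `O`. -/
noncomputable def resolvent (M : StandardMarkovProcess E Ω) (O : Set E) (α : ℝ)
    (g : ℝ≥0 × E → ℝ) (z : ℝ≥0 × E) : ℝ :=
  ∫ u in Ioi (0 : ℝ), Real.exp (-α * u) * M.killedOp O g u.toNNReal z

lemma ae_zero_lt_exitTime (M : StandardMarkovProcess E Ω) {O : Set E} (hO : IsOpen O) {x : E}
    (hx : x ∈ O) : ∀ᵐ ω ∂(M.P x), ((0 : ℝ≥0) : WithTop ℝ≥0) < M.exitTime O ω := by
  filter_upwards [M.start x] with ω hω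
  refine lt_of_le_of_ne (zero_le (a := M.exitTime O ω)) fun h => ?_
  have h1 := M.exitTime_mem hO (ω := ω) (by rw [← h]; exact WithTop.coe_ne_top)
  rw [stoppedValue, ← h] at h1
  change M.X 0 ω ∉ O at h1
  exact h1 (hω ▸ hx)

lemma abs_killedOp_le (M : StandardMarkovProcess E Ω) (O : Set E) {g : ℝ≥0 × E → ℝ} {C : ℝ}
    (hC0 : 0 ≤ C) (hC : ∀ z, |g z| ≤ C) (t : ℝ≥0) (z : ℝ≥0 × E) : |M.killedOp O g t z| ≤ C :=
  abs_integral_le_of_measure_le_one (M.killedMeasure_univ_le O _) hC hC0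

lemma abs_resolvent_le (M : StandardMarkovProcess E Ω) (O : Set E) {α : ℝ} (hα : 0 < α)
    {g : ℝ≥0 × E → ℝ} {C : ℝ} (hC0 : 0 ≤ C) (hC : ∀ z, |g z| ≤ C) (z : ℝ≥0 × E) :
    |M.resolvent O α g z| ≤ C / α :=
  abs_integral_exp_mul_le hα fun _ => M.abs_killedOp_le O hC0 hC _ _

variable [BorelSpace E] [SecondCountableTopology E]

lemma bddMeas_killedOp (M : StandardMarkovProcess E Ω) {O : Set E} (hO : IsOpen O)
    {g : ℝ≥0 × E → ℝ} (hg : BddMeas g) :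
    BddMeas fun p : ℝ≥0 × ℝ≥0 × E => M.killedOp O g p.1 p.2 := by
  obtain ⟨C, hC0, hC⟩ := hg.exists_pos_bound
  exact ⟨(StronglyMeasurable.integral_kernel (κ := ⟨_, M.measurable_killedMeasure hO⟩)
    hg.1.stronglyMeasurable).measurable, C, fun p => M.abs_killedOp_le O hC0.le hC _ _⟩

lemma bddMeas_killedOp_swap (M : StandardMarkovProcess E Ω) {O : Set E} (hO : IsOpen O)
    {g : ℝ≥0 × E → ℝ} (hg : BddMeas g) :
    BddMeas fun p : (ℝ≥0 × E) × ℝ => M.killedOp O g p.2.toNNReal p.1 :=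
  (M.bddMeas_killedOp hO hg).comp (f := fun p : (ℝ≥0 × E) × ℝ => (p.2.toNNReal, p.1))
    (by fun_prop)

lemma bddMeas_killedOp_time (M : StandardMarkovProcess E Ω) {O : Set E} (hO : IsOpen O)
    {g : ℝ≥0 × E → ℝ} (hg : BddMeas g) (z : ℝ≥0 × E) :
    BddMeas fun u : ℝ => M.killedOp O g u.toNNReal z :=
  (M.bddMeas_killedOp hO hg).comp (f := fun u : ℝ => (u.toNNReal, z)) (by fun_prop)

lemma bddMeas_resolvent (M : StandardMarkovProcess E Ω) {O : Set E} (hO : IsOpen O) {α : ℝ}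
    (hα : 0 < α) {g : ℝ≥0 × E → ℝ} (hg : BddMeas g) : BddMeas (M.resolvent O α g) :=
  bddMeas_integral_exp_mul hα (M.bddMeas_killedOp_swap hO hg)

lemma integrableOn_resolvent (M : StandardMarkovProcess E Ω) {O : Set E} (hO : IsOpen O) {α : ℝ}
    (hα : 0 < α) {g : ℝ≥0 × E → ℝ} (hg : BddMeas g) (z : ℝ≥0 × E) :
    IntegrableOn (fun u : ℝ => Real.exp (-α * u) * M.killedOp O g u.toNNReal z) (Ioi 0) :=
  integrableOn_exp_mul_of_bdd hα (M.bddMeas_killedOp_time hO hg z)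

/-- The form `g + c * h` serves sums, differences and scalar multiples at once. -/
lemma resolvent_add_mul (M : StandardMarkovProcess E Ω) {O : Set E} (hO : IsOpen O) {α : ℝ}
    (hα : 0 < α) {g h : ℝ≥0 × E → ℝ} (hg : BddMeas g) (hh : BddMeas h) (c : ℝ) (z : ℝ≥0 × E) :
    M.resolvent O α (fun y => g y + c * h y) z =
      M.resolvent O α g z + c * M.resolvent O α h z := by
  rw [resolvent, resolvent, resolvent, ← integral_const_mul, ← integral_add
    (M.integrableOn_resolvent hO hα hg z) ((M.integrableOn_resolvent hO hα hh z).const_mul c)]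
  congr 1
  ext u
  rw [killedOp, integral_add (hg.integrable _) ((hh.integrable _).const_mul c),
    integral_const_mul, killedOp, killedOp]
  ring

lemma resolvent_mono (M : StandardMarkovProcess E Ω) {O : Set E} (hO : IsOpen O) {α : ℝ}
    (hα : 0 < α) {g h : ℝ≥0 × E → ℝ} (hg : BddMeas g) (hh : BddMeas h) (hgh : ∀ z, g z ≤ h z)
    (z : ℝ≥0 × E) : M.resolvent O α g z ≤ M.resolvent O α h z :=
  integral_mono (M.integrableOn_resolvent hO hα hg z) (M.integrableOn_resolvent hO hα hh z)
    fun _ => mul_le_mul_of_nonneg_left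
      (integral_mono (hg.integrable _) (hh.integrable _) hgh) (Real.exp_nonneg _)

lemma integral_killedLaw_add (M : StandardMarkovProcess E Ω) {O : Set E} (hO : IsOpen O)
    {g : ℝ≥0 × E → ℝ} (hg : BddMeas g) {τ : Ω → WithTop ℝ≥0} (hτ : IsStoppingTime M.filt τ)
    (t s : ℝ≥0) (x : E) :
    ∫ z, g z ∂(M.killedLaw O (fun ω => τ ω + t) s x) =
      ∫ z, M.killedOp O g t z ∂(M.killedLaw O τ s x) := by
  have hm := M.measurable_killedMeasure_right hO t
  have : ProbabilityTheory.IsFiniteKernel (⟨_, hm⟩ :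
      ProbabilityTheory.Kernel (ℝ≥0 × E) (ℝ≥0 × E)) :=
    ⟨1, ENNReal.one_lt_top, fun z => M.killedMeasure_univ_le O _⟩
  have e := M.killedLaw_add_const hO hτ t s x hm
  rw [e, show (fun z => M.killedMeasure O (t, z)) = (⟨_, hm⟩ :
    ProbabilityTheory.Kernel (ℝ≥0 × E) (ℝ≥0 × E)) from rfl, integral_measure_bind]
  · rfl
  · have hi := hg.integrable (M.killedLaw O (fun ω => τ ω + t) s x)
    rwa [e] at hi

/-- The semigroup law is the strong Markov property at the deterministic time `t`. -/
lemma killedOp_killedOp (M : StandardMarkovProcess E Ω) {O : Set E} (hO : IsOpen O)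
    {g : ℝ≥0 × E → ℝ} (hg : BddMeas g) (t r : ℝ≥0) (z : ℝ≥0 × E) :
    M.killedOp O (M.killedOp O g r) t z = M.killedOp O g (t + r) z :=
  (M.integral_killedLaw_add hO hg (isStoppingTime_const M.filt t) r z.1 z.2).symm

lemma killedOp_resolvent (M : StandardMarkovProcess E Ω) {O : Set E} (hO : IsOpen O) {α : ℝ}
    (hα : 0 < α) {g : ℝ≥0 × E → ℝ} (hg : BddMeas g) (t : ℝ≥0) (z : ℝ≥0 × E) :
    M.killedOp O (M.resolvent O α g) t z =
      ∫ u in Ioi (0 : ℝ), Real.exp (-α * u) * M.killedOp O g (t + u.toNNReal) z := by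
  refine (integral_integral_exp_mul_swap (M.killedMeasure O (t, z)) hα
    (M.bddMeas_killedOp_swap hO hg)).trans ?_
  congr 1
  ext u
  exact congrArg (Real.exp (-α * u) * ·) (M.killedOp_killedOp hO hg t u.toNNReal z)

lemma resolvent_resolvent_eq (M : StandardMarkovProcess E Ω) {O : Set E} (hO : IsOpen O)
    {α γ : ℝ} (hα : 0 < α) {g : ℝ≥0 × E → ℝ} (hg : BddMeas g) (z : ℝ≥0 × E) :
    M.resolvent O γ (M.resolvent O α g) z = ∫ t in Ioi (0 : ℝ), Real.exp (-γ * t) *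
      ∫ r in Ioi (0 : ℝ), Real.exp (-α * r) * M.killedOp O g (t + r).toNNReal z := by
  refine setIntegral_congr_fun measurableSet_Ioi fun t (ht : 0 < t) => ?_
  rw [M.killedOp_resolvent hO hα hg]
  congr 1
  refine setIntegral_congr_fun measurableSet_Ioi fun r (hr : 0 < r) => ?_
  rw [Real.toNNReal_add ht.le hr.le]

lemma resolvent_comm (M : StandardMarkovProcess E Ω) {O : Set E} (hO : IsOpen O)
    {α γ : ℝ} (hα : 0 < α) (hγ : 0 < γ) {g : ℝ≥0 × E → ℝ} (hg : BddMeas g) (z : ℝ≥0 × E) :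
    M.resolvent O γ (M.resolvent O α g) z = M.resolvent O α (M.resolvent O γ g) z := by
  rw [M.resolvent_resolvent_eq hO hα hg, M.resolvent_resolvent_eq hO hγ hg]
  simp_rw [← integral_const_mul, ← mul_assoc]
  rw [integral_integral_swap]
  · refine integral_congr_ae (Eventually.of_forall fun t => integral_congr_ae
      (Eventually.of_forall fun r => ?_))
    simp only
    rw [add_comm r t, mul_comm (Real.exp _) (Real.exp _)]
  · exact integrable_exp_mul_exp_mul hα hγ
      ((M.bddMeas_killedOp_time hO hg z).comp (measurable_fst.add measurable_snd))

/-- The resolvent identity. -/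
lemma resolvent_identity (M : StandardMarkovProcess E Ω) {O : Set E} (hO : IsOpen O)
    {α γ : ℝ} (hα : 0 < α) (hγ : α < γ) {g : ℝ≥0 × E → ℝ} (hg : BddMeas g) (z : ℝ≥0 × E) :
    M.resolvent O α g z = M.resolvent O γ g z +
      (γ - α) * M.resolvent O γ (M.resolvent O α g) z := by
  rw [M.resolvent_resolvent_eq hO hα hg,
    integral_integral_exp_add hα hγ (M.bddMeas_killedOp_time hO hg z), resolvent, resolvent]
  ring

/-- Starting inside `O` the exit time is almost surely positive, so the killed semigroup tends to
the identity at time `0+`; the Laplace asymptotics then apply. -/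
lemma tendsto_mul_resolvent (M : StandardMarkovProcess E Ω) {O : Set E} (hO : IsOpen O)
    (g : ℝ≥0 × E →ᵇ ℝ) (s : ℝ≥0) {x : E} (hx : x ∈ O) :
    Tendsto (fun γ => γ * M.resolvent O γ g (s, x)) atTop (𝓝 (g (s, x))) := by
  refine tendsto_mul_integral_exp (M.bddMeas_killedOp_time hO (.of_bcf g) _) ?_
  have h0 : M.killedOp O g 0 (s, x) = g (s, x) := by
    rw [killedOp, M.integral_killedMeasure O _ g.continuous.measurable]
    have h1 : (M.P x).restrict {ω | ((0 : ℝ≥0) : WithTop ℝ≥0) < M.exitTime O ω} = M.P x :=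
      Measure.restrict_eq_self_of_ae_mem (M.ae_zero_lt_exitTime hO hx)
    simp only
    rw [h1]
    have h2 : ∀ᵐ ω ∂(M.P x), g (s + 0, M.X 0 ω) = g (s, x) := by
      filter_upwards [M.start x] with ω hω
      rw [hω, add_zero]
    rw [integral_congr_ae h2]
    simp
  rw [← h0]
  refine (M.tendsto_integral_killedMeasure hO g 0 (s, x)).comp ?_
  refine tendsto_nhdsWithin_iff.2 ⟨?_, Eventually.of_forall fun u => mem_Ici.2 zero_le⟩
  have := (continuous_real_toNNReal.tendsto 0).mono_left (nhdsWithin_le_nhds (s := Ioi 0))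
  rwa [Real.toNNReal_zero] at this

end StandardMarkovProcess

/-! ### Path functionals and Dynkin's formula for the killed resolvent -/

lemma discount_of_ne_top (α : ℝ) {t : WithTop ℝ≥0} (h : t ≠ ⊤) :
    discount α t = Real.exp (-α * t.untopA) := by
  lift t to ℝ≥0 using h
  rfl

/-- Splitting the integral over `(0, T)` at the time `a`. -/
lemma integral_lt_eq_add {φ : ℝ → ℝ} (hφ : IntegrableOn φ (Ioi 0)) (a T : WithTop ℝ≥0) :
    ∫ u in Ioi (0 : ℝ), {u : ℝ | (u.toNNReal : WithTop ℝ≥0) < T}.indicator φ u =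
      (∫ u in Ioi (0 : ℝ), {u : ℝ | (u.toNNReal : WithTop ℝ≥0) < min a T}.indicator φ u) +
      ∫ r in Ioi (0 : ℝ), {r : ℝ | a + r.toNNReal < T}.indicator
        (fun r => φ (a.untopA + r)) r := by
  have hmeas : ∀ T : WithTop ℝ≥0, MeasurableSet {u : ℝ | (u.toNNReal : WithTop ℝ≥0) < T} :=
    fun T => measurableSet_lt (by fun_prop) measurable_const
  by_cases h : a < T
  · rw [min_eq_left h.le]
    lift a to ℝ≥0 using h.ne_top with b
    have hb : (0 : ℝ) ≤ b := b.2
    have hint : IntegrableOn ({u : ℝ | (u.toNNReal : WithTop ℝ≥0) < T}.indicator φ) (Ioi 0) :=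
      hφ.indicator (hmeas T)
    rw [← Ioc_union_Ioi_eq_Ioi hb, setIntegral_union (Ioc_disjoint_Ioi le_rfl) measurableSet_Ioi
      (hint.mono_set Ioc_subset_Ioi_self) (hint.mono_set (Ioi_subset_Ioi hb)),
      Ioc_union_Ioi_eq_Ioi hb]
    congr 1
    · rw [integral_Ioc_eq_integral_Ioo, setIntegral_indicator (hmeas b)]
      have e : Ioi (0 : ℝ) ∩ {u : ℝ | (u.toNNReal : WithTop ℝ≥0) < b} = Ioo 0 (b : ℝ) := by
        ext u
        simp only [mem_inter_iff, mem_Ioi, mem_ofPred_eq, mem_Ioo, WithTop.coe_lt_coe]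
        refine and_congr_right fun hu => ?_
        rw [Real.toNNReal_lt_iff_lt_coe hu.le]
      rw [e]
      refine setIntegral_congr_fun measurableSet_Ioo fun u hu => indicator_of_mem ?_ _
      refine lt_trans ?_ h
      rw [WithTop.coe_lt_coe, Real.toNNReal_lt_iff_lt_coe hu.1.le]
      exact hu.2
    · rw [← setIntegral_Ioi_comp_add_left]
      refine setIntegral_congr_fun measurableSet_Ioi fun r (hr : 0 < r) => ?_
      have e : (((b : ℝ) + r).toNNReal : WithTop ℝ≥0) = (b : WithTop ℝ≥0) + r.toNNReal := by
        rw [Real.toNNReal_add hb hr.le, Real.toNNReal_coe, WithTop.coe_add]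
      change indicator _ φ _ = indicator _ _ _
      simp only [indicator, mem_ofPred_eq, e]
      rfl
  · rw [min_eq_right (not_lt.1 h)]
    have e : ∀ r : ℝ, {r : ℝ | a + r.toNNReal < T}.indicator (fun r => φ (a.untopA + r)) r = 0 := by
      intro r
      have hr : r ∉ {r : ℝ | a + r.toNNReal < T} := fun hr : a + r.toNNReal < T => h
        ((le_add_of_nonneg_right (zero_le (a := (r.toNNReal : WithTop ℝ≥0)))).trans_lt hr)
      exact indicator_of_notMem hr _
    simp_rw [e]
    simp

lemma bddMeas_exp_mul {E : Type*} [MeasurableSpace E] {α : ℝ} (hα : 0 < α) {g : ℝ≥0 × E → ℝ} (hg : BddMeas g) :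
    BddMeas fun y : ℝ≥0 × E => Real.exp (-α * y.1) * g y := by
  obtain ⟨C, hC⟩ := hg.2
  refine ⟨by have := hg.1; fun_prop, C, fun z => ?_⟩
  rw [abs_mul, abs_of_nonneg (Real.exp_nonneg _)]
  refine (mul_le_of_le_one_left (abs_nonneg _) ?_).trans (hC z)
  rw [Real.exp_le_one_iff, neg_mul, neg_nonpos]
  exact mul_nonneg hα.le z.1.2

namespace StandardMarkovProcess

variable {E Ω : Type*} [MetricSpace E] [MeasurableSpace E] [MeasurableSpace Ω]

lemma runningIntegral_eq (M : StandardMarkovProcess E Ω) (α : ℝ) (g : ℝ≥0 × E → ℝ) (s : ℝ≥0)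
    (T : WithTop ℝ≥0) (ω : Ω) :
    M.runningIntegral α g s T ω = ∫ u in Ioi (0 : ℝ),
      {u : ℝ | (u.toNNReal : WithTop ℝ≥0) < T}.indicator
        (fun u => Real.exp (-α * u) * g (s + u.toNNReal, M.X u.toNNReal ω)) u := by
  rw [setIntegral_indicator (measurableSet_lt (by fun_prop) measurable_const)]
  rfl

lemma runningIntegral_eq' (M : StandardMarkovProcess E Ω) (α : ℝ)
    (g : ℝ≥0 × E → ℝ) (s : ℝ≥0) (T : Ω → WithTop ℝ≥0) (ω : Ω) :
    M.runningIntegral α g s (T ω) ω = ∫ u in Ioi (0 : ℝ), Real.exp (-α * u) *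
      {ω | (u.toNNReal : WithTop ℝ≥0) < T ω}.indicator
        (fun ω => g (s + u.toNNReal, M.X u.toNNReal ω)) ω := by
  rw [runningIntegral_eq]
  congr 1
  ext u
  simp only [indicator, mul_ite, mul_zero]
  rfl

/-- The space-time process carries its own clock, so a discount factor can be made part of the test
function. -/
lemma killedOp_exp_mul (M : StandardMarkovProcess E Ω) (O : Set E) (α : ℝ) {g : ℝ≥0 × E → ℝ}
    (hg : Measurable g) (t : ℝ≥0) (z : ℝ≥0 × E) :
    M.killedOp O (fun y => Real.exp (-α * y.1) * g y) t z =
      Real.exp (-α * (z.1 + t)) * M.killedOp O g t z := by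
  rw [killedOp, killedOp, M.integral_killedMeasure O _ hg, M.integral_killedMeasure O _ (by fun_prop),
    ← integral_const_mul]
  simp only [NNReal.coe_add]

lemma abs_terminalPayoff_le (M : StandardMarkovProcess E Ω) {α : ℝ} (hα : 0 < α)
    {g : ℝ≥0 × E → ℝ} {C : ℝ} (hC : ∀ z, |g z| ≤ C) (s : ℝ≥0) (τ : Ω → WithTop ℝ≥0) (ω : Ω) :
    |M.terminalPayoff α g s τ ω| ≤ C := by
  rw [terminalPayoff, abs_mul, abs_of_nonneg (discount_nonneg _ _)]
  have h0 : 0 ≤ C := (abs_nonneg _).trans (hC (s + (τ ω).untopA, stoppedValue M.X τ ω))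
  calc discount α (τ ω) * |g _| ≤ 1 * C :=
        mul_le_mul (discount_le_one hα _) (hC _) (abs_nonneg _) zero_le_one
    _ = C := one_mul C

lemma abs_runningIntegral_le (M : StandardMarkovProcess E Ω) {α : ℝ} (hα : 0 < α)
    {g : ℝ≥0 × E → ℝ} {C : ℝ} (hC : ∀ z, |g z| ≤ C) (s : ℝ≥0) (T : WithTop ℝ≥0) (ω : Ω) :
    |M.runningIntegral α g s T ω| ≤ C / α := by
  rw [runningIntegral_eq]
  have e : ∀ u : ℝ, {u : ℝ | (u.toNNReal : WithTop ℝ≥0) < T}.indicator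
        (fun u => Real.exp (-α * u) * g (s + u.toNNReal, M.X u.toNNReal ω)) u =
      Real.exp (-α * u) * {u : ℝ | (u.toNNReal : WithTop ℝ≥0) < T}.indicator
        (fun u => g (s + u.toNNReal, M.X u.toNNReal ω)) u := fun u => by
    simp only [indicator, mul_ite, mul_zero]
  simp_rw [e]
  exact abs_integral_exp_mul_le hα fun u => (norm_indicator_le_norm_self
    (fun u : ℝ => g (s + u.toNNReal, M.X u.toNNReal ω)) u).trans (hC _)

open Classical in
/-- The random variable whose expectation is the functional `payoff`. -/
noncomputable def pathPayoff (M : StandardMarkovProcess E Ω) (O : Set E) (α : ℝ)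
    (f G H : ℝ≥0 × E → ℝ) (s : ℝ≥0) (τ : Ω → WithTop ℝ≥0) (ω : Ω) : ℝ :=
  M.runningIntegral α f s (min (τ ω) (M.exitTime O ω)) ω +
    if τ ω < M.exitTime O ω then M.terminalPayoff α G s τ ω
    else M.terminalPayoff α H s (M.exitTime O) ω

lemma payoff_eq (M : StandardMarkovProcess E Ω) (O : Set E) (α : ℝ)
    (f G H : ℝ≥0 × E → ℝ) (s : ℝ≥0) (x : E) (τ : Ω → WithTop ℝ≥0) :
    M.payoff O α f G H s x τ = ∫ ω, M.pathPayoff O α f G H s τ ω ∂(M.P x) := rfl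

lemma pathPayoff_of_lt (M : StandardMarkovProcess E Ω) {O : Set E} {α : ℝ}
    {f G H : ℝ≥0 × E → ℝ} {s : ℝ≥0} {τ : Ω → WithTop ℝ≥0} {ω : Ω}
    (h : τ ω < M.exitTime O ω) : M.pathPayoff O α f G H s τ ω =
      M.runningIntegral α f s (min (τ ω) (M.exitTime O ω)) ω + M.terminalPayoff α G s τ ω := by
  rw [pathPayoff, if_pos h]

lemma pathPayoff_of_not_lt (M : StandardMarkovProcess E Ω) {O : Set E} {α : ℝ}
    {f G H : ℝ≥0 × E → ℝ} {s : ℝ≥0} {τ : Ω → WithTop ℝ≥0} {ω : Ω}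
    (h : ¬ τ ω < M.exitTime O ω) : M.pathPayoff O α f G H s τ ω =
      M.runningIntegral α f s (min (τ ω) (M.exitTime O ω)) ω +
        M.terminalPayoff α H s (M.exitTime O) ω := by
  rw [pathPayoff, if_neg h]

lemma abs_pathPayoff_le (M : StandardMarkovProcess E Ω) (O : Set E) {α : ℝ} (hα : 0 < α)
    {f G H : ℝ≥0 × E → ℝ} {C D : ℝ} (hf : ∀ z, |f z| ≤ C) (hG : ∀ z, |G z| ≤ D)
    (hH : ∀ z, |H z| ≤ D) (s : ℝ≥0) (τ : Ω → WithTop ℝ≥0) (ω : Ω) :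
    |M.pathPayoff O α f G H s τ ω| ≤ C / α + D := by
  by_cases h : τ ω < M.exitTime O ω
  · rw [M.pathPayoff_of_lt h]
    exact (abs_add_le _ _).trans (add_le_add (M.abs_runningIntegral_le hα hf _ _ _)
      (M.abs_terminalPayoff_le hα hG _ _ _))
  · rw [M.pathPayoff_of_not_lt h]
    exact (abs_add_le _ _).trans (add_le_add (M.abs_runningIntegral_le hα hf _ _ _)
      (M.abs_terminalPayoff_le hα hH _ _ _))

lemma abs_payoff_le (M : StandardMarkovProcess E Ω) (O : Set E) {α : ℝ} (hα : 0 < α)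
    {f G H : ℝ≥0 × E → ℝ} {C D : ℝ} (hf : ∀ z, |f z| ≤ C) (hG : ∀ z, |G z| ≤ D)
    (hH : ∀ z, |H z| ≤ D) (s : ℝ≥0) (x : E) (τ : Ω → WithTop ℝ≥0) :
    |M.payoff O α f G H s x τ| ≤ C / α + D := by
  have h := norm_integral_le_of_norm_le_const (μ := M.P x)
    (f := M.pathPayoff O α f G H s τ) (C := C / α + D) (Eventually.of_forall fun ω => M.abs_pathPayoff_le O hα hf hG hH s τ ω)
  simpa [payoff_eq] using h

/-- The penalized equation in terms of the functional `payoff` for never stopping. -/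
lemma payoff_top (M : StandardMarkovProcess E Ω) (O : Set E) (α : ℝ)
    (f G H : ℝ≥0 × E → ℝ) (s : ℝ≥0) (x : E) :
    M.payoff O α f G H s x (fun _ => ⊤) = ∫ ω, (M.runningIntegral α f s (M.exitTime O ω) ω +
      M.terminalPayoff α H s (M.exitTime O) ω) ∂(M.P x) := by
  rw [payoff_eq]
  congr 1
  ext ω
  rw [M.pathPayoff_of_not_lt not_top_lt, min_eq_right le_top]

section

variable [BorelSpace E]

lemma bddMeas_path (M : StandardMarkovProcess E Ω) {g : ℝ≥0 × E → ℝ} (hg : BddMeas g)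
    (s : ℝ≥0) (ω : Ω) : BddMeas fun u : ℝ => g (s + u.toNNReal, M.X u.toNNReal ω) := by
  refine hg.comp (f := fun u : ℝ => (s + u.toNNReal, M.X u.toNNReal ω)) ?_
  exact (measurable_real_toNNReal.const_add s).prodMk
    (M.measurable_uncurry_X.comp (measurable_real_toNNReal.prodMk measurable_const))

lemma integrableOn_path (M : StandardMarkovProcess E Ω) {α : ℝ} (hα : 0 < α)
    {g : ℝ≥0 × E → ℝ} (hg : BddMeas g) (s : ℝ≥0) (ω : Ω) : IntegrableOn
      (fun u : ℝ => Real.exp (-α * u) * g (s + u.toNNReal, M.X u.toNNReal ω)) (Ioi 0) :=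
  integrableOn_exp_mul_of_bdd hα (M.bddMeas_path hg s ω)

lemma runningIntegral_add_mul (M : StandardMarkovProcess E Ω) {α : ℝ} (hα : 0 < α)
    {f g : ℝ≥0 × E → ℝ} (hf : BddMeas f) (hg : BddMeas g) (c : ℝ) (s : ℝ≥0) (T : WithTop ℝ≥0)
    (ω : Ω) : M.runningIntegral α (fun z => f z + c * g z) s T ω =
      M.runningIntegral α f s T ω + c * M.runningIntegral α g s T ω := by
  have hm : MeasurableSet {u : ℝ | (u.toNNReal : WithTop ℝ≥0) < T} :=
    measurableSet_lt (by fun_prop) measurable_const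
  rw [runningIntegral_eq, runningIntegral_eq, runningIntegral_eq, ← integral_const_mul,
    ← integral_add ((M.integrableOn_path hα hf s ω).indicator hm)
      (((M.integrableOn_path hα hg s ω).indicator hm).const_mul c)]
  congr 1
  ext u
  simp only [indicator]
  split_ifs <;> ring

lemma bddMeas_stopped_path (M : StandardMarkovProcess E Ω)
    {g : ℝ≥0 × E → ℝ} (hg : BddMeas g) (s : ℝ≥0) {T : Ω → WithTop ℝ≥0} (hT : Measurable T) :
    BddMeas fun p : Ω × ℝ => {ω | (p.2.toNNReal : WithTop ℝ≥0) < T ω}.indicator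
      (fun ω => g (s + p.2.toNNReal, M.X p.2.toNNReal ω)) p.1 := by
  have hg' : BddMeas fun p : Ω × ℝ => g (s + p.2.toNNReal, M.X p.2.toNNReal p.1) := by
    refine hg.comp (f := fun p : Ω × ℝ => (s + p.2.toNNReal, M.X p.2.toNNReal p.1)) ?_
    exact ((measurable_real_toNNReal.comp measurable_snd).const_add s).prodMk
      (M.measurable_uncurry_X.comp
        ((measurable_real_toNNReal.comp measurable_snd).prodMk measurable_fst))
  have e : (fun p : Ω × ℝ => {ω | (p.2.toNNReal : WithTop ℝ≥0) < T ω}.indicator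
      (fun ω => g (s + p.2.toNNReal, M.X p.2.toNNReal ω)) p.1) =
      {p : Ω × ℝ | (p.2.toNNReal : WithTop ℝ≥0) < T p.1}.indicator
        fun p => g (s + p.2.toNNReal, M.X p.2.toNNReal p.1) := by
    ext p; simp only [indicator]; rfl
  rw [e]
  obtain ⟨C, hC⟩ := hg'.2
  exact ⟨hg'.1.indicator (measurableSet_lt (by fun_prop) (hT.comp measurable_fst)), C,
    fun p => (norm_indicator_le_norm_self
      (fun p : Ω × ℝ => g (s + p.2.toNNReal, M.X p.2.toNNReal p.1)) p).trans (hC p)⟩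

lemma bddMeas_runningIntegral (M : StandardMarkovProcess E Ω) {α : ℝ} (hα : 0 < α)
    {g : ℝ≥0 × E → ℝ} (hg : BddMeas g) (s : ℝ≥0) {T : Ω → WithTop ℝ≥0} (hT : Measurable T) :
    BddMeas fun ω => M.runningIntegral α g s (T ω) ω := by
  simp_rw [M.runningIntegral_eq' α g s T]
  exact bddMeas_integral_exp_mul hα (M.bddMeas_stopped_path hg s hT)

lemma integral_runningIntegral (M : StandardMarkovProcess E Ω) {α : ℝ} (hα : 0 < α)
    {g : ℝ≥0 × E → ℝ} (hg : BddMeas g) (s : ℝ≥0) {T : Ω → WithTop ℝ≥0} (hT : Measurable T)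
    (x : E) : ∫ ω, M.runningIntegral α g s (T ω) ω ∂(M.P x) =
      ∫ u in Ioi (0 : ℝ), Real.exp (-α * u) * ∫ ω in {ω | (u.toNNReal : WithTop ℝ≥0) < T ω},
        g (s + u.toNNReal, M.X u.toNNReal ω) ∂(M.P x) := by
  simp_rw [M.runningIntegral_eq' α g s T]
  rw [integral_integral_exp_mul_swap (M.P x) hα (M.bddMeas_stopped_path hg s hT)]
  congr 1
  ext u
  rw [← integral_indicator (measurableSet_lt measurable_const hT)]

variable [SecondCountableTopology E]

lemma bddMeas_terminalPayoff (M : StandardMarkovProcess E Ω) {α : ℝ} (hα : 0 < α)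
    {g : ℝ≥0 × E → ℝ} (hg : BddMeas g) (s : ℝ≥0) {τ : Ω → WithTop ℝ≥0}
    (hτ : IsStoppingTime M.filt τ) : BddMeas (M.terminalPayoff α g s τ) := by
  obtain ⟨C, hC⟩ := hg.2
  exact ⟨((measurable_discount α).comp hτ.measurable').mul
    (hg.1.comp (M.measurable_stoppedPair hτ s)), C, M.abs_terminalPayoff_le hα hC s τ⟩

lemma bddMeas_pathPayoff (M : StandardMarkovProcess E Ω) {O : Set E} (hO : IsOpen O) {α : ℝ}
    (hα : 0 < α) {f G H : ℝ≥0 × E → ℝ} (hf : BddMeas f) (hG : BddMeas G) (hH : BddMeas H)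
    (s : ℝ≥0) {τ : Ω → WithTop ℝ≥0} (hτ : IsStoppingTime M.filt τ) :
    BddMeas (M.pathPayoff O α f G H s τ) := by
  obtain ⟨C, hC⟩ := hf.2
  obtain ⟨D, hD⟩ := hG.2
  obtain ⟨D', hD'⟩ := hH.2
  have hE := M.isStoppingTime_exitTime hO
  refine ⟨?_, _, M.abs_pathPayoff_le O hα hC (fun z => (hD z).trans (le_max_left D D'))
    (fun z => (hD' z).trans (le_max_right D D')) s τ⟩
  exact (M.bddMeas_runningIntegral hα hf s (hτ.measurable'.min hE.measurable')).1.add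
    (Measurable.ite (M.measurableSet_lt_exitTime hO hτ) (M.bddMeas_terminalPayoff hα hG s hτ).1
      (M.bddMeas_terminalPayoff hα hH s hE).1)

lemma payoff_add_mul (M : StandardMarkovProcess E Ω) {O : Set E} (hO : IsOpen O) {α : ℝ}
    (hα : 0 < α) {f G H f' G' H' : ℝ≥0 × E → ℝ} (hf : BddMeas f) (hG : BddMeas G)
    (hH : BddMeas H) (hf' : BddMeas f') (hG' : BddMeas G') (hH' : BddMeas H') (c : ℝ)
    (s : ℝ≥0) (x : E) {τ : Ω → WithTop ℝ≥0} (hτ : IsStoppingTime M.filt τ) :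
    M.payoff O α (fun z => f z + c * f' z) (fun z => G z + c * G' z) (fun z => H z + c * H' z)
      s x τ = M.payoff O α f G H s x τ + c * M.payoff O α f' G' H' s x τ := by
  rw [payoff_eq, payoff_eq, payoff_eq, ← integral_const_mul, ← integral_add
    ((M.bddMeas_pathPayoff hO hα hf hG hH s hτ).integrable _)
    (((M.bddMeas_pathPayoff hO hα hf' hG' hH' s hτ).integrable _).const_mul c)]
  congr 1
  ext ω
  by_cases h : τ ω < M.exitTime O ω
  · rw [M.pathPayoff_of_lt h, M.pathPayoff_of_lt h, M.pathPayoff_of_lt h,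
      M.runningIntegral_add_mul hα hf hf', terminalPayoff, terminalPayoff, terminalPayoff]
    ring
  · rw [M.pathPayoff_of_not_lt h, M.pathPayoff_of_not_lt h, M.pathPayoff_of_not_lt h,
      M.runningIntegral_add_mul hα hf hf', terminalPayoff, terminalPayoff, terminalPayoff]
    ring

/-- Bounded convergence for the functional `payoff` in its terminal data. -/
lemma tendsto_payoff (M : StandardMarkovProcess E Ω) {O : Set E} (hO : IsOpen O) {α : ℝ}
    (hα : 0 < α) {f : ℝ≥0 × E → ℝ} (hf : BddMeas f) {ι : Type*} {l : Filter ι}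
    [l.IsCountablyGenerated] {G H : ι → ℝ≥0 × E → ℝ} {G' H' : ℝ≥0 × E → ℝ} {D : ℝ}
    (hG : ∀ᶠ i in l, Measurable (G i) ∧ ∀ z, |G i z| ≤ D)
    (hH : ∀ᶠ i in l, Measurable (H i) ∧ ∀ z, |H i z| ≤ D)
    (hGlim : ∀ t, ∀ y ∈ O, Tendsto (fun i => G i (t, y)) l (𝓝 (G' (t, y))))
    (hHlim : ∀ z, Tendsto (fun i => H i z) l (𝓝 (H' z)))
    (s : ℝ≥0) (x : E) {τ : Ω → WithTop ℝ≥0} (hτ : IsStoppingTime M.filt τ) :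
    Tendsto (fun i => M.payoff O α f (G i) (H i) s x τ) l (𝓝 (M.payoff O α f G' H' s x τ)) := by
  obtain ⟨C, hC⟩ := hf.2
  simp_rw [payoff_eq]
  refine tendsto_integral_filter_of_dominated_convergence (fun _ => C / α + D) ?_ ?_
    (integrable_const _) (Eventually.of_forall fun ω => ?_)
  · filter_upwards [hG, hH] with i hGi hHi
    exact (M.bddMeas_pathPayoff hO hα hf ⟨hGi.1, D, hGi.2⟩ ⟨hHi.1, D, hHi.2⟩ s
      hτ).1.aestronglyMeasurable
  · filter_upwards [hG, hH] with i hGi hHi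
    exact Eventually.of_forall fun ω => M.abs_pathPayoff_le O hα hC hGi.2 hHi.2 s τ ω
  · by_cases h : τ ω < M.exitTime O ω
    · simp_rw [M.pathPayoff_of_lt h]
      refine ((hGlim _ _ ?_).const_mul _).const_add _
      -- Stopping before the exit happens inside `O`, so convergence of the stopping rewards is
      -- needed only there.
      have hnot := notMem_of_lt_hittingAfter (u := M.X) (s := Oᶜ) (n := 0) (ω := ω)
        (k := (τ ω).untopA) (by rw [coe_untopA_of_ne_top h.ne_top]; exact h) zero_le
      exact not_not.1 hnot
    · simp_rw [M.pathPayoff_of_not_lt h]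
      exact ((hHlim _).const_mul _).const_add _

lemma resolvent_eq_payoff (M : StandardMarkovProcess E Ω) {O : Set E} (hO : IsOpen O) {α : ℝ}
    (hα : 0 < α) {g : ℝ≥0 × E → ℝ} (hg : BddMeas g) (s : ℝ≥0) (x : E) :
    M.resolvent O α g (s, x) = ∫ ω, M.runningIntegral α g s (M.exitTime O ω) ω ∂(M.P x) := by
  rw [M.integral_runningIntegral hα hg s (M.isStoppingTime_exitTime hO).measurable' x]
  simp_rw [resolvent, killedOp, M.integral_killedMeasure O _ hg.1]

/-- The strong Markov property for the discounted killed semigroup. -/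
lemma integral_exp_mul_killedOp (M : StandardMarkovProcess E Ω) {O : Set E} (hO : IsOpen O)
    {α : ℝ} (hα : 0 < α) {g : ℝ≥0 × E → ℝ} (hg : BddMeas g) (s : ℝ≥0) (x : E)
    {τ : Ω → WithTop ℝ≥0} (hτ : IsStoppingTime M.filt τ) (r : ℝ≥0) :
    ∫ ω in {ω | τ ω < M.exitTime O ω}, Real.exp (-α * (τ ω).untopA) *
        M.killedOp O g r (s + (τ ω).untopA, stoppedValue M.X τ ω) ∂(M.P x) =
      ∫ ω in {ω | τ ω + r < M.exitTime O ω}, Real.exp (-α * (τ ω).untopA) *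
        g (s + ((τ ω).untopA + r), M.X ((τ ω).untopA + r) ω) ∂(M.P x) := by
  -- Write exp(-ατ) = exp(α(s + r)) exp(-α(s + τ + r)): a constant times a function of the time
  -- coordinate at `τ + r`. The undiscounted strong Markov property then applies.
  have hg' := bddMeas_exp_mul hα hg
  have hτr := isStoppingTime_add_const hτ r
  have h := M.integral_killedLaw_add hO hg' hτ r s x
  have hm : Measurable fun z => M.killedOp O g r z :=
    (M.bddMeas_killedOp hO hg).1.comp measurable_prodMk_left
  simp_rw [M.killedOp_exp_mul O α hg.1] at h
  rw [killedLaw, killedLaw, integral_map (M.measurable_stoppedPair hτr s).aemeasurable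
    hg'.1.aestronglyMeasurable, integral_map (M.measurable_stoppedPair hτ s).aemeasurable
    (Measurable.aestronglyMeasurable (by fun_prop))] at h
  have e1 : ∀ ω, Real.exp (-α * (τ ω).untopA) *
        M.killedOp O g r (s + (τ ω).untopA, stoppedValue M.X τ ω) = Real.exp (α * (s + r)) *
      (Real.exp (-α * (((s + (τ ω).untopA : ℝ≥0) : ℝ) + r)) *
        M.killedOp O g r (s + (τ ω).untopA, stoppedValue M.X τ ω)) := by
    intro ω
    rw [← mul_assoc, ← Real.exp_add]
    push_cast
    ring_nf
  have e2 : ∫ ω in {ω | τ ω + r < M.exitTime O ω}, Real.exp (-α * (τ ω).untopA) *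
        g (s + ((τ ω).untopA + r), M.X ((τ ω).untopA + r) ω) ∂(M.P x) =
      ∫ ω in {ω | τ ω + r < M.exitTime O ω}, Real.exp (α * (s + r)) *
        (Real.exp (-α * ((s + (τ ω + r).untopA : ℝ≥0) : ℝ)) *
        g (s + (τ ω + r).untopA, stoppedValue M.X (fun ω => τ ω + r) ω)) ∂(M.P x) := by
    refine setIntegral_congr_fun (M.measurableSet_lt_exitTime hO hτr)
      fun ω (hω : τ ω + r < M.exitTime O ω) => ?_
    have hne : τ ω ≠ ⊤ := fun h => by
      rw [h, WithTop.top_add] at hω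
      exact not_top_lt hω
    have e : (τ ω + r).untopA = (τ ω).untopA + r := by
      generalize τ ω = a at hne
      lift a to ℝ≥0 using hne
      rfl
    simp only [stoppedValue, e]
    rw [← mul_assoc, ← Real.exp_add]
    push_cast
    ring_nf
  simp_rw [e1]
  rw [e2, integral_const_mul, integral_const_mul, h]

/-- Dynkin's formula for the resolvent of the killed process. -/
lemma resolvent_eq_payoff_stopped (M : StandardMarkovProcess E Ω) {O : Set E} (hO : IsOpen O)
    {α : ℝ} (hα : 0 < α) {g : ℝ≥0 × E → ℝ} (hg : BddMeas g) (s : ℝ≥0) (x : E)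
    {τ : Ω → WithTop ℝ≥0} (hτ : IsStoppingTime M.filt τ) :
    M.resolvent O α g (s, x) =
      M.payoff O α g (M.resolvent O α g) (fun _ => 0) s x τ := by
  have hE := M.isStoppingTime_exitTime hO
  have hR := M.bddMeas_resolvent hO hα hg
  have hmτ : Measurable τ := hτ.measurable'
  have hmE : Measurable (M.exitTime O) := hE.measurable'
  have hmu : Measurable fun p : Ω × ℝ => (τ p.1).untopA + p.2.toNNReal := by
    have := hmτ.untopA
    fun_prop
  have hset : ∀ ω r, τ ω + (r : ℝ≥0) < M.exitTime O ω ↔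
      τ ω ≠ ⊤ ∧ (((τ ω).untopA + r : ℝ≥0) : WithTop ℝ≥0) < M.exitTime O ω := by
    intro ω r
    by_cases h : τ ω = ⊤
    · simp only [h, WithTop.top_add, not_top_lt, ne_eq, not_true_eq_false, false_and]
    · rw [WithTop.coe_add, coe_untopA_of_ne_top h]
      exact ⟨fun h' => ⟨h, h'⟩, fun h' => h'.2⟩
  have hbdd : BddMeas fun p : Ω × ℝ => {ω | τ ω + p.2.toNNReal < M.exitTime O ω}.indicator
      (fun ω => Real.exp (-α * (τ ω).untopA) * g (s + ((τ ω).untopA + p.2.toNNReal),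
        M.X ((τ ω).untopA + p.2.toNNReal) ω)) p.1 := by
    obtain ⟨C, hC0, hC⟩ := hg.exists_pos_bound
    refine ⟨?_, C, fun p => (norm_indicator_le_norm_self (fun ω => Real.exp (-α * (τ ω).untopA) *
      g (s + ((τ ω).untopA + p.2.toNNReal), M.X ((τ ω).untopA + p.2.toNNReal) ω)) p.1).trans ?_⟩
    · have e : (fun p : Ω × ℝ => {ω | τ ω + p.2.toNNReal < M.exitTime O ω}.indicator
          (fun ω => Real.exp (-α * (τ ω).untopA) * g (s + ((τ ω).untopA + p.2.toNNReal),
            M.X ((τ ω).untopA + p.2.toNNReal) ω)) p.1) =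
          {p : Ω × ℝ | τ p.1 ≠ ⊤ ∧
            (((τ p.1).untopA + p.2.toNNReal : ℝ≥0) : WithTop ℝ≥0) < M.exitTime O p.1}.indicator
          (fun p => Real.exp (-α * (τ p.1).untopA) * g (s + ((τ p.1).untopA + p.2.toNNReal),
            M.X ((τ p.1).untopA + p.2.toNNReal) p.1)) := by
        ext p
        simp only [indicator, mem_ofPred_eq, hset]
      rw [e]
      refine Measurable.indicator ?_ (MeasurableSet.inter ?_ ?_)
      · refine Measurable.mul ?_ (hg.1.comp ((hmu.const_add s).prodMk
          (M.measurable_uncurry_X.comp (hmu.prodMk measurable_fst))))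
        have := hmτ.untopA
        fun_prop
      · exact (hmτ.comp measurable_fst) (measurableSet_singleton (⊤ : WithTop ℝ≥0)).compl
      · exact measurableSet_lt (by fun_prop) (hmE.comp measurable_fst)
    · rw [Real.norm_eq_abs, abs_mul, abs_of_nonneg (Real.exp_nonneg _)]
      refine (mul_le_of_le_one_left (abs_nonneg _) ?_).trans (hC _)
      rw [Real.exp_le_one_iff, neg_mul, neg_nonpos]
      exact mul_nonneg hα.le (NNReal.coe_nonneg _)
  -- By the strong Markov property at `τ`, the resolvent collected at `τ` is the expected running
  -- reward from `τ` until the exit.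
  have key : ∫ ω in {ω | τ ω < M.exitTime O ω}, M.terminalPayoff α (M.resolvent O α g) s τ ω
      ∂(M.P x) = ∫ ω, (∫ r in Ioi (0 : ℝ), Real.exp (-α * r) *
        {ω | τ ω + r.toNNReal < M.exitTime O ω}.indicator
          (fun ω => Real.exp (-α * (τ ω).untopA) *
            g (s + ((τ ω).untopA + r.toNNReal), M.X ((τ ω).untopA + r.toNNReal) ω)) ω)
              ∂(M.P x) := by
    rw [integral_integral_exp_mul_swap (M.P x) hα hbdd]
    have hF : BddMeas fun p : Ω × ℝ => Real.exp (-α * (τ p.1).untopA) *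
        M.killedOp O g p.2.toNNReal (s + (τ p.1).untopA, stoppedValue M.X τ p.1) := by
      obtain ⟨C, hC0, hC⟩ := (M.bddMeas_killedOp hO hg).exists_pos_bound
      have h1 := (M.bddMeas_killedOp hO hg).1.comp (((measurable_real_toNNReal.comp
        measurable_snd).prodMk ((M.measurable_stoppedPair hτ s).comp measurable_fst)) :
          Measurable fun p : Ω × ℝ => (p.2.toNNReal, s + (τ p.1).untopA, stoppedValue M.X τ p.1))
      refine ⟨Measurable.mul ?_ h1, C, fun p => ?_⟩
      · have := hmτ.untopA
        fun_prop
      · rw [abs_mul, abs_of_nonneg (Real.exp_nonneg _)]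
        refine (mul_le_of_le_one_left (abs_nonneg _) ?_).trans (hC (_, _))
        rw [Real.exp_le_one_iff, neg_mul, neg_nonpos]
        exact mul_nonneg hα.le (NNReal.coe_nonneg _)
    have h2 := integral_integral_exp_mul_swap
      ((M.P x).restrict {ω | τ ω < M.exitTime O ω}) hα hF
    have h3 : ∀ ω ∈ {ω | τ ω < M.exitTime O ω}, M.terminalPayoff α (M.resolvent O α g) s τ ω =
        ∫ u in Ioi (0 : ℝ), Real.exp (-α * u) * (Real.exp (-α * (τ ω).untopA) *
        M.killedOp O g u.toNNReal (s + (τ ω).untopA, stoppedValue M.X τ ω)) := by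
      intro ω (hω : τ ω < M.exitTime O ω)
      rw [terminalPayoff, discount_of_ne_top α hω.ne_top, resolvent, ← integral_const_mul]
      congr 1
      ext u
      ring
    rw [setIntegral_congr_fun (M.measurableSet_lt_exitTime hO hτ) h3, h2]
    congr 1
    ext u
    simp only
    rw [integral_indicator (M.measurableSet_lt_exitTime hO (isStoppingTime_add_const hτ _)),
      M.integral_exp_mul_killedOp hO hα hg s x hτ]
  -- Pathwise, the reward up to the exit is the part before `τ` plus exactly the tail appearing in
  -- `key`.
  have hsplit : ∀ ω, M.runningIntegral α g s (M.exitTime O ω) ω =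
      M.runningIntegral α g s (min (τ ω) (M.exitTime O ω)) ω +
        ∫ r in Ioi (0 : ℝ), Real.exp (-α * r) *
        {ω | τ ω + r.toNNReal < M.exitTime O ω}.indicator
          (fun ω => Real.exp (-α * (τ ω).untopA) *
            g (s + ((τ ω).untopA + r.toNNReal), M.X ((τ ω).untopA + r.toNNReal) ω)) ω := by
    intro ω
    rw [runningIntegral_eq, runningIntegral_eq,
      integral_lt_eq_add (M.integrableOn_path hα hg s ω) (τ ω)]
    congr 1
    refine setIntegral_congr_fun measurableSet_Ioi fun r (hr : 0 < r) => ?_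
    simp only [indicator, mem_ofPred_eq, mul_ite, mul_zero]
    have e : (((τ ω).untopA : ℝ) + r).toNNReal = (τ ω).untopA + r.toNNReal := by
      rw [Real.toNNReal_add (NNReal.coe_nonneg _) hr.le, Real.toNNReal_coe]
    rw [e, mul_add, Real.exp_add, mul_left_comm, mul_assoc]
  have hB := bddMeas_integral_exp_mul hα hbdd
  have hA := M.bddMeas_runningIntegral hα hg s (hmτ.min hmE)
  have hT := M.bddMeas_terminalPayoff hα hR s hτ
  have hS := M.measurableSet_lt_exitTime hO hτ
  rw [M.resolvent_eq_payoff hO hα hg]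
  simp_rw [hsplit]
  rw [integral_add (hA.integrable _) (hB.integrable _), ← key, ← integral_indicator hS,
    ← integral_add (hA.integrable _) ((hT.integrable _).indicator hS), payoff_eq]
  congr 1
  ext ω
  by_cases h : τ ω < M.exitTime O ω
  · rw [M.pathPayoff_of_lt h, indicator_of_mem (show ω ∈ {ω | τ ω < M.exitTime O ω} from h)]
  · rw [M.pathPayoff_of_not_lt h, indicator_of_notMem (show ω ∉ {ω | τ ω < M.exitTime O ω} from h), terminalPayoff, mul_zero]

end

end StandardMarkovProcess

/-! ### Discounted exit payoffs through resolvents -/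

lemma isStoppingTime_top {Ω : Type*} {m : MeasurableSpace Ω} (f : Filtration ℝ≥0 m) :
    IsStoppingTime f fun _ => ⊤ := fun i => by
  simp

namespace StandardMarkovProcess

variable {E Ω : Type*} [MetricSpace E] [MeasurableSpace E] [MeasurableSpace Ω]

/-- The expected discounted payoff `E^x [exp (-α τ_O) H(s + τ_O, X τ_O)]` at the exit from `O`. -/
noncomputable def exitValue (M : StandardMarkovProcess E Ω) (O : Set E) (α : ℝ)
    (H : ℝ≥0 × E → ℝ) (z : ℝ≥0 × E) : ℝ :=
  ∫ ω, M.terminalPayoff α H z.1 (M.exitTime O) ω ∂(M.P z.2)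

lemma abs_exitValue_le (M : StandardMarkovProcess E Ω) (O : Set E) {α : ℝ} (hα : 0 < α)
    {H : ℝ≥0 × E → ℝ} {C : ℝ} (hC0 : 0 ≤ C) (hC : ∀ z, |H z| ≤ C) (z : ℝ≥0 × E) :
    |M.exitValue O α H z| ≤ C :=
  abs_integral_le_of_measure_le_one prob_le_one
    (fun ω => M.abs_terminalPayoff_le hα hC z.1 (M.exitTime O) ω) hC0

lemma exitTime_univ (M : StandardMarkovProcess E Ω) (ω : Ω) : M.exitTime univ ω = ⊤ := by
  simp [exitTime, hittingAfter]

lemma tendsto_killedOp (M : StandardMarkovProcess E Ω) (O : Set E) {ι : Type*} {l : Filter ι}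
    [l.IsCountablyGenerated] {g : ι → ℝ≥0 × E → ℝ} {g' : ℝ≥0 × E → ℝ} {D : ℝ}
    (hg : ∀ᶠ i in l, Measurable (g i) ∧ ∀ z, |g i z| ≤ D)
    (hlim : ∀ z, Tendsto (fun i => g i z) l (𝓝 (g' z))) (t : ℝ≥0) (z : ℝ≥0 × E) :
    Tendsto (fun i => M.killedOp O (g i) t z) l (𝓝 (M.killedOp O g' t z)) := by
  refine tendsto_integral_filter_of_dominated_convergence (fun _ => D) ?_ ?_
    (integrable_const _) (Eventually.of_forall hlim)
  · filter_upwards [hg] with i hi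
    exact hi.1.aestronglyMeasurable
  · filter_upwards [hg] with i hi
    exact Eventually.of_forall hi.2

variable [BorelSpace E] [SecondCountableTopology E]

lemma payoff_top_eq_add (M : StandardMarkovProcess E Ω) {O : Set E} (hO : IsOpen O) {α : ℝ}
    (hα : 0 < α) {g G H : ℝ≥0 × E → ℝ} (hg : BddMeas g) (hH : BddMeas H) (s : ℝ≥0) (x : E) :
    M.payoff O α g G H s x (fun _ => ⊤) =
      M.resolvent O α g (s, x) + M.exitValue O α H (s, x) := by
  have hE := M.isStoppingTime_exitTime hO
  rw [payoff_top, integral_add ((M.bddMeas_runningIntegral hα hg s hE.measurable').integrable _)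
    ((M.bddMeas_terminalPayoff hα hH s hE).integrable _), ← M.resolvent_eq_payoff hO hα hg]
  rfl

lemma isPenalizedSolution_iff (M : StandardMarkovProcess E Ω) {O : Set E} (hO : IsOpen O) {α : ℝ}
    (hα : 0 < α) {f G H : ℝ≥0 × E → ℝ} (hf : BddMeas f) (hG : BddMeas G) (hH : BddMeas H) (β : ℝ)
    (u : ℝ≥0 × E → ℝ) : M.IsPenalizedSolution O α f G H β u ↔ BddMeas u ∧
      ∀ z, u z = M.resolvent O α (fun z => f z + β * max (G z - u z) 0) z +
        M.exitValue O α H z := by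
  rw [IsPenalizedSolution, ← and_assoc]
  refine and_congr_right fun hu => ?_
  have hg : BddMeas fun z => f z + β * max (G z - u z) 0 :=
    hf.add (((BddMeas.sub hG hu).max (.const 0)).const_mul β)
  rw [Prod.forall]
  refine forall₂_congr fun s x => ?_
  -- When one never stops, the stopping reward is not collected, so `G := 0` is harmless.
  rw [← M.payoff_top_eq_add (G := 0) hO hα hg hH, payoff_top]

/-- Dynkin's formula for the resolvent of the unkilled process, up to the exit from `O`. -/
lemma resolvent_univ_eq_payoff (M : StandardMarkovProcess E Ω) {O : Set E} (hO : IsOpen O) {α : ℝ}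
    (hα : 0 < α) {g : ℝ≥0 × E → ℝ} (hg : BddMeas g) (s : ℝ≥0) (x : E) {τ : Ω → WithTop ℝ≥0}
    (hτ : IsStoppingTime M.filt τ) :
    M.resolvent univ α g (s, x) =
      M.payoff O α g (M.resolvent univ α g) (M.resolvent univ α g) s x τ := by
  have hE := M.isStoppingTime_exitTime hO
  -- For the unkilled process, use the formula at `τ ∧ τ_O`.
  rw [M.resolvent_eq_payoff_stopped isOpen_univ hα hg s x (hτ.min hE), payoff_eq, payoff_eq]
  congr 1
  ext ω
  rw [pathPayoff, M.exitTime_univ, min_eq_left le_top, pathPayoff]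
  congr 1
  have hzero : ∀ h : ℝ≥0 × E → ℝ, ∀ σ : Ω → WithTop ℝ≥0, σ ω = ⊤ →
      M.terminalPayoff α h s σ ω = 0 := fun h σ hσ => by
    rw [terminalPayoff, hσ, discount_top, zero_mul]
  by_cases h : τ ω < M.exitTime O ω
  · have e : min (τ ω) (M.exitTime O ω) = τ ω := min_eq_left h.le
    rw [if_pos h, if_pos (by rw [e]; exact h.lt_top)]
    simp only [terminalPayoff, stoppedValue, e]
  · have e : min (τ ω) (M.exitTime O ω) = M.exitTime O ω := min_eq_right (not_lt.1 h)
    rw [if_neg h]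
    -- If neither time is finite, both terminal terms vanish because the discount at `⊤` is `0`.
    by_cases h' : M.exitTime O ω = ⊤
    · rw [if_neg (by rw [e, h']; exact lt_irrefl _), hzero _ _ h', hzero _ _ (M.exitTime_univ ω)]
    · rw [if_pos (by rw [e]; exact lt_top_iff_ne_top.2 h')]
      simp only [terminalPayoff, stoppedValue, e]

/-- An infinite-horizon reward is the reward before the exit plus its continuation value at the
exit. For terminal data in the range of `U_α`, questions about exit payoffs thus become questions
about two resolvents. -/
lemma exitValue_resolvent_univ (M : StandardMarkovProcess E Ω) {O : Set E} (hO : IsOpen O) {α : ℝ}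
    (hα : 0 < α) {g : ℝ≥0 × E → ℝ} (hg : BddMeas g) (z : ℝ≥0 × E) :
    M.exitValue O α (M.resolvent univ α g) z = M.resolvent univ α g z - M.resolvent O α g z := by
  have hU := M.bddMeas_resolvent isOpen_univ hα hg
  have h := M.resolvent_univ_eq_payoff hO hα hg z.1 z.2
    (isStoppingTime_top M.filt)
  rw [M.payoff_top_eq_add hO hα hg hU] at h
  change M.resolvent univ α g z = M.resolvent O α g z + M.exitValue O α _ z at h
  rw [h, add_sub_cancel_left]

/-- Difference of the unkilled and the killed Dynkin formulas: the running rewards cancel. -/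
lemma exitValue_resolvent_univ_eq_payoff (M : StandardMarkovProcess E Ω) {O : Set E}
    (hO : IsOpen O) {α : ℝ} (hα : 0 < α) {g : ℝ≥0 × E → ℝ} (hg : BddMeas g) (s : ℝ≥0) (x : E)
    {τ : Ω → WithTop ℝ≥0} (hτ : IsStoppingTime M.filt τ) :
    M.exitValue O α (M.resolvent univ α g) (s, x) = M.payoff O α (fun _ => 0)
      (M.exitValue O α (M.resolvent univ α g)) (M.resolvent univ α g) s x τ := by
  have hU := M.bddMeas_resolvent isOpen_univ hα hg
  have hR := M.bddMeas_resolvent hO hα hg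
  have h := M.payoff_add_mul hO hα hg hU hU hg hR (.const 0) (-1) s x hτ
  rw [← M.resolvent_univ_eq_payoff hO hα hg s x hτ,
    ← M.resolvent_eq_payoff_stopped hO hα hg s x hτ] at h
  rw [M.exitValue_resolvent_univ hO hα hg, sub_eq_add_neg, ← neg_one_mul, ← h]
  congr 1
  · ext z; ring
  · ext z
    rw [M.exitValue_resolvent_univ hO hα hg]
    ring
  · ext z; ring

/-- `γ U_γ H` lies in the range of `U_α`. -/
lemma mul_resolvent_univ_eq (M : StandardMarkovProcess E Ω) {α γ : ℝ} (hα : 0 < α) (hγ : α < γ)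
    {H : ℝ≥0 × E → ℝ} (hH : BddMeas H) :
    (fun z => γ * M.resolvent univ γ H z) = M.resolvent univ α
      (fun z => γ * H z + -(γ * (γ - α)) * M.resolvent univ γ H z) := by
  have hR := M.bddMeas_resolvent isOpen_univ (hα.trans hγ) hH
  ext z
  rw [M.resolvent_add_mul isOpen_univ hα (hH.const_mul γ) hR,
    M.resolvent_comm isOpen_univ (hα.trans hγ) hα hH]
  have h := M.resolvent_identity isOpen_univ hα hγ hH z
  have h0 := M.resolvent_add_mul isOpen_univ hα (.const 0) hH γ z
  have h1 : M.resolvent univ α (fun _ => 0) z = 0 := by simp [resolvent, killedOp]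
  simp only [zero_add] at h0
  rw [h0, h1, h]
  ring

lemma tendsto_exitValue (M : StandardMarkovProcess E Ω) {O : Set E} (hO : IsOpen O) {α : ℝ}
    (hα : 0 < α) {ι : Type*} {l : Filter ι} [l.IsCountablyGenerated] {H : ι → ℝ≥0 × E → ℝ}
    {H' : ℝ≥0 × E → ℝ} {D : ℝ} (hH : ∀ᶠ i in l, Measurable (H i) ∧ ∀ z, |H i z| ≤ D)
    (hHlim : ∀ z, Tendsto (fun i => H i z) l (𝓝 (H' z))) (z : ℝ≥0 × E) :
    Tendsto (fun i => M.exitValue O α (H i) z) l (𝓝 (M.exitValue O α H' z)) := by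
  refine tendsto_integral_filter_of_dominated_convergence (fun _ => D) ?_ ?_
    (integrable_const _) (Eventually.of_forall fun ω => (hHlim _).const_mul _)
  · filter_upwards [hH] with i hi
    exact (M.bddMeas_terminalPayoff hα ⟨hi.1, D, hi.2⟩ _
      (M.isStoppingTime_exitTime hO)).1.aestronglyMeasurable
  · filter_upwards [hH] with i hi
    exact Eventually.of_forall fun ω => M.abs_terminalPayoff_le hα hi.2 _ _ ω

lemma tendsto_resolvent (M : StandardMarkovProcess E Ω) {O : Set E} (hO : IsOpen O) {α : ℝ}
    (hα : 0 < α) {ι : Type*} {l : Filter ι} [l.IsCountablyGenerated] {g : ι → ℝ≥0 × E → ℝ}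
    {g' : ℝ≥0 × E → ℝ} {D : ℝ} (hD : 0 ≤ D) (hg : ∀ᶠ i in l, Measurable (g i) ∧ ∀ z, |g i z| ≤ D)
    (hlim : ∀ z, Tendsto (fun i => g i z) l (𝓝 (g' z))) (z : ℝ≥0 × E) :
    Tendsto (fun i => M.resolvent O α (g i) z) l (𝓝 (M.resolvent O α g' z)) := by
  refine tendsto_integral_filter_of_dominated_convergence (fun u => Real.exp (-α * u) * D) ?_ ?_
    ((integrableOn_exp_neg_mul hα).mul_const D)
    (Eventually.of_forall fun u => (M.tendsto_killedOp O hg hlim _ _).const_mul _)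
  · filter_upwards [hg] with i hi
    exact (M.integrableOn_resolvent hO hα ⟨hi.1, D, hi.2⟩ z).1
  · filter_upwards [hg] with i hi
    refine Eventually.of_forall fun u => ?_
    rw [Real.norm_eq_abs, abs_mul, abs_of_nonneg (Real.exp_nonneg _)]
    exact mul_le_mul_of_nonneg_left (M.abs_killedOp_le O hD hi.2 _ _) (Real.exp_nonneg _)

/-- Every bounded continuous function is a bounded pointwise limit of functions in the range of the
resolvent `U_α` of the unkilled process. -/
lemma exists_resolvent_univ_tendsto (M : StandardMarkovProcess E Ω) {α : ℝ} (hα : 0 < α)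
    (H : ℝ≥0 × E →ᵇ ℝ) : ∃ φ : ℕ → ℝ≥0 × E → ℝ, (∀ n, BddMeas (φ n)) ∧
      (∀ n z, |M.resolvent univ α (φ n) z| ≤ ‖H‖) ∧
      ∀ z, Tendsto (fun n => M.resolvent univ α (φ n) z) atTop (𝓝 (H z)) := by
  have hγ : ∀ n : ℕ, α < n + 1 + α := fun n => by
    have : (0 : ℝ) ≤ n := n.cast_nonneg
    linarith
  -- With γ = n + 1 + α this is the function that `U_α` sends to γU_γH; the latter is bounded by ‖H‖
  -- and tends to H everywhere, since nothing is killed.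
  refine ⟨fun n z => (n + 1 + α) * H z +
    -((n + 1 + α) * ((n + 1 + α) - α)) * M.resolvent univ (n + 1 + α) H z, fun n => ?_, ?_, ?_⟩
  · exact ((BddMeas.of_bcf H).const_mul _).add
      ((M.bddMeas_resolvent isOpen_univ (hα.trans (hγ n)) (.of_bcf H)).const_mul _)
  · intro n z
    rw [← M.mul_resolvent_univ_eq hα (hγ n) (.of_bcf H), abs_mul,
      abs_of_pos (hα.trans (hγ n)), mul_comm, ← le_div_iff₀ (hα.trans (hγ n))]
    exact M.abs_resolvent_le univ (hα.trans (hγ n)) (norm_nonneg _)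
      (fun z => H.norm_coe_le_norm z) z
  · intro z
    simp_rw [← M.mul_resolvent_univ_eq hα (hγ _) (.of_bcf H)]
    refine (M.tendsto_mul_resolvent isOpen_univ H z.1 (mem_univ z.2)).comp ?_
    exact tendsto_atTop_add_const_right _ _ (tendsto_atTop_add_const_right _ _
      tendsto_natCast_atTop_atTop)

/-- The laws `P x` are not assumed measurable in `x` on all of `Ω`; measurability comes from the
approximation by differences of resolvents. -/
lemma bddMeas_exitValue (M : StandardMarkovProcess E Ω) {O : Set E} (hO : IsOpen O) {α : ℝ}
    (hα : 0 < α) (H : ℝ≥0 × E →ᵇ ℝ) : BddMeas (M.exitValue O α H) := by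
  obtain ⟨φ, hφ, hb, hlim⟩ := M.exists_resolvent_univ_tendsto hα H
  refine ⟨?_, ‖H‖, M.abs_exitValue_le O hα (norm_nonneg _) fun z => H.norm_coe_le_norm z⟩
  refine measurable_of_tendsto_metrizable (f := fun n =>
    M.exitValue O α (M.resolvent univ α (φ n))) (fun n => ?_) (tendsto_pi_nhds.2
      (M.tendsto_exitValue hO hα (Eventually.of_forall fun n =>
        ⟨(M.bddMeas_resolvent isOpen_univ hα (hφ n)).1, hb n⟩) hlim))
  have e : M.exitValue O α (M.resolvent univ α (φ n)) =
      fun z => M.resolvent univ α (φ n) z - M.resolvent O α (φ n) z :=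
    funext fun z => M.exitValue_resolvent_univ hO hα (hφ n) z
  rw [e]
  exact (M.bddMeas_resolvent isOpen_univ hα (hφ n)).1.sub (M.bddMeas_resolvent hO hα (hφ n)).1

/-- Strong Markov property for the payoff at the exit from `O`. -/
lemma exitValue_eq_payoff (M : StandardMarkovProcess E Ω) {O : Set E} (hO : IsOpen O) {α : ℝ}
    (hα : 0 < α) (H : ℝ≥0 × E →ᵇ ℝ) (s : ℝ≥0) (x : E) {τ : Ω → WithTop ℝ≥0}
    (hτ : IsStoppingTime M.filt τ) :
    M.exitValue O α H (s, x) = M.payoff O α (fun _ => 0) (M.exitValue O α H) H s x τ := by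
  obtain ⟨φ, hφ, hb, hlim⟩ := M.exists_resolvent_univ_tendsto hα H
  have hm : ∀ n, Measurable (M.resolvent univ α (φ n)) := fun n =>
    (M.bddMeas_resolvent isOpen_univ hα (hφ n)).1
  have h1 := M.tendsto_exitValue hO hα (Eventually.of_forall fun n => ⟨hm n, hb n⟩) hlim
  have h2 := M.tendsto_payoff hO hα (.const 0) (τ := τ) (s := s) (x := x) (D := ‖H‖) (l := atTop)
    (G := fun n => M.exitValue O α (M.resolvent univ α (φ n)))
    (H := fun n => M.resolvent univ α (φ n)) (G' := M.exitValue O α H) (H' := H)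
    (Eventually.of_forall fun n => ⟨?_, M.abs_exitValue_le O hα (norm_nonneg _) (hb n)⟩)
    (Eventually.of_forall fun n => ⟨hm n, hb n⟩) (fun t y _ => h1 _) hlim hτ
  · simp_rw [← M.exitValue_resolvent_univ_eq_payoff hO hα (hφ _) s x hτ] at h2
    exact tendsto_nhds_unique (h1 (s, x)) h2
  · have e : M.exitValue O α (M.resolvent univ α (φ n)) =
        fun z => M.resolvent univ α (φ n) z - M.resolvent O α (φ n) z :=
      funext fun z => M.exitValue_resolvent_univ hO hα (hφ n) z
    rw [e]
    exact (hm n).sub (M.bddMeas_resolvent hO hα (hφ n)).1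

/-- Dynkin's formula. -/
lemma resolvent_add_exitValue_eq_payoff (M : StandardMarkovProcess E Ω) {O : Set E}
    (hO : IsOpen O) {α : ℝ} (hα : 0 < α) {g v : ℝ≥0 × E → ℝ} (hg : BddMeas g) (H : ℝ≥0 × E →ᵇ ℝ)
    (hv : ∀ z, v z = M.resolvent O α g z + M.exitValue O α H z) (s : ℝ≥0) (x : E)
    {τ : Ω → WithTop ℝ≥0} (hτ : IsStoppingTime M.filt τ) :
    v (s, x) = M.payoff O α g v H s x τ := by
  have h := M.payoff_add_mul hO hα hg (M.bddMeas_resolvent hO hα hg) (.const 0) (.const 0)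
    (M.bddMeas_exitValue hO hα H) (.of_bcf H) 1 s x hτ
  rw [← M.resolvent_eq_payoff_stopped hO hα hg s x hτ, ← M.exitValue_eq_payoff hO hα H s x hτ] at h
  simp only [one_mul, add_zero, zero_add, ← hv] at h
  exact h.symm

/-- Since U_α g = U_γ(g + (γ - α)U_α g), the exit value at rate γ is also a difference of
resolvents, and the claim reduces to the resolvent identity in `O`. -/
lemma exitValue_resolvent_univ_identity (M : StandardMarkovProcess E Ω) {O : Set E} (hO : IsOpen O)
    {α γ : ℝ} (hα : 0 < α) (hγ : α < γ) {g : ℝ≥0 × E → ℝ} (hg : BddMeas g) (z : ℝ≥0 × E) :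
    M.exitValue O α (M.resolvent univ α g) z = M.exitValue O γ (M.resolvent univ α g) z +
      (γ - α) * M.resolvent O γ (M.exitValue O α (M.resolvent univ α g)) z := by
  have hγ0 := hα.trans hγ
  have hU := M.bddMeas_resolvent isOpen_univ hα hg
  have hR := M.bddMeas_resolvent hO hα hg
  have e : M.resolvent univ α g = M.resolvent univ γ (fun z => g z + (γ - α) *
      M.resolvent univ α g z) := by
    ext z
    rw [M.resolvent_add_mul isOpen_univ hγ0 hg hU, M.resolvent_identity isOpen_univ hα hγ hg]
  have e1 : M.exitValue O γ (M.resolvent univ α g) z = M.resolvent univ α g z -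
      (M.resolvent O γ g z + (γ - α) * M.resolvent O γ (M.resolvent univ α g) z) := by
    have h := M.exitValue_resolvent_univ hO hγ0 (hg.add (hU.const_mul (γ - α))) z
    rw [← e] at h
    rw [h, M.resolvent_add_mul hO hγ0 hg hU]
  have e2 : M.exitValue O α (M.resolvent univ α g) = fun z => M.resolvent univ α g z +
      (-1) * M.resolvent O α g z := by
    ext z
    rw [M.exitValue_resolvent_univ hO hα hg]
    ring
  rw [e1, e2, M.resolvent_add_mul hO hγ0 hU hR]
  simp only
  rw [M.resolvent_identity hO hα hγ hg]
  ring

/-- The dependence of `exitValue` on the discount rate. -/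
lemma exitValue_identity (M : StandardMarkovProcess E Ω) {O : Set E} (hO : IsOpen O)
    {α γ : ℝ} (hα : 0 < α) (hγ : α < γ) (H : ℝ≥0 × E →ᵇ ℝ) (z : ℝ≥0 × E) :
    M.exitValue O α H z = M.exitValue O γ H z +
      (γ - α) * M.resolvent O γ (M.exitValue O α H) z := by
  obtain ⟨φ, hφ, hb, hlim⟩ := M.exists_resolvent_univ_tendsto hα H
  have hm : ∀ n, Measurable (M.resolvent univ α (φ n)) := fun n =>
    (M.bddMeas_resolvent isOpen_univ hα (hφ n)).1
  have h1 := M.tendsto_exitValue hO hα (Eventually.of_forall fun n => ⟨hm n, hb n⟩) hlim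
  have h2 := M.tendsto_exitValue hO (hα.trans hγ)
    (Eventually.of_forall fun n => ⟨hm n, hb n⟩) hlim
  have h3 := M.tendsto_resolvent hO (hα.trans hγ) (norm_nonneg H) (l := atTop)
    (g := fun n => M.exitValue O α (M.resolvent univ α (φ n)))
    (Eventually.of_forall fun n => ⟨?_, M.abs_exitValue_le O hα (norm_nonneg _) (hb n)⟩) h1 z
  · refine tendsto_nhds_unique (h1 z) ?_
    simp_rw [M.exitValue_resolvent_univ_identity hO hα hγ (hφ _) z]
    exact (h2 z).add (h3.const_mul _)
  · have e : M.exitValue O α (M.resolvent univ α (φ n)) =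
        fun z => M.resolvent univ α (φ n) z - M.resolvent O α (φ n) z :=
      funext fun z => M.exitValue_resolvent_univ hO hα (hφ n) z
    rw [e]
    exact (hm n).sub (M.bddMeas_resolvent hO hα (hφ n)).1

/-- From inside `O` the exit time is almost surely positive, so the discount kills the exit payoff.
-/
lemma tendsto_exitValue_atTop (M : StandardMarkovProcess E Ω) {O : Set E} (hO : IsOpen O)
    {H : ℝ≥0 × E → ℝ} (hH : BddMeas H) (s : ℝ≥0) {x : E} (hx : x ∈ O) :
    Tendsto (fun γ => M.exitValue O γ H (s, x)) atTop (𝓝 0) := by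
  obtain ⟨C, hC⟩ := hH.2
  have h : Tendsto (fun γ => M.exitValue O γ H (s, x)) atTop (𝓝 (∫ _, (0 : ℝ) ∂(M.P x))) := by
    refine tendsto_integral_filter_of_dominated_convergence (fun _ => C) ?_ ?_
      (integrable_const _) ?_
    · filter_upwards [eventually_gt_atTop 0] with γ hγ
      exact (M.bddMeas_terminalPayoff hγ hH _
        (M.isStoppingTime_exitTime hO)).1.aestronglyMeasurable
    · filter_upwards [eventually_gt_atTop 0] with γ hγ
      exact Eventually.of_forall fun ω => M.abs_terminalPayoff_le hγ hC _ _ ω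
    · filter_upwards [M.ae_zero_lt_exitTime hO hx] with ω hω
      by_cases ht : M.exitTime O ω = ⊤
      · simp only [terminalPayoff, ht, discount_top, zero_mul]
        exact tendsto_const_nhds
      · rw [← zero_mul (H (s + (M.exitTime O ω).untopA, stoppedValue M.X (M.exitTime O) ω))]
        refine Tendsto.mul_const _ ?_
        simp_rw [discount_of_ne_top _ ht]
        refine Real.tendsto_exp_atBot.comp ?_
        have hpos : (0 : ℝ) < (M.exitTime O ω).untopA := by
          rw [← coe_untopA_of_ne_top ht, WithTop.coe_lt_coe] at hω
          exact hω
        simp_rw [neg_mul]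
        exact tendsto_neg_atTop_atBot.comp (tendsto_id.atTop_mul_const hpos)
  simpa using h

end StandardMarkovProcess

/-! ### Vague and weak convergence of measures -/

section

open scoped CompactlySupported

lemma bddMeas_compactlySupported {Z : Type*} [TopologicalSpace Z] [MeasurableSpace Z]
    [OpensMeasurableSpace Z] (ψ : C_c(Z, ℝ)) : BddMeas ψ :=
  BddMeas.of_bcf ψ.toBoundedContinuousFunction

variable {Z : Type*} [MetricSpace Z] [ProperSpace Z]

/-- Product of a continuous function with a continuous cutoff function at distance `n` from `z₀`. -/
noncomputable def mulCutoff (z₀ : Z) (g : C(Z, ℝ)) (n : ℕ) : C_c(Z, ℝ) where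
  toFun z := g z * max 0 (min 1 (n + 1 - dist z z₀))
  continuous_toFun := by fun_prop
  hasCompactSupport' := by
    refine HasCompactSupport.of_support_subset_isCompact (isCompact_closedBall z₀ (n + 1))
      fun z hz => ?_
    by_contra h
    rw [Metric.mem_closedBall, not_le] at h
    refine hz ?_
    have h1 : min 1 ((n : ℝ) + 1 - dist z z₀) ≤ 0 := (min_le_right _ _).trans (by linarith)
    simp only [max_eq_left h1, mul_zero]

lemma mulCutoff_apply (z₀ : Z) (g : C(Z, ℝ)) (n : ℕ) (z : Z) :
    mulCutoff z₀ g n z = g z * mulCutoff z₀ 1 n z := by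
  simp [mulCutoff]

lemma mulCutoff_one_nonneg (z₀ : Z) (n : ℕ) (z : Z) : 0 ≤ mulCutoff z₀ 1 n z := by
  simp [mulCutoff]

lemma mulCutoff_one_le (z₀ : Z) (n : ℕ) (z : Z) : mulCutoff z₀ 1 n z ≤ 1 := by
  simp [mulCutoff]

lemma mulCutoff_one_of_dist_le {z₀ : Z} {n : ℕ} {z : Z} (h : dist z z₀ ≤ n) :
    mulCutoff z₀ 1 n z = 1 := by
  have h1 : min 1 ((n : ℝ) + 1 - dist z z₀) = 1 := min_eq_left (by linarith)
  simp [mulCutoff, h1]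

lemma eventually_mulCutoff_one_eq (z₀ z : Z) : ∀ᶠ n in atTop, mulCutoff z₀ 1 n z = 1 := by
  filter_upwards [eventually_ge_atTop ⌈dist z z₀⌉₊] with n hn
  exact mulCutoff_one_of_dist_le (Nat.ceil_le.1 hn)

variable [MeasurableSpace Z] [BorelSpace Z]

lemma tendsto_integral_mulCutoff_one (z₀ : Z) (m : Measure Z) [IsFiniteMeasure m] :
    Tendsto (fun n => ∫ z, mulCutoff z₀ 1 n z ∂m) atTop (𝓝 (m.real univ)) := by
  have h : Tendsto (fun n => ∫ z, mulCutoff z₀ 1 n z ∂m) atTop (𝓝 (∫ _, (1 : ℝ) ∂m)) := by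
    refine tendsto_integral_of_dominated_convergence (fun _ => 1)
      (fun n => (bddMeas_compactlySupported _).1.aestronglyMeasurable) (integrable_const _)
      (fun n => Eventually.of_forall fun z => ?_) (Eventually.of_forall fun z => ?_)
    · rw [Real.norm_eq_abs, abs_of_nonneg (mulCutoff_one_nonneg _ _ _)]
      exact mulCutoff_one_le _ _ _
    · exact tendsto_const_nhds.congr' ((eventually_mulCutoff_one_eq z₀ z).mono fun _ h => h.symm)
  simpa using h

lemma abs_integral_sub_mulCutoff_le (z₀ : Z) (m : Measure Z) [IsFiniteMeasure m] (g : Z →ᵇ ℝ)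
    (n : ℕ) : |∫ z, g z ∂m - ∫ z, mulCutoff z₀ g.toContinuousMap n z ∂m| ≤
      ‖g‖ * (m.real univ - ∫ z, mulCutoff z₀ 1 n z ∂m) := by
  have h1 := (bddMeas_compactlySupported (mulCutoff z₀ 1 n)).integrable m
  rw [← integral_sub ((BddMeas.of_bcf g).integrable m)
    ((bddMeas_compactlySupported _).integrable m)]
  have e : m.real univ - ∫ z, mulCutoff z₀ 1 n z ∂m = ∫ z, (1 - mulCutoff z₀ 1 n z) ∂m := by
    rw [integral_sub (integrable_const _) h1]
    simp
  rw [e, ← integral_const_mul]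
  rw [← Real.norm_eq_abs]
  refine norm_integral_le_of_norm_le (((integrable_const (1 : ℝ)).sub h1).const_mul ‖g‖)
    (Eventually.of_forall fun z => ?_)
  rw [mulCutoff_apply, Real.norm_eq_abs]
  change |g z - g z * _| ≤ _
  rw [← mul_one_sub, abs_mul, abs_of_nonneg (sub_nonneg.2 (mulCutoff_one_le z₀ n z))]
  exact mul_le_mul_of_nonneg_right (g.norm_coe_le_norm z) (sub_nonneg.2 (mulCutoff_one_le z₀ n z))

/-- Vague convergence and convergence of the total masses imply weak convergence. -/
lemma tendsto_integral_of_vague (z₀ : Z) {ι : Type*} {l : Filter ι} {m : ι → Measure Z}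
    {m' : Measure Z} [∀ i, IsFiniteMeasure (m i)] [IsFiniteMeasure m']
    (hvague : ∀ ψ : C_c(Z, ℝ), Tendsto (fun i => ∫ z, ψ z ∂(m i)) l (𝓝 (∫ z, ψ z ∂m')))
    (hmass : Tendsto (fun i => (m i).real univ) l (𝓝 (m'.real univ))) (g : Z →ᵇ ℝ) :
    Tendsto (fun i => ∫ z, g z ∂(m i)) l (𝓝 (∫ z, g z ∂m')) := by
  rw [Metric.tendsto_nhds]
  intro ε hε
  -- Three errors: δ from vague convergence, and ‖g‖ δ from the cutoff under each of the two
  -- measures.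
  set δ := ε / (1 + 2 * ‖g‖) with hδ
  have hB := norm_nonneg g
  have hδ0 : 0 < δ := by positivity
  have hδε : δ + ‖g‖ * δ + ‖g‖ * δ = ε := by
    rw [hδ]; field_simp; ring
  have h0 : Tendsto (fun n => m'.real univ - ∫ z, mulCutoff z₀ 1 n z ∂m') atTop (𝓝 0) := by
    simpa using (tendsto_integral_mulCutoff_one z₀ m').const_sub (m'.real univ)
  obtain ⟨n, hn⟩ := (h0.eventually_lt_const hδ0).exists
  -- Tightness: the limit has little mass beyond the cutoff, and convergence of total masses
  -- transfers this to `m i`.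
  have h1 := ((hmass.sub (hvague (mulCutoff z₀ 1 n))).eventually_lt_const hn)
  have h2 := (Metric.tendsto_nhds.1 (hvague (mulCutoff z₀ g.toContinuousMap n))) δ hδ0
  filter_upwards [h1, h2] with i hi1 hi2
  have h3 := abs_integral_sub_mulCutoff_le z₀ (m i) g n
  have h4 := abs_integral_sub_mulCutoff_le z₀ m' g n
  have h5 := mul_le_mul_of_nonneg_left hi1.le hB
  have h6 := mul_le_mul_of_nonneg_left hn.le hB
  rw [Real.dist_eq, abs_lt] at hi2 ⊢
  rw [abs_le] at h3 h4
  constructor <;> linarith [hi2.1, hi2.2, h3.1, h3.2, h4.1, h4.2]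

/-- The cutoff radius depends on `φ` and `ε` only, and is uniform over measures of mass at most one.
-/
lemma abs_integral_sub_mulCutoff_le_of_zeroAtInfty (z₀ : Z) (φ : C₀(Z, ℝ)) {ε : ℝ} (hε : 0 < ε) :
    ∃ n, ∀ m : Measure Z, m univ ≤ 1 →
      |∫ z, φ z ∂m - ∫ z, mulCutoff z₀ φ.toContinuousMap n z ∂m| ≤ ε := by
  have h := (Metric.tendsto_nhds.1 φ.zero_at_infty') ε hε
  rw [← Metric.cobounded_eq_cocompact, (Metric.hasBasis_cobounded_compl_closedBall z₀).eventually_iff]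
    at h
  obtain ⟨r, -, hr⟩ := h
  refine ⟨⌈r⌉₊, fun m hm => ?_⟩
  have : IsFiniteMeasure m := ⟨hm.trans_lt ENNReal.one_lt_top⟩
  rw [← integral_sub (f := φ) ((BddMeas.of_bcf φ.toBCF).integrable m)
    ((bddMeas_compactlySupported _).integrable m)]
  refine abs_integral_le_of_measure_le_one hm (fun z => ?_) hε.le
  rw [mulCutoff_apply]
  change |φ z - φ z * _| ≤ _
  rw [← mul_one_sub, abs_mul, abs_of_nonneg (sub_nonneg.2 (mulCutoff_one_le z₀ _ z))]
  by_cases hz : dist z z₀ ≤ r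
  · rw [mulCutoff_one_of_dist_le (hz.trans (Nat.le_ceil r)), sub_self, mul_zero]
    exact hε.le
  · have h1 : |φ z| ≤ ε := by
      have := @hr z (by simpa using hz)
      rw [Real.dist_eq, sub_zero] at this
      exact this.le
    exact (mul_le_of_le_one_right (abs_nonneg _)
      (sub_le_self _ (mulCutoff_one_nonneg _ _ _))).trans h1

/-- Vague convergence of measures of mass at most one implies convergence of the integrals of
functions vanishing at infinity. -/
lemma tendsto_integral_zeroAtInfty_of_vague (z₀ : Z) {ι : Type*} {l : Filter ι} {m : ι → Measure Z}
    {m' : Measure Z} (hm : ∀ i, m i univ ≤ 1) (hm' : m' univ ≤ 1)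
    (hvague : ∀ ψ : C_c(Z, ℝ), Tendsto (fun i => ∫ z, ψ z ∂(m i)) l (𝓝 (∫ z, ψ z ∂m')))
    (φ : C₀(Z, ℝ)) : Tendsto (fun i => ∫ z, φ z ∂(m i)) l (𝓝 (∫ z, φ z ∂m')) := by
  rw [Metric.tendsto_nhds]
  intro ε hε
  obtain ⟨n, hn⟩ := abs_integral_sub_mulCutoff_le_of_zeroAtInfty z₀ φ (show 0 < ε / 4 by positivity)
  filter_upwards [Metric.tendsto_nhds.1 (hvague (mulCutoff z₀ φ.toContinuousMap n)) (ε / 4)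
    (by positivity)] with i hi
  have h1 := hn (m i) (hm i)
  have h2 := hn m' hm'
  rw [Real.dist_eq, abs_lt] at hi ⊢
  rw [abs_le] at h1 h2
  constructor <;> linarith [hi.1, hi.2, h1.1, h1.2, h2.1, h2.2]

/-- Vague compactness of the measures of mass at most one. -/
lemma exists_vague_limit (z₀ : Z) {ι : Type*} (l : Ultrafilter ι) {m : ι → Measure Z}
    (hm : ∀ i, m i univ ≤ 1) : ∃ μ : Measure Z, μ univ ≤ 1 ∧
      ∀ ψ : C_c(Z, ℝ), Tendsto (fun i => ∫ z, ψ z ∂(m i)) l (𝓝 (∫ z, ψ z ∂μ)) := by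
  have hfin : ∀ i, IsFiniteMeasure (m i) := fun i => ⟨(hm i).trans_lt ENNReal.one_lt_top⟩
  have hint : ∀ (ψ : C_c(Z, ℝ)) i, Integrable ψ (m i) := fun ψ i =>
    (bddMeas_compactlySupported ψ).integrable _
  -- Along an ultrafilter every bounded family of integrals converges; the limits form a positive
  -- linear functional, represented by the Riesz–Markov theorem.
  have L : ∀ ψ : C_c(Z, ℝ), ∃ x, Tendsto (fun i => ∫ z, ψ z ∂(m i)) l (𝓝 x) := by
    intro ψ
    obtain ⟨C, hC0, hC⟩ := (bddMeas_compactlySupported ψ).exists_pos_bound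
    obtain ⟨x, -, hx⟩ := (isCompact_Icc (a := -C) (b := C)).ultrafilter_le_nhds'
      (l.map fun i => ∫ z, ψ z ∂(m i)) (Ultrafilter.mem_map.2 <| Eventually.of_forall fun i =>
        abs_le.1 (abs_integral_le_of_measure_le_one (hm i) hC hC0.le))
    exact ⟨x, hx⟩
  choose Λ hΛ using L
  let Λ' : C_c(Z, ℝ) →ₚ[ℝ] ℝ :=
  { toFun := Λ
    map_add' ψ ψ' := by
      refine tendsto_nhds_unique (hΛ (ψ + ψ')) (((hΛ ψ).add (hΛ ψ')).congr fun i => ?_)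
      exact (integral_add (hint ψ i) (hint ψ' i)).symm
    map_smul' c ψ := by
      refine tendsto_nhds_unique (hΛ (c • ψ)) (((hΛ ψ).const_smul c).congr fun i => ?_)
      exact (integral_smul c ψ).symm
    monotone' ψ ψ' h := le_of_tendsto_of_tendsto' (hΛ ψ) (hΛ ψ') fun i =>
      integral_mono (hint ψ i) (hint ψ' i) h }
  refine ⟨RealRMK.rieszMeasure Λ', ?_, fun ψ => ?_⟩
  · have hball : ∀ n : ℕ, RealRMK.rieszMeasure Λ' (Metric.closedBall z₀ n) ≤ 1 := by
      intro n
      refine (RealRMK.rieszMeasure_le_of_eq_one Λ' (f := mulCutoff z₀ 1 n)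
        (mulCutoff_one_nonneg z₀ n) (isCompact_closedBall z₀ n)
        fun z hz => mulCutoff_one_of_dist_le hz).trans ?_
      rw [ENNReal.ofReal_le_one]
      refine le_of_tendsto (hΛ (mulCutoff z₀ 1 n)) (Eventually.of_forall fun i => ?_)
      refine (le_abs_self _).trans (abs_integral_le_of_measure_le_one (hm i) (fun z => ?_)
        zero_le_one)
      rw [abs_of_nonneg (mulCutoff_one_nonneg _ _ _)]
      exact mulCutoff_one_le _ _ _
    rw [← Metric.iUnion_closedBall_nat z₀, Monotone.measure_iUnion]
    · exact iSup_le hball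
    · exact fun i j hij => Metric.closedBall_subset_closedBall (Nat.cast_le.2 hij)
  · rw [RealRMK.integral_rieszMeasure]
    exact hΛ ψ

/-- For measures of mass at most one, vague convergence can be tested on a set of functions
vanishing at infinity whose bounded pointwise limits comprise all compactly supported functions. -/
lemma tendsto_integral_of_boundedly_dense (z₀ : Z) {ι : Type*} {l : Filter ι} {m : ι → Measure Z}
    {m' : Measure Z} (hm : ∀ i, m i univ ≤ 1) (hm' : m' univ ≤ 1) {D : Set C₀(Z, ℝ)}
    (hD : ∀ φ ∈ D, Tendsto (fun i => ∫ z, φ z ∂(m i)) l (𝓝 (∫ z, φ z ∂m')))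
    (hdense : ∀ ψ : C_c(Z, ℝ), ∃ φ : ℕ → C₀(Z, ℝ), (∀ n, φ n ∈ D) ∧ (∃ C, ∀ n z, |φ n z| ≤ C) ∧
      ∀ z, Tendsto (fun n => φ n z) atTop (𝓝 (ψ z))) (ψ : C_c(Z, ℝ)) :
    Tendsto (fun i => ∫ z, ψ z ∂(m i)) l (𝓝 (∫ z, ψ z ∂m')) := by
  rw [tendsto_iff_ultrafilter]
  intro 𝒰 h𝒰
  obtain ⟨μ, hμ, hlim⟩ := exists_vague_limit z₀ 𝒰 hm
  obtain ⟨φ, hφD, ⟨C, hC⟩, hφ⟩ := hdense ψ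
  have : IsFiniteMeasure μ := ⟨hμ.trans_lt ENNReal.one_lt_top⟩
  have : IsFiniteMeasure m' := ⟨hm'.trans_lt ENNReal.one_lt_top⟩
  have hbdd : ∀ ν : Measure Z, IsFiniteMeasure ν →
      Tendsto (fun n => ∫ z, φ n z ∂ν) atTop (𝓝 (∫ z, ψ z ∂ν)) := fun ν _ =>
    tendsto_integral_of_dominated_convergence (fun _ => C)
      (fun n => (φ n).continuous.measurable.aestronglyMeasurable) (integrable_const _)
      (fun n => Eventually.of_forall (hC n)) (Eventually.of_forall hφ)
  -- Mass at most one lets vague convergence test functions vanishing at infinity, so `μ` and `m'`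
  -- agree on `D`, and then on its bounded pointwise limits.
  have heq : ∀ n, ∫ z, φ n z ∂μ = ∫ z, φ n z ∂m' := fun n =>
    tendsto_nhds_unique (tendsto_integral_zeroAtInfty_of_vague z₀ hm hμ hlim (φ n))
      ((hD (φ n) (hφD n)).mono_left h𝒰)
  have e : ∫ z, ψ z ∂μ = ∫ z, ψ z ∂m' :=
    tendsto_nhds_unique (hbdd μ ‹_›) ((hbdd m' ‹_›).congr fun n => (heq n).symm)
  rw [← e]
  exact hlim ψ

end

/-! ### Feller continuity of resolvents and exit values -/

section

open scoped CompactlySupported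

/-- Needed for dominated convergence along `cocompact`. -/
lemma isCountablyGenerated_cocompact {Z : Type*} [MetricSpace Z] [ProperSpace Z] (z : Z) :
    (cocompact Z).IsCountablyGenerated := by
  rw [← Metric.cobounded_eq_cocompact, ← Metric.comap_dist_right_atTop z]
  infer_instance

namespace StandardMarkovProcess

variable {E Ω : Type*} [MetricSpace E] [MeasurableSpace E] [MeasurableSpace Ω]

lemma stoppedSemigroup_univ (M : StandardMarkovProcess E Ω) (t : ℝ≥0) (h : E → ℝ) (x : E) :
    M.stoppedSemigroup univ t h x = ∫ ω, h (M.X t ω) ∂(M.P x) := by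
  rw [stoppedSemigroup]
  congr 1
  ext ω
  refine indicator_of_mem ?_ _
  change (t : WithTop ℝ≥0) < M.exitTime univ ω
  rw [M.exitTime_univ]
  exact WithTop.coe_lt_top t

lemma StoppedFeller.continuous_stoppedSemigroup {M : StandardMarkovProcess E Ω} {O : Set E}
    (hF : M.StoppedFeller O) {t : ℝ≥0} (ht : 0 < t) (h : E →ᵇ ℝ) :
    Continuous (M.stoppedSemigroup O t h) := by
  obtain ⟨g, hg⟩ := hF t ht h
  rw [← funext hg]
  exact g.continuous

variable [BorelSpace E]

lemma killedOp_eq_stoppedSemigroup [SecondCountableTopology E]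
    (M : StandardMarkovProcess E Ω) {O : Set E} (hO : IsOpen O)
    {g : ℝ≥0 × E → ℝ} (hg : Measurable g) (t : ℝ≥0) (z : ℝ≥0 × E) :
    M.killedOp O g t z = M.stoppedSemigroup O t (fun y => g (z.1 + t, y)) z.2 := by
  rw [killedOp, M.integral_killedMeasure O _ hg, stoppedSemigroup, integral_indicator
    (M.measurableSet_lt_exitTime hO (isStoppingTime_const M.filt t))]

lemma abs_stoppedSemigroup_sub_le [SecondCountableTopology E] (M : StandardMarkovProcess E Ω)
    {O : Set E} (hO : IsOpen O) (t : ℝ≥0) {h k : E → ℝ} (hh : BddMeas h) (hk : BddMeas k) {ε : ℝ}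
    (hε : 0 ≤ ε) (hhk : ∀ y, |h y - k y| ≤ ε) (x : E) :
    |M.stoppedSemigroup O t h x - M.stoppedSemigroup O t k x| ≤ ε := by
  have hm := M.measurableSet_lt_exitTime hO (isStoppingTime_const M.filt t)
  have hh' := hh.comp (M.measurable_X t)
  have hk' := hk.comp (M.measurable_X t)
  rw [stoppedSemigroup, stoppedSemigroup, ← integral_sub ((hh'.integrable _).indicator hm)
    ((hk'.integrable _).indicator hm)]
  refine abs_integral_le_of_measure_le_one prob_le_one (fun ω => ?_) hε
  by_cases h : ω ∈ {ω | (t : WithTop ℝ≥0) < M.exitTime O ω}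
  · rw [indicator_of_mem h, indicator_of_mem h]
    exact hhk _
  · rw [indicator_of_notMem h, indicator_of_notMem h, sub_zero, abs_zero]
    exact hε

lemma measureReal_killedMeasure_univ [SecondCountableTopology E] (M : StandardMarkovProcess E Ω)
    {O : Set E} (hO : IsOpen O) (t : ℝ≥0) (z : ℝ≥0 × E) :
    (M.killedMeasure O (t, z)).real univ = M.stoppedSemigroup O t (fun _ => 1) z.2 := by
  rw [← M.killedOp_eq_stoppedSemigroup hO (g := fun _ => 1) measurable_const t z, killedOp]
  simp

variable [ProperSpace E]

/-- The weak Feller property gives vague continuity of the transition laws; they are probability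
measures, so no mass escapes and the continuity is weak. -/
lemma WeakFeller.stoppedFeller_univ {M : StandardMarkovProcess E Ω} (hM : M.WeakFeller) :
    M.StoppedFeller univ := by
  intro t _ h
  have hprob : ∀ x, IsProbabilityMeasure ((M.P x).map (M.X t)) := fun x =>
    Measure.isProbabilityMeasure_map (M.measurable_X t).aemeasurable
  have e : ∀ (h : E → ℝ), Continuous h → ∀ x,
      ∫ y, h y ∂((M.P x).map (M.X t)) = M.stoppedSemigroup univ t h x := fun h hh x => by
    rw [stoppedSemigroup_univ, integral_map (M.measurable_X t).aemeasurable
      hh.measurable.aestronglyMeasurable]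
  have hcont : Continuous fun x => M.stoppedSemigroup univ t h x := by
    refine continuous_iff_continuousAt.2 fun x => ?_
    have h1 := tendsto_integral_of_vague x (l := 𝓝 x) (m := fun x => (M.P x).map (M.X t))
      (m' := (M.P x).map (M.X t)) (fun ψ => ?_) (by simp) h
    · simp_rw [e h h.continuous] at h1
      exact h1
    · obtain ⟨k, hk⟩ := hM t (ψ : C₀(E, ℝ))
      simp_rw [e ψ ψ.continuous, stoppedSemigroup_univ]
      have h2 : Tendsto k (𝓝 x) (𝓝 (k x)) := k.continuous.tendsto x
      rw [show ⇑k = _ from funext hk] at h2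
      exact h2
  refine ⟨BoundedContinuousFunction.ofNormedAddCommGroup _ hcont ‖h‖ fun x => ?_, fun x => rfl⟩
  rw [← e h h.continuous]
  exact abs_integral_le_of_measure_le_one prob_le_one (fun y => h.norm_coe_le_norm y)
    (norm_nonneg h)

/-- The space-time version of the Feller property of the stopped semigroup. -/
lemma StoppedFeller.continuous_killedOp {M : StandardMarkovProcess E Ω} {O : Set E}
    (hF : M.StoppedFeller O) (hO : IsOpen O) {t : ℝ≥0} (ht : 0 < t) (g : ℝ≥0 × E →ᵇ ℝ) :
    Continuous (M.killedOp O g t) := by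
  refine continuous_iff_continuousAt.2 fun z₀ => ?_
  -- It suffices to treat compactly supported functions and total masses; the mass is the stopped
  -- semigroup applied to `1`.
  refine tendsto_integral_of_vague z₀ (fun ψ => ?_) ?_ g
  · change Tendsto (fun z => M.killedOp O ψ t z) (𝓝 z₀) (𝓝 (M.killedOp O ψ t z₀))
    let k : ℝ≥0 → E →ᵇ ℝ := fun s => ψ.toBoundedContinuousFunction.compContinuous
      ⟨fun y => (s + t, y), by fun_prop⟩
    have e : ∀ z, M.killedOp O ψ t z = M.stoppedSemigroup O t (k z.1) z.2 := fun z =>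
      M.killedOp_eq_stoppedSemigroup hO ψ.continuous.measurable t z
    simp_rw [e]
    rw [Metric.tendsto_nhds]
    intro ε hε
    -- Freeze the time coordinate at `z₀.1`, where (A1) applies; uniform continuity bounds the cost
    -- of freezing.
    have hu : UniformContinuous ψ :=
      ψ.hasCompactSupport.uniformContinuous_of_continuous ψ.continuous
    obtain ⟨δ, hδ, hψ⟩ := Metric.uniformContinuous_iff.1 hu (ε / 2) (half_pos hε)
    have h1 := Metric.tendsto_nhds.1 (((hF.continuous_stoppedSemigroup ht (k z₀.1)).comp
      continuous_snd).tendsto z₀) (ε / 2) (half_pos hε)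
    filter_upwards [h1, Metric.ball_mem_nhds z₀ hδ] with z hz1 hz2
    have h2 := M.abs_stoppedSemigroup_sub_le hO t (.of_bcf (k z.1)) (.of_bcf (k z₀.1))
      (half_pos hε).le (fun y => ?_) z.2
    · refine (dist_triangle _ (M.stoppedSemigroup O t (k z₀.1) z.2) _).trans_lt ?_
      rw [Real.dist_eq]
      exact (add_lt_add_of_le_of_lt h2 hz1).trans_eq (add_halves ε)
    · refine (hψ (a := (z.1 + t, y)) (b := (z₀.1 + t, y)) ?_).le
      rw [Prod.dist_eq, dist_self, max_eq_left dist_nonneg]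
      change dist (z.1 + t) (z₀.1 + t) < δ
      rw [NNReal.dist_eq, NNReal.coe_add, NNReal.coe_add, add_sub_add_right_eq_sub]
      exact (le_max_left _ _).trans_lt hz2
  · simp_rw [M.measureReal_killedMeasure_univ hO]
    exact ((hF.continuous_stoppedSemigroup ht 1).comp continuous_snd).tendsto z₀

lemma StoppedFeller.continuous_resolvent {M : StandardMarkovProcess E Ω} {O : Set E}
    (hF : M.StoppedFeller O) (hO : IsOpen O) {α : ℝ} (hα : 0 < α) (g : ℝ≥0 × E →ᵇ ℝ) :
    Continuous (M.resolvent O α g) := by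
  refine continuous_of_dominated (bound := fun u => Real.exp (-α * u) * ‖g‖)
    (fun z => (M.integrableOn_resolvent hO hα (.of_bcf g) z).1)
    (fun z => Eventually.of_forall fun u => ?_)
    ((integrableOn_exp_neg_mul hα).mul_const _) ?_
  · rw [Real.norm_eq_abs, abs_mul, abs_of_nonneg (Real.exp_nonneg _)]
    exact mul_le_mul_of_nonneg_left (M.abs_killedOp_le O (norm_nonneg _)
      (fun z => g.norm_coe_le_norm z) _ _) (Real.exp_nonneg _)
  -- Continuity is known only for `u > 0`, which suffices for the integral over `Ioi 0`.
  · refine ae_restrict_of_forall_mem measurableSet_Ioi fun u (hu : 0 < u) => ?_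
    exact (hF.continuous_killedOp hO (Real.toNNReal_pos.2 hu) g).const_mul _

/-- The resolvent as a map on bounded continuous functions. -/
noncomputable def StoppedFeller.resolventBCF {M : StandardMarkovProcess E Ω} {O : Set E}
    (hF : M.StoppedFeller O) (hO : IsOpen O) {α : ℝ} (hα : 0 < α) (g : ℝ≥0 × E →ᵇ ℝ) :
    ℝ≥0 × E →ᵇ ℝ :=
  BoundedContinuousFunction.ofNormedAddCommGroup (M.resolvent O α g)
    (hF.continuous_resolvent hO hα g) (‖g‖ / α)
    fun z => M.abs_resolvent_le O hα (norm_nonneg _) (fun z => g.norm_coe_le_norm z) z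

/-- The clock only moves forward, so the value is zero once the initial time is past the support of
`ψ`; in space it is dominated by the semigroup applied to a cutoff, which vanishes at infinity. -/
lemma WeakFeller.tendsto_killedOp_univ_cocompact {M : StandardMarkovProcess E Ω}
    (hM : M.WeakFeller) (x₀ : E) (ψ : C_c(ℝ≥0 × E, ℝ)) (t : ℝ≥0) :
    Tendsto (M.killedOp univ ψ t) (cocompact (ℝ≥0 × E)) (𝓝 0) := by
  obtain ⟨C, hC0, hC⟩ := (bddMeas_compactlySupported ψ).exists_pos_bound
  have hK := ψ.hasCompactSupport.isCompact
  obtain ⟨r, hr⟩ := hK.isBounded.subset_closedBall ((0 : ℝ≥0), x₀)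
  obtain ⟨n, hn⟩ := exists_nat_ge r
  have hzero : ∀ z : ℝ≥0 × E, (n : ℝ) < dist z (0, x₀) → ψ z = 0 := fun z hz => by
    by_contra h
    exact absurd ((hr (subset_tsupport ψ h)).trans hn) (not_le.2 hz)
  obtain ⟨k, hk⟩ := hM t (mulCutoff x₀ 1 n : C₀(E, ℝ))
  have hle : ∀ z, |M.killedOp univ ψ t z| ≤ C * k z.2 := by
    intro z
    rw [M.killedOp_eq_stoppedSemigroup isOpen_univ (bddMeas_compactlySupported ψ).1 t z,
      stoppedSemigroup_univ, hk, ← integral_const_mul, ← Real.norm_eq_abs]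
    refine norm_integral_le_of_norm_le ((((bddMeas_compactlySupported (mulCutoff x₀ 1 n)).comp
      (M.measurable_X t)).integrable _).const_mul C) (Eventually.of_forall fun ω => ?_)
    change |_| ≤ C * mulCutoff x₀ 1 n (M.X t ω)
    by_cases h : dist (M.X t ω) x₀ ≤ n
    · rw [mulCutoff_one_of_dist_le h, mul_one]
      exact hC _
    · rw [hzero _ ((not_le.1 h).trans_le (le_max_right _ _)), abs_zero]
      exact mul_nonneg hC0.le (mulCutoff_one_nonneg _ _ _)
  have hle' : ∀ z : ℝ≥0 × E, n < z.1 → M.killedOp univ ψ t z = 0 := by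
    intro z hz
    rw [M.killedOp_eq_stoppedSemigroup isOpen_univ (bddMeas_compactlySupported ψ).1 t z,
      stoppedSemigroup_univ]
    have : ∀ ω, ψ (z.1 + t, M.X t ω) = 0 := fun ω => by
      refine hzero _ (lt_of_lt_of_le ?_ (le_max_left _ _))
      change (n : ℝ) < dist (z.1 + t) 0
      rw [NNReal.dist_eq, NNReal.coe_zero, sub_zero, NNReal.abs_eq, NNReal.coe_add]
      exact lt_add_of_lt_of_nonneg (by exact_mod_cast hz) t.2
    simp [this]
  rw [Metric.tendsto_nhds]
  intro ε hε
  have h1 := Metric.tendsto_nhds.1 (zero_at_infty k) (ε / C) (by positivity)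
  obtain ⟨K, hK, hKε⟩ := mem_cocompact.1 h1
  refine mem_cocompact.2 ⟨Icc 0 (n : ℝ≥0) ×ˢ K, isCompact_Icc.prod hK, fun z hz => ?_⟩
  change dist _ _ < ε
  rw [Real.dist_eq, sub_zero]
  by_cases hz1 : (n : ℝ≥0) < z.1
  · rw [hle' z hz1, abs_zero]
    exact hε
  · have hz2 : z.2 ∉ K := fun h => hz ⟨⟨zero_le, not_lt.1 hz1⟩, h⟩
    have h2 : dist (k z.2) 0 < ε / C := hKε hz2
    rw [Real.dist_eq, sub_zero] at h2
    refine (hle z).trans_lt ?_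
    calc C * k z.2 ≤ C * |k z.2| := mul_le_mul_of_nonneg_left (le_abs_self _) hC0.le
      _ < C * (ε / C) := mul_lt_mul_of_pos_left h2 hC0
      _ = ε := by field_simp

lemma WeakFeller.tendsto_resolvent_univ_cocompact {M : StandardMarkovProcess E Ω}
    (hM : M.WeakFeller) (x₀ : E) {α : ℝ} (hα : 0 < α) (ψ : C_c(ℝ≥0 × E, ℝ)) :
    Tendsto (M.resolvent univ α ψ) (cocompact (ℝ≥0 × E)) (𝓝 0) := by
  have hψ := bddMeas_compactlySupported ψ
  obtain ⟨C, hC0, hC⟩ := hψ.exists_pos_bound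
  have := isCountablyGenerated_cocompact ((0 : ℝ≥0), x₀)
  have h : Tendsto (M.resolvent univ α ψ) (cocompact (ℝ≥0 × E))
      (𝓝 (∫ _ in Ioi (0 : ℝ), (0 : ℝ))) := by
    refine tendsto_integral_filter_of_dominated_convergence (fun u => Real.exp (-α * u) * C)
      (Eventually.of_forall fun z => (M.integrableOn_resolvent isOpen_univ hα hψ z).1)
      (Eventually.of_forall fun z => Eventually.of_forall fun u => ?_)
      ((integrableOn_exp_neg_mul hα).mul_const _) (Eventually.of_forall fun u => ?_)
    · rw [Real.norm_eq_abs, abs_mul, abs_of_nonneg (Real.exp_nonneg _)]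
      exact mul_le_mul_of_nonneg_left (M.abs_killedOp_le univ hC0.le hC _ _) (Real.exp_nonneg _)
    · simpa using (hM.tendsto_killedOp_univ_cocompact x₀ ψ u.toNNReal).const_mul
        (Real.exp (-α * u))
  simpa using h

/-- The discounted law of the exit time and place. -/
noncomputable def exitLaw (M : StandardMarkovProcess E Ω) (O : Set E) (α : ℝ) (z : ℝ≥0 × E) :
    Measure (ℝ≥0 × E) :=
  ((M.P z.2).withDensity fun ω => ENNReal.ofReal (discount α (M.exitTime O ω))).map
    fun ω => (z.1 + (M.exitTime O ω).untopA, stoppedValue M.X (M.exitTime O) ω)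

lemma exitValue_eq_integral (M : StandardMarkovProcess E Ω) {O : Set E} (hO : IsOpen O) (α : ℝ)
    {H : ℝ≥0 × E → ℝ} (hH : Measurable H) (z : ℝ≥0 × E) :
    M.exitValue O α H z = ∫ y, H y ∂(M.exitLaw O α z) := by
  have hE := M.isStoppingTime_exitTime hO
  have hd : Measurable fun ω => ENNReal.ofReal (discount α (M.exitTime O ω)) :=
    ((measurable_discount α).comp hE.measurable').ennreal_ofReal
  rw [exitLaw, integral_map (M.measurable_stoppedPair hE z.1).aemeasurable hH.aestronglyMeasurable,
    integral_withDensity_eq_integral_toReal_smul hd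
      (Eventually.of_forall fun _ => ENNReal.ofReal_lt_top)]
  simp_rw [ENNReal.toReal_ofReal (discount_nonneg _ _)]
  rfl

lemma exitLaw_univ_le (M : StandardMarkovProcess E Ω) {O : Set E} (hO : IsOpen O) {α : ℝ}
    (hα : 0 < α) (z : ℝ≥0 × E) : M.exitLaw O α z univ ≤ 1 := by
  rw [exitLaw, Measure.map_apply (M.measurable_stoppedPair (M.isStoppingTime_exitTime hO) z.1) .univ,
    preimage_univ, withDensity_apply _ .univ, Measure.restrict_univ]
  calc ∫⁻ ω, ENNReal.ofReal (discount α (M.exitTime O ω)) ∂(M.P z.2)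
      ≤ ∫⁻ _, 1 ∂(M.P z.2) := lintegral_mono fun ω => by
        simpa using discount_le_one hα (M.exitTime O ω)
    _ = 1 := by simp

lemma killedOp_univ_const (M : StandardMarkovProcess E Ω) (c : ℝ) (t : ℝ≥0) (z : ℝ≥0 × E) :
    M.killedOp univ (fun _ => c) t z = c := by
  rw [M.killedOp_eq_stoppedSemigroup isOpen_univ measurable_const t z, stoppedSemigroup_univ]
  simp

/-- Since the process is conservative, the constant `1` is in the range of `U_α`; this controls the
total mass of the exit law. -/
lemma resolvent_univ_const (M : StandardMarkovProcess E Ω) {α : ℝ} (hα : 0 < α) (z : ℝ≥0 × E) :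
    M.resolvent univ α (fun _ => α) z = 1 := by
  simp_rw [resolvent, M.killedOp_univ_const]
  rw [integral_mul_const, integral_exp_neg_mul hα]
  field_simp

/-- Continuity of the expected discounted payoff at the exit from `O`. -/
lemma WeakFeller.continuous_exitValue {M : StandardMarkovProcess E Ω} (hM : M.WeakFeller)
    {O : Set E} (hO : IsOpen O) (hF : M.StoppedFeller O) {α : ℝ} (hα : 0 < α)
    (H : ℝ≥0 × E →ᵇ ℝ) : Continuous (M.exitValue O α H) := by
  have hU := hM.stoppedFeller_univ
  -- For terminal data in the range of `U_α` the exit value is a difference of two continuous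
  -- resolvents.
  have hcont : ∀ g : ℝ≥0 × E →ᵇ ℝ, Continuous (M.exitValue O α (M.resolvent univ α g)) := by
    intro g
    rw [funext (M.exitValue_resolvent_univ hO hα (.of_bcf g))]
    exact (hU.continuous_resolvent isOpen_univ hα g).sub (hF.continuous_resolvent hO hα g)
  have hfin : ∀ z, IsFiniteMeasure (M.exitLaw O α z) := fun z =>
    ⟨(M.exitLaw_univ_le hO hα z).trans_lt ENNReal.one_lt_top⟩
  refine continuous_iff_continuousAt.2 fun z₀ => ?_
  rw [ContinuousAt, funext (M.exitValue_eq_integral hO α H.continuous.measurable)]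
  have := hfin z₀
  refine tendsto_integral_of_vague z₀ (l := 𝓝 z₀) (m := M.exitLaw O α) (m' := M.exitLaw O α z₀) (fun ψ => ?_) ?_ H
  · refine tendsto_integral_of_boundedly_dense z₀ (M.exitLaw_univ_le hO hα)
      (M.exitLaw_univ_le hO hα z₀) (D := {φ | Continuous (M.exitValue O α φ)}) (fun φ hφ => ?_)
      (fun ψ => ?_) ψ
    · simp_rw [← M.exitValue_eq_integral hO α (H := φ) φ.continuous.measurable]
      exact hφ.tendsto z₀
    · have hγ : ∀ n : ℕ, α < n + 1 + α := fun n => by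
        have : (0 : ℝ) ≤ n := n.cast_nonneg
        linarith
      have hγ0 := fun n => hα.trans (hγ n)
      let b := ψ.toBoundedContinuousFunction
      -- The approximants γU_γψ, with γ = n + 1 + α, lie in the range of `U_α` on continuous
      -- functions, and vanish at infinity because `ψ` has compact support.
      let φ : ℕ → C₀(ℝ≥0 × E, ℝ) := fun n =>
        { toFun := fun z => (n + 1 + α) * M.resolvent univ (n + 1 + α) ψ z
          continuous_toFun := (hU.continuous_resolvent isOpen_univ (hγ0 n) b).const_mul _
          zero_at_infty' := by
            simpa using (hM.tendsto_resolvent_univ_cocompact z₀.2 (hγ0 n) ψ).const_mul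
              ((n : ℝ) + 1 + α) }
      refine ⟨φ, fun n => ?_, ⟨‖b‖, fun n z => ?_⟩, fun z => ?_⟩
      · have e := M.mul_resolvent_univ_eq hα (hγ n) (bddMeas_compactlySupported ψ)
        change Continuous (M.exitValue O α
          fun z => ((n : ℝ) + 1 + α) * M.resolvent univ (n + 1 + α) ψ z)
        rw [e]
        exact hcont (((n : ℝ) + 1 + α) • b + (-(((n : ℝ) + 1 + α) * ((n + 1 + α) - α))) •
          hU.resolventBCF isOpen_univ (hγ0 n) b)
      · change |((n : ℝ) + 1 + α) * M.resolvent univ (n + 1 + α) ψ z| ≤ ‖b‖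
        rw [abs_mul, abs_of_pos (hγ0 n), mul_comm, ← le_div_iff₀ (hγ0 n)]
        exact M.abs_resolvent_le univ (hγ0 n) (norm_nonneg _) (fun z => b.norm_coe_le_norm z) z
      · refine (M.tendsto_mul_resolvent isOpen_univ b z.1 (mem_univ z.2)).comp ?_
        exact tendsto_atTop_add_const_right _ _ (tendsto_atTop_add_const_right _ _
          tendsto_natCast_atTop_atTop)
  · have e : ∀ z, (M.exitLaw O α z).real univ = M.exitValue O α (M.resolvent univ α
        (BoundedContinuousFunction.const (ℝ≥0 × E) α)) z := by
      intro z
      have e1 : M.resolvent univ α (BoundedContinuousFunction.const (ℝ≥0 × E) α) = fun _ => 1 :=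
        funext fun z => M.resolvent_univ_const hα z
      rw [e1, M.exitValue_eq_integral hO α measurable_const]
      simp
    simp_rw [e]
    exact (hcont _).tendsto z₀

end StandardMarkovProcess

end

/-! ### The penalized equation and its comparison with stopping -/

/-- A function bounded above is nonpositive if its upper bounds contract. -/
lemma nonpos_of_forall_bound_contracts {Z : Type*} {d : Z → ℝ} (hd : ∃ C, ∀ z, d z ≤ C) {k : ℝ}
    (hk0 : 0 ≤ k) (hk1 : k < 1)
    (h : ∀ C, 0 ≤ C → (∀ z, d z ≤ C) → ∀ z, d z ≤ k * C) (z : Z) : d z ≤ 0 := by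
  obtain ⟨C, hC⟩ := hd
  have hn : ∀ n : ℕ, ∀ z, d z ≤ k ^ n * max C 0 := by
    intro n
    induction n with
    | zero => exact fun z => by simpa using Or.inl (hC z)
    | succ n ih =>
      intro z
      rw [pow_succ', mul_assoc]
      exact h _ (by positivity) ih z
  have hlim := (tendsto_pow_atTop_nhds_zero_of_lt_one hk0 hk1).mul_const (max C 0)
  rw [zero_mul] at hlim
  exact ge_of_tendsto' hlim fun n => hn n z

/-- The decreasing penalty becomes increasing in the unknown once the unknown itself is added;
monotonicity of the fixed point map rests on this. -/
lemma max_sub_zero_add_self (a b : ℝ) : max (a - b) 0 + b = max a b := by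
  rcases le_total a b with h | h
  · rw [max_eq_right (sub_nonpos.2 h), max_eq_right h, zero_add]
  · rw [max_eq_left (sub_nonneg.2 h), max_eq_left h, sub_add_cancel]

lemma bddMeas_penalized {Z : Type*} [MeasurableSpace Z] {f G u : Z → ℝ} (hf : BddMeas f) (hG : BddMeas G) (hu : BddMeas u)
    (β : ℝ) : BddMeas fun z => f z + β * max (G z - u z) 0 :=
  hf.add (((hG.sub hu).max (.const 0)).const_mul β)

namespace StandardMarkovProcess

variable {E Ω : Type*} [MetricSpace E] [MeasurableSpace E] [MeasurableSpace Ω]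

lemma runningIntegral_mono [BorelSpace E] (M : StandardMarkovProcess E Ω) {α : ℝ} (hα : 0 < α)
    {f g : ℝ≥0 × E → ℝ} (hf : BddMeas f) (hg : BddMeas g) (s : ℝ≥0) (T : WithTop ℝ≥0) (ω : Ω)
    (h : ∀ t : ℝ≥0, (t : WithTop ℝ≥0) < T → f (s + t, M.X t ω) ≤ g (s + t, M.X t ω)) :
    M.runningIntegral α f s T ω ≤ M.runningIntegral α g s T ω := by
  have hm : MeasurableSet {u : ℝ | (u.toNNReal : WithTop ℝ≥0) < T} :=
    measurableSet_lt (by fun_prop) measurable_const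
  rw [runningIntegral_eq, runningIntegral_eq]
  refine integral_mono ((M.integrableOn_path hα hf s ω).indicator hm)
    ((M.integrableOn_path hα hg s ω).indicator hm) fun u => ?_
  refine indicator_le_indicator' fun hu => ?_
  exact mul_le_mul_of_nonneg_left (h _ hu) (Real.exp_nonneg _)

lemma isLUB_value (M : StandardMarkovProcess E Ω) (O : Set E) {α : ℝ} (hα : 0 < α)
    (f G H : ℝ≥0 × E →ᵇ ℝ) (z : ℝ≥0 × E) :
    IsLUB {r | ∃ τ, IsStoppingTime M.filt τ ∧ r = M.payoff O α f G H z.1 z.2 τ}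
      (M.value O α f G H z) := by
  refine isLUB_csSup ⟨_, _, isStoppingTime_top M.filt, rfl⟩ ⟨‖f‖ / α + (‖G‖ + ‖H‖), ?_⟩
  rintro r ⟨τ, -, rfl⟩
  exact (le_abs_self _).trans (M.abs_payoff_le O hα (fun z => f.norm_coe_le_norm z)
    (fun z => (G.norm_coe_le_norm z).trans (le_add_of_nonneg_right (norm_nonneg _)))
    (fun z => (H.norm_coe_le_norm z).trans (le_add_of_nonneg_left (norm_nonneg _))) _ _ _)

section

variable [BorelSpace E] [SecondCountableTopology E]

lemma resolvent_sub (M : StandardMarkovProcess E Ω) {O : Set E} (hO : IsOpen O) {α : ℝ}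
    (hα : 0 < α) {g h : ℝ≥0 × E → ℝ} (hg : BddMeas g) (hh : BddMeas h) (z : ℝ≥0 × E) :
    M.resolvent O α (fun y => g y - h y) z = M.resolvent O α g z - M.resolvent O α h z := by
  have e : (fun y => g y - h y) = fun y => g y + (-1) * h y := by ext y; ring
  rw [e, M.resolvent_add_mul hO hα hg hh]
  ring

lemma resolvent_sub_le (M : StandardMarkovProcess E Ω) {O : Set E} (hO : IsOpen O) {α : ℝ}
    (hα : 0 < α) {g h : ℝ≥0 × E → ℝ} (hg : BddMeas g) (hh : BddMeas h) {C : ℝ} (hC0 : 0 ≤ C)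
    (hC : ∀ z, g z - h z ≤ C) (z : ℝ≥0 × E) :
    M.resolvent O α g z - M.resolvent O α h z ≤ C / α := by
  rw [← M.resolvent_sub hO hα hg hh]
  refine (M.resolvent_mono hO hα (hg.sub hh) (.const C) hC z).trans ?_
  exact (le_abs_self _).trans
    (M.abs_resolvent_le O hα hC0 (fun _ => (abs_of_nonneg hC0).le) z)

/-- Change of the discount rate in the linear equation. -/
lemma resolvent_add_exitValue_identity (M : StandardMarkovProcess E Ω) {O : Set E} (hO : IsOpen O)
    {α β : ℝ} (hα : 0 < α) (hβ : 0 < β) {g v : ℝ≥0 × E → ℝ} (hg : BddMeas g) (H : ℝ≥0 × E →ᵇ ℝ)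
    (hv : ∀ z, v z = M.resolvent O α g z + M.exitValue O α H z) (z : ℝ≥0 × E) :
    v z = M.resolvent O (α + β) (fun z => g z + β * v z) z + M.exitValue O (α + β) H z := by
  have hγ : α < α + β := lt_add_of_pos_right α hβ
  have hγ0 := hα.trans hγ
  have hR := M.bddMeas_resolvent hO hα hg
  have hh := M.bddMeas_exitValue hO hα H
  have hv' : BddMeas v := funext hv ▸ hR.add hh
  have e : M.resolvent O (α + β) v z = M.resolvent O (α + β) (M.resolvent O α g) z +
      M.resolvent O (α + β) (M.exitValue O α H) z := by
    have h := M.resolvent_add_mul hO hγ0 hR hh 1 z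
    simp only [one_mul, ← hv] at h
    exact h
  rw [M.resolvent_add_mul hO hγ0 hg hv', e, hv z, M.resolvent_identity hO hα hγ hg,
    M.exitValue_identity hO hα hγ H]
  ring

/-- The penalized equation with the penalty absorbed into the discount rate. -/
lemma isPenalizedSolution_iff_add (M : StandardMarkovProcess E Ω) {O : Set E} (hO : IsOpen O)
    {α : ℝ} (hα : 0 < α) {f G : ℝ≥0 × E → ℝ} (hf : BddMeas f) (hG : BddMeas G)
    (H : ℝ≥0 × E →ᵇ ℝ) {β : ℝ} (hβ : 0 < β) (u : ℝ≥0 × E → ℝ) :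
    M.IsPenalizedSolution O α f G H β u ↔ BddMeas u ∧ ∀ z, u z =
      M.resolvent O (α + β) (fun z => f z + β * max (G z) (u z)) z +
        M.exitValue O (α + β) H z := by
  rw [M.isPenalizedSolution_iff hO hα hf hG (.of_bcf H)]
  refine and_congr_right fun hu => ?_
  have hg := bddMeas_penalized hf hG hu β
  have hγ0 : 0 < α + β := add_pos hα hβ
  have e : (fun z => f z + β * max (G z) (u z)) =
      fun z => (f z + β * max (G z - u z) 0) + β * u z := by
    ext z
    rw [add_assoc, ← mul_add, max_sub_zero_add_self]
  refine ⟨fun h z => ?_, fun h => ?_⟩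
  · rw [e]
    exact M.resolvent_add_exitValue_identity hO hα hβ hg H h z
  -- Freeze `u` in the penalty and let `v` be the right side at rate `α`. Both `u` and `v` solve the
  -- same linear equation at rate `α + β`, which is uniquely solvable by contraction.
  · set v : ℝ≥0 × E → ℝ := fun z => M.resolvent O α (fun z => f z + β * max (G z - u z) 0) z +
      M.exitValue O α H z with hv
    have hvb : BddMeas v := (M.bddMeas_resolvent hO hα hg).add (M.bddMeas_exitValue hO hα H)
    have h' : ∀ z, v z = M.resolvent O (α + β)
        (fun z => (f z + β * max (G z - u z) 0) + β * v z) z + M.exitValue O (α + β) H z :=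
      M.resolvent_add_exitValue_identity hO hα hβ hg H fun z => rfl
    rw [e] at h
    have hk : β / (α + β) < 1 := (div_lt_one hγ0).2 (lt_add_of_pos_left β hα)
    have hk0 : 0 ≤ β / (α + β) := by positivity
    have key : ∀ a b : ℝ≥0 × E → ℝ, BddMeas a → BddMeas b →
        (∀ z, a z = M.resolvent O (α + β)
          (fun z => (f z + β * max (G z - u z) 0) + β * a z) z + M.exitValue O (α + β) H z) →
        (∀ z, b z = M.resolvent O (α + β)
          (fun z => (f z + β * max (G z - u z) 0) + β * b z) z + M.exitValue O (α + β) H z) →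
        ∀ z, a z ≤ b z := by
      intro a b ha hb hae hbe z
      refine sub_nonpos.1 (nonpos_of_forall_bound_contracts (d := fun z => a z - b z) ?_ hk0 hk
        (fun C hC0 hC z => ?_) z)
      · obtain ⟨C, hC⟩ := (ha.sub hb).2
        exact ⟨C, fun z => (le_abs_self _).trans (hC z)⟩
      · rw [hae z, hbe z, add_sub_add_right_eq_sub, div_mul_eq_mul_div]
        refine M.resolvent_sub_le hO hγ0 (hg.add (ha.const_mul β)) (hg.add (hb.const_mul β))
          (by positivity) (fun z => ?_) z
        rw [add_sub_add_left_eq_sub, ← mul_sub]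
        exact mul_le_mul_of_nonneg_left (hC z) hβ.le
    exact fun z => le_antisymm (key u v hu hvb h h' z) (key v u hvb hu h' h z)

/-- Solutions of the penalized equations are unique and monotone in the penalty. -/
lemma IsPenalizedSolution.le {M : StandardMarkovProcess E Ω} {O : Set E} (hO : IsOpen O)
    {α : ℝ} (hα : 0 < α) {f G : ℝ≥0 × E → ℝ} (hf : BddMeas f) (hG : BddMeas G)
    {H : ℝ≥0 × E →ᵇ ℝ} {β β' : ℝ} (hβ : 0 < β) (hββ' : β ≤ β') {u u' : ℝ≥0 × E → ℝ}
    (hu : M.IsPenalizedSolution O α f G H β u) (hu' : M.IsPenalizedSolution O α f G H β' u')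
    (z : ℝ≥0 × E) : u z ≤ u' z := by
  have hβ' : 0 < β' := hβ.trans_le hββ'
  have hγ0 : 0 < α + β' := add_pos hα hβ'
  obtain ⟨hub, hue⟩ := (M.isPenalizedSolution_iff hO hα hf hG (.of_bcf H) β u).1 hu
  obtain ⟨hub', hue'⟩ := (M.isPenalizedSolution_iff_add hO hα hf hG H hβ' u').1 hu'
  have hg := bddMeas_penalized hf hG hub β
  -- The equation for `u`, with penalty `β`, is also moved to the rate `α + β'`, so that both
  -- solutions involve the same resolvent.
  have hue2 := M.resolvent_add_exitValue_identity hO hα hβ' hg H hue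
  refine sub_nonpos.1 (nonpos_of_forall_bound_contracts (d := fun z => u z - u' z)
    (k := β' / (α + β')) ?_ (by positivity) ((div_lt_one hγ0).2 (lt_add_of_pos_left β' hα))
    (fun C hC0 hC z => ?_) z)
  · obtain ⟨C, hC⟩ := (hub.sub hub').2
    exact ⟨C, fun z => (le_abs_self _).trans (hC z)⟩
  · rw [hue2 z, hue' z, add_sub_add_right_eq_sub, div_mul_eq_mul_div]
    refine M.resolvent_sub_le hO hγ0 (hg.add (hub.const_mul β'))
      (hf.add ((hG.max hub').const_mul β')) (by positivity) (fun z => ?_) z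
    -- In all, β(G - u)⁺ + β'u ≤ β' max(G, u) ≤ β'(max(G, u') + C).
    have h1 : β * max (G z - u z) 0 ≤ β' * max (G z - u z) 0 :=
      mul_le_mul_of_nonneg_right hββ' (le_max_right _ _)
    have h2 : max (G z - u z) 0 + u z ≤ max (G z) (u' z) + C := by
      rw [max_sub_zero_add_self]
      refine max_le (le_add_of_le_of_nonneg (le_max_left _ _) hC0) ?_
      linarith [hC z, le_max_right (G z) (u' z)]
    nlinarith [mul_le_mul_of_nonneg_left h2 hβ'.le]

/-- Existence of a bounded continuous solution of the penalized equation. -/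
lemma exists_isPenalizedSolution_bcf [ProperSpace E] {M : StandardMarkovProcess E Ω}
    (hM : M.WeakFeller) {O : Set E} (hO : IsOpen O) (hF : M.StoppedFeller O) {α : ℝ} (hα : 0 < α)
    (f G H : ℝ≥0 × E →ᵇ ℝ) {β : ℝ} (hβ : 0 < β) :
    ∃ u : ℝ≥0 × E →ᵇ ℝ, M.IsPenalizedSolution O α f G H β u := by
  have hγ0 : 0 < α + β := add_pos hα hβ
  let h : ℝ≥0 × E →ᵇ ℝ := BoundedContinuousFunction.ofNormedAddCommGroup
    (M.exitValue O (α + β) H) (hM.continuous_exitValue hO hF hγ0 H) ‖H‖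
    (M.abs_exitValue_le O hγ0 (norm_nonneg _) fun z => H.norm_coe_le_norm z)
  -- Continuity of the resolvent and of the exit value makes this a self-map of the complete space
  -- of bounded continuous functions.
  let Ψ : (ℝ≥0 × E →ᵇ ℝ) → (ℝ≥0 × E →ᵇ ℝ) := fun u =>
    hF.resolventBCF hO hγ0 (f + β • (G ⊔ u)) + h
  have hΨ : ∀ u z, Ψ u z = M.resolvent O (α + β) (fun z => f z + β * max (G z) (u z)) z +
      M.exitValue O (α + β) H z := fun u z => rfl
  have hb : ∀ u : ℝ≥0 × E →ᵇ ℝ, BddMeas fun z => f z + β * max (G z) (u z) := fun u =>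
    (BddMeas.of_bcf f).add (((BddMeas.of_bcf G).max (.of_bcf u)).const_mul β)
  have hle : ∀ u v z, Ψ u z - Ψ v z ≤ β / (α + β) * dist u v := by
    intro u v z
    rw [hΨ, hΨ, add_sub_add_right_eq_sub, div_mul_eq_mul_div]
    refine M.resolvent_sub_le hO hγ0 (hb u) (hb v) (by positivity) (fun z => ?_) z
    rw [add_sub_add_left_eq_sub, ← mul_sub]
    refine mul_le_mul_of_nonneg_left ?_ hβ.le
    rw [sub_le_iff_le_add']
    have h1 := (le_abs_self _).trans (BoundedContinuousFunction.dist_coe_le_dist (f := u) (g := v) z)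
    refine max_le (le_add_of_le_of_nonneg (le_max_left _ _) dist_nonneg) ?_
    linarith [le_max_right (G z) (v z)]
  have hΨc : ContractingWith ⟨β / (α + β), (div_pos hβ hγ0).le⟩ Ψ := by
    refine ⟨?_, LipschitzWith.of_dist_le_mul fun u v => ?_⟩
    · change β / (α + β) < 1
      exact (div_lt_one hγ0).2 (lt_add_of_pos_left β hα)
    · refine (BoundedContinuousFunction.dist_le (mul_nonneg (div_pos hβ hγ0).le dist_nonneg)).2 fun z => ?_
      rw [Real.dist_eq, abs_le']
      refine ⟨hle u v z, ?_⟩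
      rw [neg_sub, dist_comm]
      exact hle v u z
  refine ⟨hΨc.fixedPoint, (M.isPenalizedSolution_iff_add hO hα (.of_bcf f) (.of_bcf G) H hβ _).2
    ⟨.of_bcf _, fun z => ?_⟩⟩
  rw [← hΨ, hΨc.fixedPoint_isFixedPt]

/-- The solution of the penalized equation is dominated by the value function. -/
lemma IsPenalizedSolution.exists_le_payoff_add {M : StandardMarkovProcess E Ω} {O : Set E}
    (hO : IsOpen O) {α : ℝ} (hα : 0 < α) {f G H v : ℝ≥0 × E →ᵇ ℝ} {β : ℝ}
    (hv : M.IsPenalizedSolution O α f G H β v) (s : ℝ≥0) (x : E) {ε : ℝ} (hε : 0 < ε) :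
    ∃ τ, IsStoppingTime M.filt τ ∧ v (s, x) ≤ M.payoff O α f G H s x τ + ε := by
  obtain ⟨hvb, hve⟩ := (M.isPenalizedSolution_iff hO hα (.of_bcf f) (.of_bcf G) (.of_bcf H) β v).1 hv
  have hg := bddMeas_penalized (.of_bcf f) (.of_bcf G) hvb β
  -- Strict inequality makes `W` open, so its hitting time is a stopping time. Before it the penalty
  -- vanishes; at it the process is in the closure of `W`, where v ≤ G + ε still holds.
  let W : Set (ℝ≥0 × E) := {z | v z < G z + ε}
  have hW : IsOpen W := isOpen_lt v.continuous (G.continuous.add_const ε)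
  let Y : ℝ≥0 → Ω → ℝ≥0 × E := fun t ω => (s + t, M.X t ω)
  have hY : ∀ ω t, ContinuousWithinAt (fun r => Y r ω) (Ici t) t := fun ω t =>
    (continuous_const.add continuous_id).continuousWithinAt.prodMk (M.right_continuous_paths ω t)
  set τ := hittingAfter Y W 0 with hτ_def
  have hτ : IsStoppingTime M.filt τ := isStoppingTime_hittingAfter_of_isOpen
    (fun t => measurable_const.prodMk (M.adapted t)) hY hW
  refine ⟨τ, hτ, ?_⟩
  rw [M.resolvent_add_exitValue_eq_payoff hO hα hg H hve s x hτ, payoff_eq, payoff_eq]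
  have hi1 := (M.bddMeas_pathPayoff hO hα hg hvb (.of_bcf H) s hτ).integrable (M.P x)
  have hi2 := (M.bddMeas_pathPayoff hO hα (.of_bcf f) (.of_bcf G) (.of_bcf H) s hτ).integrable
    (M.P x)
  have hle : ∀ ω, M.pathPayoff O α (fun z => f z + β * max (G z - v z) 0) v H s τ ω ≤
      M.pathPayoff O α f G H s τ ω + ε := by
    intro ω
    have hrun : M.runningIntegral α (fun z => f z + β * max (G z - v z) 0) s
        (min (τ ω) (M.exitTime O ω)) ω ≤
        M.runningIntegral α f s (min (τ ω) (M.exitTime O ω)) ω := by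
      refine M.runningIntegral_mono hα hg (.of_bcf f) s _ ω fun t ht => ?_
      have h1 : Y t ω ∉ W := notMem_of_lt_hittingAfter (ht.trans_le (min_le_left _ _)) zero_le
      have h2 : G (s + t, M.X t ω) + ε ≤ v (s + t, M.X t ω) := not_lt.1 h1
      rw [max_eq_right (by linarith), mul_zero, add_zero]
    by_cases h : τ ω < M.exitTime O ω
    · rw [M.pathPayoff_of_lt h, M.pathPayoff_of_lt h, add_assoc]
      refine add_le_add hrun ?_
      have hmem : stoppedValue Y τ ω ∈ closure W := mem_closure_hittingAfter (hY ω) h.ne_top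
      have hcl : v (stoppedValue Y τ ω) ≤ G (stoppedValue Y τ ω) + ε :=
        closure_lt_subset_le v.continuous (G.continuous.add_const ε) hmem
      have hcl' : v (s + (τ ω).untopA, stoppedValue M.X τ ω) ≤
        G (s + (τ ω).untopA, stoppedValue M.X τ ω) + ε := hcl
      rw [terminalPayoff, terminalPayoff]
      have h0 := discount_nonneg α (τ ω)
      have h1 := discount_le_one hα (τ ω)
      nlinarith [mul_le_mul_of_nonneg_left hcl' h0]
    · rw [M.pathPayoff_of_not_lt h, M.pathPayoff_of_not_lt h]
      linarith
  refine (integral_mono hi1 (hi2.add (integrable_const ε)) hle).trans_eq ?_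
  simp only [Pi.add_apply]
  rw [integral_add hi2 (integrable_const ε)]
  simp

/-- The penalized value dominates the payoff of stopping with the truncated reward. -/
lemma IsPenalizedSolution.payoff_min_le {M : StandardMarkovProcess E Ω} {O : Set E}
    (hO : IsOpen O) {α : ℝ} (hα : 0 < α) {f G : ℝ≥0 × E → ℝ} (hf : BddMeas f) (hG : BddMeas G)
    {H : ℝ≥0 × E →ᵇ ℝ} {β : ℝ} (hβ : 0 < β) {v : ℝ≥0 × E → ℝ}
    (hv : M.IsPenalizedSolution O α f G H β v) (s : ℝ≥0) (x : E) {τ : Ω → WithTop ℝ≥0}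
    (hτ : IsStoppingTime M.filt τ) :
    M.payoff O α f (fun z => min (G z) (v z)) H s x τ ≤ v (s, x) := by
  obtain ⟨hvb, hve⟩ := (M.isPenalizedSolution_iff hO hα hf hG (.of_bcf H) β v).1 hv
  have hg := bddMeas_penalized hf hG hvb β
  have hmin : BddMeas fun z => min (G z) (v z) := by
    have h := (hG.neg.max hvb.neg).neg
    simpa only [max_neg_neg, neg_neg] using h
  rw [M.resolvent_add_exitValue_eq_payoff hO hα hg H hve s x hτ, payoff_eq, payoff_eq]
  refine integral_mono ((M.bddMeas_pathPayoff hO hα hf hmin (.of_bcf H) s hτ).integrable _)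
    ((M.bddMeas_pathPayoff hO hα hg hvb (.of_bcf H) s hτ).integrable _) fun ω => ?_
  -- Dynkin's formula has turned `v` into a payoff with running reward `f` plus a nonnegative
  -- penalty and stopping reward `v`, each at least its counterpart.
  have hrun := M.runningIntegral_mono hα hf hg s (min (τ ω) (M.exitTime O ω)) ω fun t _ =>
    le_add_of_nonneg_right (mul_nonneg hβ.le (le_max_right _ _))
  by_cases h : τ ω < M.exitTime O ω
  · rw [M.pathPayoff_of_lt h, M.pathPayoff_of_lt h]
    exact add_le_add hrun (mul_le_mul_of_nonneg_left (min_le_right _ _) (discount_nonneg _ _))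
  · rw [M.pathPayoff_of_not_lt h, M.pathPayoff_of_not_lt h]
    exact add_le_add hrun le_rfl

/-- In the limit of large penalties, the solutions dominate the obstacle inside `O`. -/
lemma tendsto_min_penalized (M : StandardMarkovProcess E Ω) {O : Set E}
    (hO : IsOpen O) {α : ℝ} (hα : 0 < α) (f G H : ℝ≥0 × E →ᵇ ℝ) {w : ℝ → ℝ≥0 × E → ℝ}
    (hw : ∀ β, 0 < β → M.IsPenalizedSolution O α f G H β (w β)) (s : ℝ≥0) {x : E} (hx : x ∈ O) :
    Tendsto (fun β => min (G (s, x)) (w β (s, x))) atTop (𝓝 (G (s, x))) := by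
  have hγ : Tendsto (fun β => α + β) atTop atTop := tendsto_atTop_add_const_left _ _ tendsto_id
  have hinv : ∀ C : ℝ, Tendsto (fun β => C / (α + β)) atTop (𝓝 0) := fun C =>
    hγ.const_div_atTop C
  have hsmall : ∀ g : ℝ≥0 × E →ᵇ ℝ,
      Tendsto (fun β => M.resolvent O (α + β) g (s, x)) atTop (𝓝 0) := fun g =>
    squeeze_zero_norm' (by
      filter_upwards [eventually_gt_atTop 0] with β hβ
      exact M.abs_resolvent_le O (add_pos hα hβ) (norm_nonneg _)
        (fun z => g.norm_coe_le_norm z) (s, x)) (hinv ‖g‖)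
  -- The lower bound for `w β` obtained from max(G, w β) ≥ G, with β written as (α + β) - α to
  -- expose the approximate identity γR_γ at γ = α + β.
  have hlow : Tendsto (fun β => M.resolvent O (α + β) f (s, x) +
      ((α + β) * M.resolvent O (α + β) G (s, x) - α * M.resolvent O (α + β) G (s, x)) +
      M.exitValue O (α + β) H (s, x)) atTop (𝓝 (G (s, x))) := by
    have h := ((hsmall f).add (((M.tendsto_mul_resolvent hO G s hx).comp hγ).sub
      ((hsmall G).const_mul α))).add ((M.tendsto_exitValue_atTop hO (.of_bcf H) s hx).comp hγ)
    simpa using h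
  have hlow' := (tendsto_const_nhds (x := G (s, x))).min hlow
  rw [min_self] at hlow'
  refine tendsto_of_tendsto_of_tendsto_of_le_of_le' hlow' tendsto_const_nhds ?_
    (Eventually.of_forall fun β => min_le_left _ _)
  filter_upwards [eventually_gt_atTop 0] with β hβ
  refine min_le_min_left _ ?_
  obtain ⟨hb, he⟩ := (M.isPenalizedSolution_iff_add hO hα (.of_bcf f) (.of_bcf G) H hβ _).1 (hw β hβ)
  rw [he]
  refine add_le_add_left ?_ _
  have h1 := M.resolvent_mono hO (add_pos hα hβ)
    ((BddMeas.of_bcf f).add ((BddMeas.of_bcf G).const_mul β))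
    ((BddMeas.of_bcf f).add (((BddMeas.of_bcf G).max hb).const_mul β))
    (fun z => add_le_add_right (mul_le_mul_of_nonneg_left (le_max_left (G z) (w β z)) hβ.le) _)
    (s, x)
  rw [M.resolvent_add_mul hO (add_pos hα hβ) (.of_bcf f) (.of_bcf G)] at h1
  linarith

/-- The payoffs are bounded by the payoffs of the penalized problems in the limit. -/
lemma tendsto_payoff_min_penalized (M : StandardMarkovProcess E Ω) {O : Set E}
    (hO : IsOpen O) {α : ℝ} (hα : 0 < α) (f G H : ℝ≥0 × E →ᵇ ℝ) {w : ℝ → ℝ≥0 × E → ℝ}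
    (hw : ∀ β, 0 < β → M.IsPenalizedSolution O α f G H β (w β)) (s : ℝ≥0) (x : E)
    {τ : Ω → WithTop ℝ≥0} (hτ : IsStoppingTime M.filt τ) :
    Tendsto (fun β => M.payoff O α f (fun z => min (G z) (w β z)) H s x τ) atTop
      (𝓝 (M.payoff O α f G H s x τ)) := by
  -- Domination: for β ≥ 1 monotonicity bounds `w β` below by `w 1`, and the minimum with `G`
  -- supplies the upper bound.
  have h1b := (M.isPenalizedSolution_iff hO hα (.of_bcf f) (.of_bcf G) (.of_bcf H) 1 _).1
    (hw 1 one_pos)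
  obtain ⟨C, hC0, hC⟩ := h1b.1.exists_pos_bound
  refine M.tendsto_payoff hO hα (.of_bcf f) (D := ‖G‖ + C + ‖H‖) ?_
    (Eventually.of_forall fun _ => ⟨H.continuous.measurable, fun z =>
      (H.norm_coe_le_norm z).trans (by linarith [norm_nonneg G])⟩)
    (fun t y hy => M.tendsto_min_penalized hO hα f G H hw t hy) (fun z => tendsto_const_nhds) s x hτ
  filter_upwards [eventually_ge_atTop 1] with β hβ
  have hβ0 : 0 < β := one_pos.trans_le hβ
  refine ⟨G.continuous.measurable.min (hw β hβ0).1, fun z => ?_⟩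
  have h1 := (hw 1 one_pos).le hO hα (.of_bcf f) (.of_bcf G) one_pos hβ (hw β hβ0) z
  have h2 := abs_le.1 (hC z)
  have h3 := abs_le.1 (G.norm_coe_le_norm z)
  have hH := norm_nonneg H
  have hG := norm_nonneg G
  rw [abs_le]
  refine ⟨le_min (by linarith) (by linarith), (min_le_left _ _).trans (by linarith)⟩

end

/-! ### Convergence to the value function -/

section

variable [ProperSpace E] [BorelSpace E]

lemma existsUnique_isPenalizedSolution {M : StandardMarkovProcess E Ω}
    (hM : M.WeakFeller) {O : Set E} (hO : IsOpen O) (hF : M.StoppedFeller O) {α : ℝ} (hα : 0 < α)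
    (f G H : ℝ≥0 × E →ᵇ ℝ) {β : ℝ} (hβ : 0 < β) :
    ∃! u : ℝ≥0 × E → ℝ, M.IsPenalizedSolution O α f G H β u := by
  obtain ⟨u, hu⟩ := exists_isPenalizedSolution_bcf hM hO hF hα f G H hβ
  refine ⟨u, hu, fun v hv => funext fun z => le_antisymm ?_ ?_⟩
  · exact hv.le hO hα (.of_bcf f) (.of_bcf G) hβ le_rfl hu z
  · exact hu.le hO hα (.of_bcf f) (.of_bcf G) hβ le_rfl hv z

/-- By uniqueness a bounded measurable solution is the continuous fixed point. -/
lemma IsPenalizedSolution.continuous {M : StandardMarkovProcess E Ω}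
    (hM : M.WeakFeller) {O : Set E} (hO : IsOpen O) (hF : M.StoppedFeller O) {α : ℝ} (hα : 0 < α)
    {f G H : ℝ≥0 × E →ᵇ ℝ} {β : ℝ} (hβ : 0 < β) {u : ℝ≥0 × E → ℝ}
    (hu : M.IsPenalizedSolution O α f G H β u) : Continuous u := by
  obtain ⟨v, hv⟩ := exists_isPenalizedSolution_bcf hM hO hF hα f G H hβ
  rw [(existsUnique_isPenalizedSolution hM hO hF hα f G H hβ).unique hu hv]
  exact v.continuous

lemma IsPenalizedSolution.le_value {M : StandardMarkovProcess E Ω}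
    (hM : M.WeakFeller) {O : Set E} (hO : IsOpen O) (hF : M.StoppedFeller O) {α : ℝ} (hα : 0 < α)
    {f G H : ℝ≥0 × E →ᵇ ℝ} {β : ℝ} (hβ : 0 < β) {u : ℝ≥0 × E → ℝ}
    (hu : M.IsPenalizedSolution O α f G H β u) (z : ℝ≥0 × E) : u z ≤ M.value O α f G H z := by
  obtain ⟨v, hv⟩ := exists_isPenalizedSolution_bcf hM hO hF hα f G H hβ
  rw [(existsUnique_isPenalizedSolution hM hO hF hα f G H hβ).unique hu hv]
  refine le_of_forall_pos_le_add fun ε hε => ?_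
  obtain ⟨τ, hτ, hle⟩ := hv.exists_le_payoff_add hO hα z.1 z.2 hε
  exact hle.trans (add_le_add_left ((M.isLUB_value O hα f G H z).1 ⟨τ, hτ, rfl⟩) ε)

/-- The upper bound is `IsPenalizedSolution.le_value`; for the lower one, a single stopping time
with payoff above `a` suffices. -/
lemma tendsto_penalized {M : StandardMarkovProcess E Ω}
    (hM : M.WeakFeller) {O : Set E} (hO : IsOpen O) (hF : M.StoppedFeller O) {α : ℝ} (hα : 0 < α)
    (f G H : ℝ≥0 × E →ᵇ ℝ) {w : ℝ → ℝ≥0 × E → ℝ}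
    (hw : ∀ β, 0 < β → M.IsPenalizedSolution O α f G H β (w β)) (z : ℝ≥0 × E) :
    Tendsto (fun β => w β z) atTop (𝓝 (M.value O α f G H z)) := by
  refine tendsto_order.2 ⟨fun a ha => ?_, fun a ha => ?_⟩
  · obtain ⟨-, ⟨τ, hτ, rfl⟩, hlt⟩ := (lt_isLUB_iff (M.isLUB_value O hα f G H z)).1 ha
    filter_upwards [(M.tendsto_payoff_min_penalized hO hα f G H hw z.1 z.2 hτ).eventually_const_lt
      hlt, eventually_gt_atTop 0] with β h1 hβ
    exact h1.trans_le ((hw β hβ).payoff_min_le hO hα (.of_bcf f) (.of_bcf G) hβ z.1 z.2 hτ)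
  · filter_upwards [eventually_gt_atTop 0] with β hβ
    exact ((hw β hβ).le_value hM hO hF hα hβ z).trans_lt ha

/-- The value function is a supremum of continuous functions. -/
lemma lowerSemicontinuous_value {M : StandardMarkovProcess E Ω}
    (hM : M.WeakFeller) {O : Set E} (hO : IsOpen O) (hF : M.StoppedFeller O) {α : ℝ} (hα : 0 < α)
    (f G H : ℝ≥0 × E →ᵇ ℝ) : LowerSemicontinuous (M.value O α f G H) := by
  choose! w hw using fun (β : ℝ) (hβ : 0 < β) =>
    exists_isPenalizedSolution_bcf hM hO hF hα f G H hβ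
  intro z a ha
  have hlim := tendsto_penalized hM hO hF hα f G H (w := fun β => w β) hw z
  obtain ⟨β, h1, hβ⟩ := ((hlim.eventually_const_lt ha).and (eventually_gt_atTop 0)).exists
  filter_upwards [(w β).continuous.continuousAt.eventually_const_lt h1] with y hy
  exact hy.trans_le ((hw β hβ).le_value hM hO hF hα hβ y)

lemma tendstoUniformlyOn_penalized {M : StandardMarkovProcess E Ω}
    (hM : M.WeakFeller) {O : Set E} (hO : IsOpen O) (hF : M.StoppedFeller O) {α : ℝ} (hα : 0 < α)
    (f G H : ℝ≥0 × E →ᵇ ℝ) (hcont : Continuous (M.value O α f G H)) {w : ℝ → ℝ≥0 × E → ℝ}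
    (hw : ∀ β, 0 < β → M.IsPenalizedSolution O α f G H β (w β)) {K : Set (ℝ≥0 × E)}
    (hK : IsCompact K) : TendstoUniformlyOn w (M.value O α f G H) atTop K := by
  have hpos : ∀ β : ℝ, 0 < max β 1 := fun β => one_pos.trans_le (le_max_right _ _)
  have heq : ∀ᶠ β : ℝ in atTop, w (max β 1) = w β := by
    filter_upwards [eventually_ge_atTop 1] with β hβ
    rw [max_eq_left hβ]
  -- Dini's theorem. Nothing is known about `w β` for β ≤ 0, so the index is replaced by `max β 1`,
  -- which changes nothing near infinity.
  have h := Monotone.tendstoUniformlyOn_of_forall_tendsto (F := fun β : ℝ => w (max β 1))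
    (f := M.value O α f G H) hK
    (fun β => ((hw _ (hpos β)).continuous hM hO hF hα (hpos β)).continuousOn)
    (fun z _ β β' hβ => (hw _ (hpos β)).le hO hα (.of_bcf f) (.of_bcf G) (hpos β)
      (max_le_max_right 1 hβ) (hw _ (hpos β')) z)
    hcont.continuousOn fun z _ => (tendsto_penalized hM hO hF hα f G H hw z).congr'
      (heq.mono fun β hβ => (congrFun hβ z).symm)
  exact h.congr (heq.mono fun β hβ z _ => congrFun hβ z)

end

end StandardMarkovProcess

theorem mainTheorem4 {E Ω : Type*} [MetricSpace E] [ProperSpace E] [MeasurableSpace E]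
    [BorelSpace E] [MeasurableSpace Ω] (M : StandardMarkovProcess E Ω) (hM : M.WeakFeller)
    (O : Set E) (hO : IsOpen O) (hA1 : M.StoppedFeller O) (α : ℝ) (hα : 0 < α)
    (f G H : (ℝ≥0 × E) →ᵇ ℝ) :
    -- the value function is a genuine supremum
    (∀ s x, IsLUB {r | ∃ τ, IsStoppingTime M.filt τ ∧ r = M.payoff O α f G H s x τ}
      (M.value O α f G H (s, x))) ∧
    -- the penalized equations are uniquely solvable
    (∀ β : ℝ, 0 < β → ∃! u : ℝ≥0 × E → ℝ, M.IsPenalizedSolution O α f G H β u) ∧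
    -- monotone pointwise convergence
    (∀ w : ℝ → ℝ≥0 × E → ℝ, (∀ β, 0 < β → M.IsPenalizedSolution O α f G H β (w β)) →
      (∀ β β', 0 < β → β ≤ β' → ∀ z, w β z ≤ w β' z) ∧
      (∀ z, Tendsto (fun β => w β z) atTop (𝓝 (M.value O α f G H z)))) ∧
    -- lower semicontinuity
    LowerSemicontinuous (M.value O α f G H) ∧
    -- uniform convergence on compacts when the value function is continuous
    (Continuous (M.value O α f G H) →
      ∀ w : ℝ → ℝ≥0 × E → ℝ, (∀ β, 0 < β → M.IsPenalizedSolution O α f G H β (w β)) →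
        ∀ K : Set (ℝ≥0 × E), IsCompact K →
          TendstoUniformlyOn w (M.value O α f G H) atTop K) := by
  refine ⟨fun s x => M.isLUB_value O hα f G H (s, x), fun β hβ =>
    StandardMarkovProcess.existsUnique_isPenalizedSolution hM hO hA1 hα f G H hβ,
    fun w hw => ⟨fun β β' hβ hββ' z => (hw β hβ).le hO hα (.of_bcf f) (.of_bcf G) hβ hββ'
      (hw β' (hβ.trans_le hββ')) z,
      StandardMarkovProcess.tendsto_penalized hM hO hA1 hα f G H hw⟩,
    StandardMarkovProcess.lowerSemicontinuous_value hM hO hA1 hα f G H,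
    fun hcont w hw K hK =>
      StandardMarkovProcess.tendstoUniformlyOn_penalized hM hO hA1 hα f G H hcont hw hK⟩
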